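/- Call an interval graph (the intersection graph of a finite family of nonempty open intervals of the real line) \emph{vertebrate} if its independence number equals its number of maximal cliques. The \emph{claw number} of a graph is the largest $w \ge 0$ such that the graph contains the star $K_{1,w}$ as an induced subgraph. For every $v \ge 1$ there is an algorithm running in $2^{O(v^2)}\, n^{O(v)}$ time that, given a vertebrate interval graph $G$ with $n \ge 1$ vertices, decides whether the vertex set of $G$ can be partitioned into two (possibly empty) sets, each inducing a subgraph of claw number at most $v$. More precisely, there are an absolute constant $C$ and a single algorithm (a program for a unit-cost random access machine with addition and subtraction) which, given any $v \ge 1$ and the adjacency matrix of any vertebrate interval graph $G$ with $n \ge 1$ vertices, decides this within $2^{C v^2}\, n^{C v}$ steps. In particular (the case $v = 2$), it can be decided in time polynomial in $n$ whether the vertex set of a given vertebrate interval graph can be partitioned into two sets, each inducing a proper interval graph, i.e. the intersection graph of a family of nonempty open intervals in which no interval properly contains another. -/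

import Mathlib

/-! ### Graph-theoretic notions -/

namespace SimpleGraph

variable {V : Type*}

/-- The open intervals `(l u, r u)` of the real line, all of them nonempty, form an interval
representation of `G`: two distinct vertices are adjacent iff their intervals intersect. -/
def IsIntervalRep (G : SimpleGraph V) (l r : V → ℝ) : Prop :=
  (∀ u, l u < r u) ∧
    ∀ u w, u ≠ w → (G.Adj u w ↔ (Set.Ioo (l u) (r u) ∩ Set.Ioo (l w) (r w)).Nonempty)

/-- An interval graph is the intersection graph of a family of open intervals. -/
def IsIntervalGraph (G : SimpleGraph V) : Prop :=
  ∃ l r : V → ℝ, G.IsIntervalRep l r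

/-- A proper interval graph is the intersection graph of a family of open intervals in which no
interval properly contains another. -/
def IsProperIntervalGraph (G : SimpleGraph V) : Prop :=
  ∃ l r : V → ℝ, G.IsIntervalRep l r ∧
    ∀ u w, ¬ Set.Ioo (l u) (r u) ⊂ Set.Ioo (l w) (r w)

/-- The number of (inclusion-)maximal cliques of `G`. -/
noncomputable def numMaximalCliques (G : SimpleGraph V) : ℕ :=
  Set.ncard {s : Set V | Maximal G.IsClique s}

/-- A vertebrate interval graph: an interval graph in which the maximum size of an independent
set equals the number of maximal cliques. -/
def IsVertebrateIntervalGraph (G : SimpleGraph V) : Prop :=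
  G.IsIntervalGraph ∧ G.indepNum = G.numMaximalCliques

/-- The claw number of `G`: the supremum of all `w` such that the star `K_{1,w}` is an induced
subgraph of `G` (a maximum whenever `G` is finite and nonempty, and `0` for the null graph). -/
noncomputable def clawNumber (G : SimpleGraph V) : ℕ∞ :=
  ⨆ (w : ℕ) (_ : (completeBipartiteGraph (Fin 1) (Fin w)).IsIndContained G), (w : ℕ∞)

/-- The vertices of `G` can be partitioned into two sets, each inducing a subgraph of claw
number at most `v`. -/
def HasTwoPartition (G : SimpleGraph V) (v : ℕ) : Prop :=
  ∃ P : Set V, (G.induce P).clawNumber ≤ v ∧ (G.induce Pᶜ).clawNumber ≤ v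

/-- The vertices of `G` can be partitioned into two sets, each inducing a proper interval
graph. -/
def HasTwoProperIntervalPartition (G : SimpleGraph V) : Prop :=
  ∃ P : Set V, (G.induce P).IsProperIntervalGraph ∧ (G.induce Pᶜ).IsProperIntervalGraph

end SimpleGraph

/-! ### A random access machine with unit costs

The machine has one memory cell `M a` for every address `a : ℕ`, holding a natural number.  A
program is a finite piece of code in a structured language; its only primitive operations are
constants, reading a cell at a computed address (indirect addressing), addition, truncated
subtraction, writing a cell at a computed address, and a test for zero.  Each primitive operation
takes one unit of time.  There is no multiplication, so unit costs are polynomially related to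
the time of a Turing machine. -/

namespace RAM

/-- The contents of the memory. -/
abbrev Mem : Type := ℕ → ℕ

/-- Arithmetic terms: constants, the content of the cell at a computed address, sum, truncated
difference. -/
inductive Term : Type
  | const (c : ℕ) : Term
  | read (a : Term) : Term
  | add (a b : Term) : Term
  | sub (a b : Term) : Term

/-- The value of a term in a memory. -/
def Term.eval (M : Mem) : Term → ℕ
  | .const c => c
  | .read a => M (a.eval M)
  | .add a b => a.eval M + b.eval M
  | .sub a b => a.eval M - b.eval M

/-- The time for evaluating a term: one unit for each operation in it. -/
def Term.cost : Term → ℕ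
  | .const _ => 1
  | .read a => a.cost + 1
  | .add a b => a.cost + b.cost + 1
  | .sub a b => a.cost + b.cost + 1

/-- Programs.  `write a e` stores the value of `e` in the cell whose address is the value
of `a`. -/
inductive Prog : Type
  | skip : Prog
  | write (a e : Term) : Prog
  | seq (p q : Prog) : Prog
  | cond (e : Term) (p q : Prog) : Prog
  | loop (e : Term) (p : Prog) : Prog

/-- `Exec p M t M'`: the program `p`, started in the memory `M`, halts after exactly `t` units of
time in the memory `M'`. -/
inductive Exec : Prog → Mem → ℕ → Mem → Prop
  | skip (M : Mem) : Exec .skip M 1 M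
  | write (a e : Term) (M : Mem) :
      Exec (.write a e) M (a.cost + e.cost + 1) (Function.update M (a.eval M) (e.eval M))
  | seq {p q : Prog} {M M₁ M₂ : Mem} {t₁ t₂ : ℕ} :
      Exec p M t₁ M₁ → Exec q M₁ t₂ M₂ → Exec (.seq p q) M (t₁ + t₂) M₂
  | cond_true {e : Term} {p q : Prog} {M M' : Mem} {t : ℕ} :
      e.eval M ≠ 0 → Exec p M t M' → Exec (.cond e p q) M (e.cost + 1 + t) M'
  | cond_false {e : Term} {p q : Prog} {M M' : Mem} {t : ℕ} :
      e.eval M = 0 → Exec q M t M' → Exec (.cond e p q) M (e.cost + 1 + t) M'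
  | loop_true {e : Term} {p : Prog} {M M₁ M₂ : Mem} {t₁ t₂ : ℕ} :
      e.eval M ≠ 0 → Exec p M t₁ M₁ → Exec (.loop e p) M₁ t₂ M₂ →
        Exec (.loop e p) M (e.cost + 1 + t₁ + t₂) M₂
  | loop_false {e : Term} {p : Prog} {M : Mem} :
      e.eval M = 0 → Exec (.loop e p) M (e.cost + 1) M

/-- Started in the memory `M`, the program `p` halts within time `T` and answers the question
whether `Q` holds, by leaving `1` (yes) or `0` (no) in cell `0`. -/
def Prog.DecidesWithin (p : Prog) (M : Mem) (Q : Prop) (T : ℕ) : Prop :=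
  ∃ (t : ℕ) (M' : Mem), Exec p M t M' ∧ t ≤ T ∧ (Q → M' 0 = 1) ∧ (¬ Q → M' 0 = 0)

/-- The input memory for a graph on the vertices `0, …, n - 1`: cell `1` holds `n`, the cells from
`2` on hold the adjacency matrix row by row, and all other cells (among them cell `0`) hold `0`. -/
noncomputable def graphInput {n : ℕ} (G : SimpleGraph (Fin n)) : Mem := fun a =>
  open Classical in
  if a = 1 then n
  else if ∃ i j : Fin n, a = 2 + (i.val * n + j.val) ∧ G.Adj i j then 1
  else 0

/-- The input memory for a parameter `v` and a graph: as `graphInput`, with `v` in cell `0`. -/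
noncomputable def paramGraphInput {n : ℕ} (v : ℕ) (G : SimpleGraph (Fin n)) : Mem :=
  Function.update (graphInput G) 0 v

end RAM

/-! In a vertebrate interval graph every maximal clique is the closed neighbourhood of a simplicial
vertex, because by counting a maximum independent set meets every maximal clique
(`exists_simplicial_of_indepNum_eq`). Choose one simplicial vertex per twin class and, in a
transitive orientation of the complement, count the chosen vertices before `u` and those not after
`u`. This yields an integer interval model in which every unit interval `[j, j + 1)` occurs
(`near_iff`, `intervalModel`). The orientation itself is computable: orienting each implication
class by its lexicographically least increasing pair is transitive as soon as some transitive
orientation exists (`IsOrient.lex`).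

A partition as required is a two-colouring without a monochromatic claw with `v + 1` leaves. The
unit intervals inside `u` that share its colour are independent leaves, so at most `v` positions of
any interval have the colour of that interval (`cntIn_le_of_good`). Hence a good colouring can be
replaced by a canonical one, determined by the colours of the positions and of those intervals of
length at most `2 * v` whose end positions differ in colour (`good_canon`). All vertices meeting an
interval through a position `t` lie in a window covered by four intervals (`exists_window`). In each
of the four some colour is rare, so at most `21 * v` positions, each with `4 * v + 2` bits, describe
the canonical colouring in the window (`exists_decode`). This leaves `(n * 2 ^ (4 * v + 2)) ^ (21 *
v)` local colourings. A dynamic program over `t` checks the centres starting at `t` and the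
agreement of consecutive windows. The windows containing a given vertex are consecutive, so the
local colourings glue (`exists_good_iff`).

On the machine, `Comp` is a class of functions closed under arithmetic, reading and bounded sums,
hence under bounded quantifiers, with time polynomial in the largest number `Z` involved. Four
tables filled by course-of-values recursion (`exec_tabulate`) hold the implication classes, two
sequences of powers and the dynamic program. Taking the number of codes for `Z` gives the time
bound. For `v = 2`, interval graphs of claw number at most two are exactly the proper interval
graphs. -/

namespace RAM

/-! ### Registers, heaps and functions computable in polynomial time -/

/-- Address of the `i`-th register: a cell on the diagonal of the adjacency matrix or beyond. -/
def reg (n i : ℕ) : ℕ := 2 + i * (n + 1)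

/-- The term for the address of the `i`-th register. -/
def regT : ℕ → Term
  | 0 => .const 2
  | i + 1 => .add (.add (regT i) (.read (.const 1))) (.const 1)

/-- The term for the content of the `i`-th register. -/
def getT (i : ℕ) : Term := .read (regT i)

lemma regT_eval (M : Mem) (i : ℕ) : (regT i).eval M = reg (M 1) i := by
  induction i with
  | zero => simp [regT, Term.eval, reg]
  | succ i ih => simp only [regT, Term.eval, ih, reg]; ring

lemma getT_eval (M : Mem) (i : ℕ) : (getT i).eval M = M (reg (M 1) i) := by
  simp [getT, Term.eval, regT_eval]

lemma reg_inj {n i j : ℕ} : reg n i = reg n j ↔ i = j := by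
  simp [reg]

lemma reg_ne_one (n i : ℕ) : (1 : ℕ) ≠ reg n i := by
  unfold reg; omega

/-- The address `a` is not a register. -/
def OffLane (n a : ℕ) : Prop := ∀ i, a ≠ reg n i

lemma offLane_one (n : ℕ) : OffLane n 1 := fun i => reg_ne_one n i

/-- The memory `M` represents the heap `H`: they agree outside the registers. -/
def Rep (M H : Mem) : Prop := ∀ a, OffLane (H 1) a → M a = H a

lemma Rep.one {M H : Mem} (h : Rep M H) : M 1 = H 1 := h 1 (offLane_one _)

/-- Types of contexts: finitely many natural numbers. -/
class Ctx (Γ : Type) where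
  /-- the number of variables -/
  len : ℕ
  /-- the value of the `i`-th variable -/
  val : Γ → ℕ → ℕ

instance : Ctx Unit := ⟨0, fun _ _ => 0⟩

instance {Γ : Type} [Ctx Γ] : Ctx (Γ × ℕ) :=
  ⟨Ctx.len Γ + 1, fun γ i => if i = Ctx.len Γ then γ.2 else Ctx.val γ.1 i⟩

/-- The variables of the context are stored in the registers `ρ 0, ρ 1, …`. -/
def Holds {Γ : Type} [Ctx Γ] (ρ : ℕ → ℕ) (n : ℕ) (M : Mem) (γ : Γ) : Prop :=
  ∀ i < Ctx.len Γ, M (reg n (ρ i)) = Ctx.val γ i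

/-- `M'` and `M` differ at most in the registers from `e` on. -/
def Frame (n e : ℕ) (M M' : Mem) : Prop := ∀ a, (∀ i, e ≤ i → a ≠ reg n i) → M' a = M a

lemma Frame.refl (n e : ℕ) (M : Mem) : Frame n e M M := fun _ _ => rfl

lemma Frame.trans {n e e' : ℕ} {M M' M'' : Mem} (h : Frame n e M M') (h' : Frame n e' M' M'')
    (he : e ≤ e') : Frame n e M M'' := fun a ha =>
  (h' a fun i hi => ha i (he.trans hi)).trans (h a ha)

lemma Frame.update {n e i : ℕ} {M M' : Mem} (h : Frame n e M M') (hi : e ≤ i) (x : ℕ) :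
    Frame n e M (Function.update M' (reg n i) x) := fun a ha => by
  rw [Function.update_of_ne (ha i hi), h a ha]

lemma Frame.rep {n e : ℕ} {M M' H : Mem} (h : Frame n e M M') (hn : n = H 1) (hr : Rep M H) :
    Rep M' H := fun a ha => by
  subst hn; rw [h a fun i _ => ha i, hr a ha]

lemma Frame.reg {n e i : ℕ} {M M' : Mem} (h : Frame n e M M') (hi : i < e) :
    M' (reg n i) = M (reg n i) :=
  h _ fun j hj hij => by rw [reg_inj] at hij; omega

lemma Frame.holds {Γ : Type} [Ctx Γ] {ρ : ℕ → ℕ} {n e : ℕ} {M M' : Mem} {γ : Γ}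
    (h : Frame n e M M') (hρ : ∀ i < Ctx.len Γ, ρ i < e) (hh : Holds ρ n M γ) :
    Holds ρ n M' γ := fun i hi => by rw [h.reg (hρ i hi), hh i hi]

/-- The function `f` of a heap and a context is computable by a program within time polynomial in
the largest number involved, and has polynomially bounded values. -/
def Comp {Γ : Type} [Ctx Γ] (f : Mem → Γ → ℕ) : Prop :=
  ∀ (ρ : ℕ → ℕ) (e : ℕ), (∀ i < Ctx.len Γ, ρ i < e) → ∃ (p : Prog) (c : ℕ),
    ∀ (H M : Mem) (γ : Γ) (Z : ℕ), 1 ≤ H 1 → Rep M H → Holds ρ (H 1) M γ → 2 ≤ Z →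
      (∀ a, H a ≤ Z) → (∀ i < Ctx.len Γ, Ctx.val γ i ≤ Z) →
      ∃ t M', Exec p M t M' ∧ M' (reg (H 1) e) = f H γ ∧ Frame (H 1) e M M' ∧
        t ≤ Z ^ c ∧ f H γ ≤ Z ^ c

lemma le_pow_self_of_two_le {Z : ℕ} (hZ : 2 ≤ Z) (k : ℕ) : k ≤ Z ^ k :=
  (Nat.lt_pow_self (by omega : 1 < Z)).le

lemma pow_add_pow_le {Z : ℕ} (hZ : 2 ≤ Z) (a b : ℕ) : Z ^ a + Z ^ b ≤ Z ^ (a + b + 1) := by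
  have h1 : 1 ≤ Z ^ a := Nat.one_le_pow _ _ (by omega)
  have h2 : 1 ≤ Z ^ b := Nat.one_le_pow _ _ (by omega)
  calc Z ^ a + Z ^ b ≤ 2 * (Z ^ a * Z ^ b) := by nlinarith
    _ ≤ Z * (Z ^ a * Z ^ b) := Nat.mul_le_mul_right _ hZ
    _ = Z ^ (a + b + 1) := by ring

lemma add_le_pow {Z x y a b : ℕ} (hZ : 2 ≤ Z) (hx : x ≤ Z ^ a) (hy : y ≤ Z ^ b) :
    x + y ≤ Z ^ (a + b + 1) := (Nat.add_le_add hx hy).trans (pow_add_pow_le hZ a b)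

lemma pow_mono {Z x a b : ℕ} (hZ : 2 ≤ Z) (hx : x ≤ Z ^ a) (h : a ≤ b) : x ≤ Z ^ b :=
  hx.trans (Nat.pow_le_pow_right (by omega) h)

/-- Writing the value of a term into the register `e`. -/
lemma exec_writeReg {n e : ℕ} {M : Mem} (h1 : M 1 = n) (T : Term) :
    Exec (.write (regT e) T) M ((regT e).cost + T.cost + 1)
      (Function.update M (reg n e) (T.eval M)) := by
  have := Exec.write (regT e) T M
  rwa [regT_eval, h1] at this

section
variable {Γ : Type} [Ctx Γ]

lemma Comp.congr {f g : Mem → Γ → ℕ} (hf : Comp f) (h : ∀ H γ, g H γ = f H γ) : Comp g := by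
  have : g = f := by funext H γ; exact h H γ
  rwa [this]

/-- A term over the registers holding the variables. -/
lemma Comp.ofTerm {f : Mem → Γ → ℕ} (T : (ℕ → ℕ) → Term) (c₀ : ℕ)
    (hT : ∀ ρ H M γ, Rep M H → Holds ρ (H 1) M γ → (T ρ).eval M = f H γ)
    (hb : ∀ H (γ : Γ) Z, 2 ≤ Z → (∀ a, H a ≤ Z) → (∀ i < Ctx.len Γ, Ctx.val γ i ≤ Z) →
      f H γ ≤ Z ^ c₀) : Comp f := by
  intro ρ e _
  refine ⟨.write (regT e) (T ρ), ((regT e).cost + (T ρ).cost + 1) + c₀, ?_⟩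
  intro H M γ Z _ hr hh hZ hH hγ
  refine ⟨_, _, exec_writeReg hr.one _, ?_, (Frame.refl _ _ _).update le_rfl _, ?_, ?_⟩
  · rw [Function.update_self, hT ρ H M γ hr hh]
  · exact pow_mono hZ (le_pow_self_of_two_le hZ _) (by omega)
  · exact pow_mono hZ (hb H γ Z hZ hH hγ) (by omega)

lemma Comp.const (k : ℕ) : Comp (fun _ (_ : Γ) => k) :=
  .ofTerm (fun _ => .const k) k (fun _ _ _ _ _ _ => rfl)
    fun _ _ _ hZ _ _ => le_pow_self_of_two_le hZ k

lemma Comp.var : Comp (fun _ (γ : Γ × ℕ) => γ.2) := by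
  refine .ofTerm (fun ρ => getT (ρ (Ctx.len Γ))) 1 ?_ ?_
  · intro ρ H M γ hr hh
    have := hh (Ctx.len Γ) (Nat.lt_succ_self _)
    rw [getT_eval, hr.one, this]
    simp [Ctx.val]
  · intro H γ Z _ _ hγ
    have := hγ (Ctx.len Γ) (Nat.lt_succ_self _)
    simpa [Ctx.val] using this

lemma Comp.weaken {f : Mem → Γ → ℕ} (hf : Comp f) : Comp (fun H (γ : Γ × ℕ) => f H γ.1) := by
  intro ρ e hρ
  obtain ⟨p, c, hp⟩ := hf ρ e fun i hi => hρ i (Nat.lt_succ_of_lt hi)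
  refine ⟨p, c, fun H M γ Z h1 hr hh hZ hH hγ => hp H M γ.1 Z h1 hr ?_ hZ hH ?_⟩
  · intro i hi
    rw [hh i (Nat.lt_succ_of_lt hi)]
    simp [Ctx.val, hi.ne]
  · intro i hi
    have := hγ i (Nat.lt_succ_of_lt hi)
    simpa [Ctx.val, hi.ne] using this

lemma Comp.binop {f g : Mem → Γ → ℕ} (T : Term → Term → Term) (op : ℕ → ℕ → ℕ)
    (hT : ∀ a b M, (T a b).eval M = op (a.eval M) (b.eval M))
    (hop : ∀ a b, op a b ≤ a + b) (hf : Comp f) (hg : Comp g) :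
    Comp (fun H γ => op (f H γ) (g H γ)) := by
  intro ρ e hρ
  obtain ⟨p, c, hp⟩ := hf ρ e hρ
  -- Register `e`, which holds the first operand, lies below the frame of the second computation and
  -- survives it.
  obtain ⟨q, c', hq⟩ := hg ρ (e + 1) fun i hi => Nat.lt_succ_of_lt (hρ i hi)
  set k := (regT e).cost + (T (getT e) (getT (e + 1))).cost + 1
  refine ⟨.seq (.seq p q) (.write (regT e) (T (getT e) (getT (e + 1)))),
    (c + c' + 1) + k + 1, ?_⟩
  intro H M γ Z h1 hr hh hZ hH hγ
  obtain ⟨t, M₁, ex, hv, hfr, ht, hb⟩ := hp H M γ Z h1 hr hh hZ hH hγ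
  have hr₁ := hfr.rep rfl hr
  obtain ⟨t', M₂, ex', hv', hfr', ht', hb'⟩ := hq H M₁ γ Z h1 hr₁ (hfr.holds hρ hh) hZ hH hγ
  have hr₂ := hfr'.rep rfl hr₁
  refine ⟨_, _, .seq (.seq ex ex') (exec_writeReg hr₂.one _), ?_,
    (hfr.trans hfr' (Nat.le_succ _)).update le_rfl _, ?_, ?_⟩
  · rw [Function.update_self, hT, getT_eval, getT_eval, hr₂.one, hv', hfr'.reg (Nat.lt_succ_self e),
      hv]
  · exact add_le_pow hZ (add_le_pow hZ ht ht') (le_pow_self_of_two_le hZ k)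
  · exact pow_mono hZ ((hop _ _).trans (add_le_pow hZ hb hb')) (by omega)

lemma Comp.add {f g : Mem → Γ → ℕ} (hf : Comp f) (hg : Comp g) :
    Comp (fun H γ => f H γ + g H γ) :=
  .binop .add (· + ·) (fun _ _ _ => rfl) (fun _ _ => le_rfl) hf hg

lemma Comp.sub {f g : Mem → Γ → ℕ} (hf : Comp f) (hg : Comp g) :
    Comp (fun H γ => f H γ - g H γ) :=
  .binop .sub (· - ·) (fun _ _ _ => rfl) (fun _ _ => (Nat.sub_le _ _).trans (Nat.le_add_right _ _))
    hf hg

/-- Memory and heap agree only outside the registers, hence the condition on the address. -/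
lemma Comp.read {f : Mem → Γ → ℕ} (hf : Comp f)
    (hoff : ∀ H γ, 1 ≤ H 1 → OffLane (H 1) (f H γ)) :
    Comp (fun H γ => H (f H γ)) := by
  intro ρ e hρ
  obtain ⟨p, c, hp⟩ := hf ρ e hρ
  set k := (regT e).cost + (Term.read (getT e)).cost + 1
  refine ⟨.seq p (.write (regT e) (.read (getT e))), c + k + 1, ?_⟩
  intro H M γ Z h1 hr hh hZ hH hγ
  obtain ⟨t, M₁, ex, hv, hfr, ht, hb⟩ := hp H M γ Z h1 hr hh hZ hH hγ
  have hr₁ := hfr.rep rfl hr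
  refine ⟨_, _, .seq ex (exec_writeReg hr₁.one _), ?_, hfr.update le_rfl _, ?_, ?_⟩
  · rw [Function.update_self, Term.eval, getT_eval, hr₁.one, hv, hr₁ _ (hoff H γ h1)]
  · exact add_le_pow hZ ht (le_pow_self_of_two_le hZ k)
  · exact pow_mono hZ (a := 1) (by simpa using hH _) (by omega)

/-- A loop with an invariant and a bound for the time of one round. -/
lemma exec_loop {e : Term} {p : Prog} (I : ℕ → Mem → Prop) (N T : ℕ)
    (hstep : ∀ i < N, ∀ M, I i M →
      e.eval M ≠ 0 ∧ ∃ t M', Exec p M t M' ∧ t ≤ T ∧ I (i + 1) M')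
    (hend : ∀ M, I N M → e.eval M = 0) {M : Mem} (h0 : I 0 M) :
    ∃ t M', Exec (.loop e p) M t M' ∧ I N M' ∧ t ≤ N * (e.cost + 1 + T) + (e.cost + 1) := by
  suffices h : ∀ k i, i + k = N → ∀ M, I i M →
      ∃ t M', Exec (.loop e p) M t M' ∧ I N M' ∧ t ≤ k * (e.cost + 1 + T) + (e.cost + 1) from
    h N 0 (by omega) M h0
  intro k
  induction k with
  | zero =>
    rintro i hi M hM
    obtain rfl : i = N := by omega
    exact ⟨_, _, .loop_false (hend M hM), hM, by omega⟩
  | succ k ih =>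
    intro i hi M hM
    obtain ⟨hne, t, M', ex, ht, hM'⟩ := hstep i (by omega) M hM
    obtain ⟨t', M'', ex', hM'', ht'⟩ := ih (i + 1) (by omega) M' hM'
    refine ⟨_, _, .loop_true hne ex ex', hM'', ?_⟩
    rw [Nat.succ_mul]; omega

lemma holds_extend {ρ : ℕ → ℕ} {n e x : ℕ} {M : Mem} {γ : Γ} (hh : Holds ρ n M γ)
    (hx : M (reg n e) = x) : Holds (Function.update ρ (Ctx.len Γ) e) n M (γ, x) := by
  intro i hi
  by_cases h : i = Ctx.len Γ
  · subst h; simp [Ctx.val, hx]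
  · have : i < Ctx.len Γ := lt_of_le_of_ne (Nat.lt_succ_iff.mp hi) h
    simp [Ctx.val, h, hh i this]

/-- The source of all iteration within `Comp`. The index can be as large as `Z ^ c`, so the summand
is run with the size bound `Z ^ (c + 1)`, and the polynomial bounds compose. -/
lemma Comp.sum {b : Mem → Γ → ℕ} {f : Mem → Γ → ℕ → ℕ} (hb : Comp b)
    (hf : Comp (fun H (γ : Γ × ℕ) => f H γ.1 γ.2)) :
    Comp (fun H γ => ∑ x ∈ Finset.range (b H γ), f H γ x) := by
  intro ρ e hρ
  obtain ⟨p, c, hp⟩ := hb ρ e hρ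
  -- Register `e` holds the number of terms, `e + 1` the partial sum, `e + 2` the index and `e + 3`
  -- the current term.
  obtain ⟨q, c', hq⟩ := hf (Function.update ρ (Ctx.len Γ) (e + 2)) (e + 3) (by
    intro i hi
    by_cases h : i = Ctx.len Γ
    · subst h; simp
    · have := hρ i (lt_of_le_of_ne (Nat.lt_succ_iff.mp hi) h)
      simp [h]; omega)
  set w₁ : Prog := .write (regT (e + 1)) (.const 0) with hw₁
  set w₂ : Prog := .write (regT (e + 2)) (.const 0) with hw₂
  set g : Term := .sub (getT e) (getT (e + 2)) with hg
  set T₃ : Term := .add (getT (e + 1)) (getT (e + 3)) with hT₃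
  set T₄ : Term := .add (getT (e + 2)) (.const 1) with hT₄
  set w₃ : Prog := .write (regT (e + 1)) T₃ with hw₃
  set w₄ : Prog := .write (regT (e + 2)) T₄ with hw₄
  set k₁ := ((regT (e + 1)).cost + (Term.const 0).cost + 1)
  set k₂ := ((regT (e + 2)).cost + (Term.const 0).cost + 1)
  set k₃ := ((regT (e + 1)).cost + T₃.cost + 1)
  set k₄ := ((regT (e + 2)).cost + T₄.cost + 1)
  set k₅ := ((regT e).cost + (getT (e + 1)).cost + 1)
  set k := k₁ + k₂ + (g.cost + 1) + k₅
  set k' := g.cost + 1 + k₃ + k₄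
  set d := (c + 1) * c' + c'
  refine ⟨.seq (.seq (.seq (.seq p w₁) w₂) (.loop g (.seq (.seq q w₃) w₄)))
      (.write (regT e) (getT (e + 1))), c + k + 1 + (c + (d + k' + 1)) + 1, ?_⟩
  intro H M γ Z h1 hr hh hZ hH hγ
  obtain ⟨t₀, M₀, ex₀, hv₀, hfr₀, ht₀, hb₀⟩ := hp H M γ Z h1 hr hh hZ hH hγ
  have hr₀ := hfr₀.rep rfl hr
  set N := b H γ
  set n := H 1
  have ex₁ : Exec w₁ M₀ k₁ _ := exec_writeReg hr₀.one _
  set M₁ := Function.update M₀ (reg n (e + 1)) ((Term.const 0).eval M₀) with hM₁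
  have hfr₁ : Frame n e M M₁ := hfr₀.update (by omega) _
  have hr₁ := hfr₁.rep rfl hr
  have ex₂ : Exec w₂ M₁ k₂ _ := exec_writeReg hr₁.one _
  set M₂ := Function.update M₁ (reg n (e + 2)) ((Term.const 0).eval M₁) with hM₂
  have hfr₂ : Frame n e M M₂ := hfr₁.update (by omega) _
  have hZc : Z ≤ Z ^ (c + 1) := by
    simpa using Nat.pow_le_pow_right (by omega : 0 < Z) (by omega : 1 ≤ c + 1)
  have hctx : ∀ i < N, ∀ j < Ctx.len (Γ × ℕ), Ctx.val (γ, i) j ≤ Z ^ (c + 1) := by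
    intro i hi j hj
    by_cases h : j = Ctx.len Γ
    · simp only [Ctx.val, h, if_true]; exact hi.le.trans (pow_mono hZ hb₀ (by omega))
    · simp only [Ctx.val, h, if_false]
      exact (hγ j (lt_of_le_of_ne (Nat.lt_succ_iff.mp hj) h)).trans hZc
  -- The value bound in `hq` comes only with a memory; a hypothetical one with `x` in the index
  -- register serves.
  have hfb : ∀ x < N, f H γ x ≤ Z ^ d := by
    intro x hx
    have hfrx : Frame n e M (Function.update M (reg n (e + 2)) x) :=
      (Frame.refl n e M).update (by omega) x
    obtain ⟨-, -, -, -, -, -, hle⟩ := hq H _ (γ, x) (Z ^ (c + 1)) h1 (hfrx.rep rfl hr)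
      (holds_extend (hfrx.holds hρ hh) (Function.update_self _ _ _)) (hZ.trans hZc)
      (fun a => (hH a).trans hZc) (hctx x hx)
    rw [← pow_mul] at hle
    exact pow_mono hZ hle (by omega)
  let I : ℕ → Mem → Prop := fun i M' => Frame n e M M' ∧ M' (reg n e) = N ∧
    M' (reg n (e + 1)) = ∑ x ∈ Finset.range i, f H γ x ∧ M' (reg n (e + 2)) = i
  have hI0 : I 0 M₂ := by
    refine ⟨hfr₂, ?_, ?_, ?_⟩
    · rw [hM₂, Function.update_of_ne (by rw [Ne, reg_inj]; omega), hM₁,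
        Function.update_of_ne (by rw [Ne, reg_inj]; omega), hv₀]
    · rw [hM₂, Function.update_of_ne (by rw [Ne, reg_inj]; omega), hM₁, Function.update_self]
      simp [Term.eval]
    · rw [hM₂, Function.update_self]; rfl
  obtain ⟨t₃, M₃, ex₃, ⟨hfr₃, _, hv₃, _⟩, ht₃⟩ := exec_loop (e := g) (p := .seq (.seq q w₃) w₄) I N
    (Z ^ d + k₃ + k₄) (by
      rintro i hi M' ⟨hfr, hvN, hvS, hvi⟩
      have hr' := hfr.rep rfl hr
      refine ⟨?_, ?_⟩
      · rw [hg, Term.eval, getT_eval, getT_eval, hr'.one, hvN, hvi]; omega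
      obtain ⟨t, M₅, ex, hv, hfr', ht, -⟩ := hq H M' (γ, i) (Z ^ (c + 1)) h1 hr'
        (holds_extend (hfr.holds hρ hh) hvi) (hZ.trans hZc) (fun a => (hH a).trans hZc) (hctx i hi)
      have hr₅ := hfr'.rep rfl hr'
      have ex₆ : Exec w₃ M₅ k₃ _ := exec_writeReg hr₅.one _
      set M₆ := Function.update M₅ (reg n (e + 1)) (T₃.eval M₅) with hM₆
      have hfr₆ : Frame n e M M₆ := (hfr.trans hfr' (by omega)).update (by omega) _
      have hr₆ := hfr₆.rep rfl hr
      have ex₇ : Exec w₄ M₆ k₄ _ := exec_writeReg hr₆.one _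
      refine ⟨_, _, .seq (.seq ex ex₆) ex₇, ?_, hfr₆.update (by omega) _, ?_, ?_, ?_⟩
      · rw [← pow_mul] at ht
        have := pow_mono hZ ht (b := d) (by omega)
        omega
      · rw [Function.update_of_ne (by rw [Ne, reg_inj]; omega), hM₆,
          Function.update_of_ne (by rw [Ne, reg_inj]; omega), hfr'.reg (by omega), hvN]
      · rw [Function.update_of_ne (by rw [Ne, reg_inj]; omega), hM₆, Function.update_self, hT₃,
          Term.eval, getT_eval, getT_eval, hr₅.one, hv, hfr'.reg (by omega), hvS,
          Finset.sum_range_succ]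
      · rw [Function.update_self, hT₄, Term.eval, getT_eval, hr₆.one, hM₆,
          Function.update_of_ne (by rw [Ne, reg_inj]; omega), hfr'.reg (by omega), hvi]
        rfl) (by
      rintro M' ⟨hfr, hvN, _, hvi⟩
      rw [hg, Term.eval, getT_eval, getT_eval, (hfr.rep rfl hr).one, hvN, hvi]; omega) hI0
  have hr₃ := hfr₃.rep rfl hr
  have ex₄ : Exec (.write (regT e) (getT (e + 1))) M₃ k₅ _ := exec_writeReg hr₃.one _
  have hNd : N * (Z ^ d + k') ≤ Z ^ (c + (d + k' + 1)) := by
    rw [pow_add Z c]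
    exact Nat.mul_le_mul hb₀ (add_le_pow hZ le_rfl (le_pow_self_of_two_le hZ _))
  refine ⟨_, _, .seq (.seq (.seq (.seq ex₀ ex₁) ex₂) ex₃) ex₄, ?_, hfr₃.update le_rfl _, ?_, ?_⟩
  · rw [Function.update_self, getT_eval, hr₃.one, hv₃]
  · have h2 : t₀ + k ≤ Z ^ (c + k + 1) := add_le_pow hZ ht₀ (le_pow_self_of_two_le hZ _)
    have h3 := add_le_pow hZ h2 hNd
    have h4 : N * (g.cost + 1 + (Z ^ d + k₃ + k₄)) = N * (Z ^ d + k') := by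
      congr 1; omega
    omega
  · have : ∑ x ∈ Finset.range N, f H γ x ≤ N * Z ^ d := by
      simpa using Finset.sum_le_card_nsmul (Finset.range N) _ (Z ^ d)
        fun x hx => hfb x (Finset.mem_range.mp hx)
    refine pow_mono hZ (this.trans ((Nat.mul_le_mul_left _ (Nat.le_add_right _ k')).trans hNd)) ?_
    omega

end

end RAM

/-! ### Arithmetic, Boolean operations and bounded quantifiers -/

namespace RAM

section
variable {Γ : Type} [Ctx Γ]

open Classical in
/-- The truth value of a proposition as a number. -/
noncomputable def ind (P : Prop) : ℕ := if P then 1 else 0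

lemma ind_eq_one {P : Prop} : ind P = 1 ↔ P := by unfold ind; split_ifs <;> simp_all

lemma ind_true {P : Prop} (h : P) : ind P = 1 := by simp [ind, h]

lemma ind_false {P : Prop} (h : ¬ P) : ind P = 0 := by simp [ind, h]

lemma ind_le_one (P : Prop) : ind P ≤ 1 := by unfold ind; split_ifs <;> simp

lemma ind_ne_zero {P : Prop} : ind P ≠ 0 ↔ P := by unfold ind; split_ifs <;> simp_all

lemma ind_congr {P Q : Prop} (h : P ↔ Q) : ind P = ind Q := by rw [propext h]

/-- A predicate whose truth value is computable. -/
def CompP (P : Mem → Γ → Prop) : Prop := Comp (fun H γ => ind (P H γ))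

/-- The machine cannot multiply, so `f` copies of `g` are added. -/
lemma Comp.mul {f g : Mem → Γ → ℕ} (hf : Comp f) (hg : Comp g) :
    Comp (fun H γ => f H γ * g H γ) :=
  (Comp.sum hf (f := fun H γ _ => g H γ) hg.weaken).congr (by simp)

lemma CompP.congr {P Q : Mem → Γ → Prop} (hP : CompP P) (h : ∀ H γ, Q H γ ↔ P H γ) : CompP Q :=
  Comp.congr hP fun H γ => ind_congr (h H γ)

/-- With truncated subtraction, `d - (d - 1)` is the truth value of `0 < d`; here `d = g - f`. -/
lemma CompP.lt {f g : Mem → Γ → ℕ} (hf : Comp f) (hg : Comp g) :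
    CompP (fun H γ => f H γ < g H γ) :=
  ((hg.sub hf).sub ((hg.sub hf).sub (.const 1))).congr fun H γ => by
    unfold ind; split_ifs <;> omega

lemma CompP.not {P : Mem → Γ → Prop} (hP : CompP P) : CompP (fun H γ => ¬ P H γ) :=
  ((Comp.const 1).sub hP).congr fun H γ => by unfold ind; split_ifs <;> simp_all

lemma CompP.and {P Q : Mem → Γ → Prop} (hP : CompP P) (hQ : CompP Q) :
    CompP (fun H γ => P H γ ∧ Q H γ) :=
  (Comp.mul hP hQ).congr fun H γ => by unfold ind; split_ifs <;> simp_all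

lemma CompP.or {P Q : Mem → Γ → Prop} (hP : CompP P) (hQ : CompP Q) :
    CompP (fun H γ => P H γ ∨ Q H γ) :=
  (hP.not.and hQ.not).not.congr fun _ _ => by tauto

lemma CompP.imp {P Q : Mem → Γ → Prop} (hP : CompP P) (hQ : CompP Q) :
    CompP (fun H γ => P H γ → Q H γ) :=
  (hP.not.or hQ).congr fun _ _ => by tauto

lemma CompP.iff {P Q : Mem → Γ → Prop} (hP : CompP P) (hQ : CompP Q) :
    CompP (fun H γ => P H γ ↔ Q H γ) :=
  ((hP.imp hQ).and (hQ.imp hP)).congr fun _ _ => by tauto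

lemma CompP.le {f g : Mem → Γ → ℕ} (hf : Comp f) (hg : Comp g) :
    CompP (fun H γ => f H γ ≤ g H γ) :=
  (CompP.lt hg hf).not.congr fun _ _ => by simp

lemma CompP.eq {f g : Mem → Γ → ℕ} (hf : Comp f) (hg : Comp g) :
    CompP (fun H γ => f H γ = g H γ) :=
  ((CompP.le hf hg).and (CompP.le hg hf)).congr fun _ _ => le_antisymm_iff

lemma CompP.ne {f g : Mem → Γ → ℕ} (hf : Comp f) (hg : Comp g) :
    CompP (fun H γ => f H γ ≠ g H γ) := (CompP.eq hf hg).not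

lemma CompP.ex {b : Mem → Γ → ℕ} {P : Mem → Γ → ℕ → Prop} (hb : Comp b)
    (hP : CompP (fun H (γ : Γ × ℕ) => P H γ.1 γ.2)) :
    CompP (fun H γ => ∃ x < b H γ, P H γ x) :=
  (CompP.lt (.const 0) (Comp.sum hb (f := fun H γ x => ind (P H γ x)) hP)).congr fun H γ => by
    rw [Finset.sum_pos_iff]
    constructor
    · rintro ⟨x, hx, h⟩
      exact ⟨x, Finset.mem_range.mpr hx, by rw [ind_true h]; exact one_pos⟩
    · rintro ⟨x, hx, h⟩
      exact ⟨x, Finset.mem_range.mp hx, ind_ne_zero.mp h.ne'⟩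

lemma CompP.all {b : Mem → Γ → ℕ} {P : Mem → Γ → ℕ → Prop} (hb : Comp b)
    (hP : CompP (fun H (γ : Γ × ℕ) => P H γ.1 γ.2)) :
    CompP (fun H γ => ∀ x < b H γ, P H γ x) :=
  (CompP.ex hb (P := fun H γ x => ¬ P H γ x) hP.not).not.congr fun _ _ => by
    push Not; rfl

/-- The quotient is the number of `x < f` with `(x + 1) * g ≤ f`; the conjunct `0 < g` accounts for
division by zero. -/
lemma Comp.div {f g : Mem → Γ → ℕ} (hf : Comp f) (hg : Comp g) :
    Comp (fun H γ => f H γ / g H γ) := by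
  refine (Comp.sum hf (f := fun H γ x => ind (0 < g H γ ∧ (x + 1) * g H γ ≤ f H γ))
    ((CompP.lt (.const 0) hg.weaken).and
      (CompP.le ((Comp.var.add (.const 1)).mul hg.weaken) hf.weaken))).congr fun H γ => ?_
  rcases Nat.eq_zero_or_pos (g H γ) with h | h
  · simp [h, ind]
  · have : ∀ x, (0 < g H γ ∧ (x + 1) * g H γ ≤ f H γ) ↔ x < f H γ / g H γ := by
      intro x
      rw [← Nat.succ_le_iff (m := x), Nat.le_div_iff_mul_le h]
      simp [h]
    simp_rw [ind, this]
    rw [Finset.sum_ite, Finset.sum_const_zero, add_zero, Finset.sum_const, smul_eq_mul, mul_one]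
    have h2 : (Finset.range (f H γ)).filter (fun x => x < f H γ / g H γ)
        = Finset.range (f H γ / g H γ) := by
      ext x
      simp only [Finset.mem_filter, Finset.mem_range, and_iff_right_iff_imp]
      exact fun hx => hx.trans_le (Nat.div_le_self _ _)
    rw [h2, Finset.card_range]

lemma Comp.mod {f g : Mem → Γ → ℕ} (hf : Comp f) (hg : Comp g) :
    Comp (fun H γ => f H γ % g H γ) :=
  (hf.sub (hg.mul (hf.div hg))).congr fun _ _ => Nat.mod_def _ _

lemma Comp.ite {P : Mem → Γ → Prop} {f g : Mem → Γ → ℕ} (hP : CompP P) (hf : Comp f)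
    (hg : Comp g) : Comp (fun H γ => ind (P H γ) * f H γ + (1 - ind (P H γ)) * g H γ) :=
  (Comp.mul hP hf).add (((Comp.const 1).sub hP).mul hg)

lemma Comp.heapOne : Comp (fun H (_ : Γ) => H 1) :=
  Comp.read (.const 1) fun _ _ _ => offLane_one _

lemma Comp.heapZero : Comp (fun H (_ : Γ) => H 0) :=
  Comp.read (.const 0) fun _ _ _ i => by unfold reg; omega

end

/-! ### The adjacency matrix and the tables -/

/-- The vertices `a` and `b` are adjacent according to the heap. -/
def adjH (H : Mem) (a b : ℕ) : Prop :=
  (a < H 1 ∧ b < H 1 ∧ a ≠ b) ∧ H (2 + (a * H 1 + b)) ≠ 0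

/-- The registers inside the matrix are its diagonal entries, which carry no information about the
graph; all others lie beyond the matrix. -/
lemma offLane_matrix {n a b : ℕ} (ha : a < n) (hb : b < n) (hab : a ≠ b) :
    OffLane n (2 + (a * n + b)) := by
  intro i hi
  unfold reg at hi
  have h : a * n + b = i * n + i := by rw [Nat.mul_succ] at hi; omega
  have hi : i < n := by
    by_contra hni
    push Not at hni
    have h1 : n * n ≤ i * n := Nat.mul_le_mul_right n hni
    have h2 : (a + 1) * n ≤ n * n := Nat.mul_le_mul_right n ha
    rw [Nat.succ_mul] at h2
    omega
  rcases lt_trichotomy a i with hai | rfl | hai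
  · have h2 : (a + 1) * n ≤ i * n := Nat.mul_le_mul_right n hai
    rw [Nat.succ_mul] at h2; omega
  · omega
  · have h2 : (i + 1) * n ≤ a * n := Nat.mul_le_mul_right n hai
    rw [Nat.succ_mul] at h2; omega

/-- Address of the `i`-th entry of the `q`-th table, `q < 4`. -/
def taddr (n q i : ℕ) : ℕ := 3 + (n + 1) * (n + (4 * i + q))

/-- Modulo `n + 1`, registers are congruent to `2` and table addresses to `3`; these differ because
`1 ≤ n`. -/
lemma taddr_offLane {n : ℕ} (hn : 1 ≤ n) (q i : ℕ) : OffLane n (taddr n q i) := by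
  intro j hj
  unfold taddr reg at hj
  have : 1 + (n + 1) * (n + (4 * i + q)) = (n + 1) * j := by rw [mul_comm (n + 1) j]; omega
  have h := congrArg (· % (n + 1)) this
  simp only [Nat.add_mul_mod_self_left, Nat.mul_mod_right] at h
  rw [Nat.mod_eq_of_lt (by omega)] at h
  omega

lemma taddr_gt (n q i : ℕ) : 1 + n * n < taddr n q i := by
  unfold taddr
  have : n * n ≤ (n + 1) * (n + (4 * i + q)) := Nat.mul_le_mul (by omega) (by omega)
  omega

lemma taddr_inj {n q q' i i' : ℕ} (hq : q < 4) (hq' : q' < 4)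
    (h : taddr n q i = taddr n q' i') : q = q' ∧ i = i' := by
  unfold taddr at h
  have := Nat.eq_of_mul_eq_mul_left (Nat.succ_pos n) (Nat.add_left_cancel h)
  omega

/-- The `i`-th entry of the `q`-th table. -/
def tab (H : Mem) (q i : ℕ) : ℕ := H (taddr (H 1) q i)

section
variable {Γ : Type} [Ctx Γ]

lemma CompP.adjH {f g : Mem → Γ → ℕ} (hf : Comp f) (hg : Comp g) :
    CompP (fun H γ => adjH H (f H γ) (g H γ)) := by
  set P : Mem → Γ → Prop := fun H γ => f H γ < H 1 ∧ g H γ < H 1 ∧ f H γ ≠ g H γ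
  have hP : CompP P := (CompP.lt hf .heapOne).and ((CompP.lt hg .heapOne).and (CompP.ne hf hg))
  -- Off the range or on the diagonal the address is replaced by cell `1`, since a read must never
  -- hit a register.
  have haddr := Comp.ite hP
    ((Comp.const 2).add ((hf.mul .heapOne).add hg)) (.const 1)
  refine (hP.and (CompP.ne (haddr.read ?_) (.const 0))).congr fun H γ => ?_
  · intro H γ h1
    by_cases h : P H γ
    · simpa only [ind_true h, one_mul, Nat.sub_self, zero_mul, add_zero] using
        offLane_matrix h.1 h.2.1 h.2.2
    · simpa only [ind_false h, zero_mul, zero_add, Nat.sub_zero, one_mul] using offLane_one _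
  · unfold RAM.adjH
    refine and_congr_right fun h => ?_
    simp only [ind_true (P := P H γ) h, one_mul, Nat.sub_self, zero_mul, add_zero]

lemma Comp.taddr {f : Mem → Γ → ℕ} (q : ℕ) (hf : Comp f) :
    Comp (fun H γ => taddr (H 1) q (f H γ)) :=
  (Comp.const 3).add ((Comp.heapOne.add (.const 1)).mul
    (Comp.heapOne.add (((Comp.const 4).mul hf).add (.const q))))

lemma Comp.tab {f : Mem → Γ → ℕ} (q : ℕ) (hf : Comp f) :
    Comp (fun H γ => tab H q (f H γ)) :=
  (hf.taddr q).read fun _ _ h1 => taddr_offLane h1 _ _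

end

/-- Entering `F 0, …, F (b - 1)` into the `q`-th table. -/
def setTab (H : Mem) (q : ℕ) (F : ℕ → ℕ) : ℕ → Mem
  | 0 => H
  | b + 1 => Function.update (setTab H q F b) (taddr (H 1) q b) (F b)

lemma setTab_of_le {H : Mem} {q : ℕ} {F : ℕ → ℕ} (b : ℕ) {a : ℕ} (ha : a ≤ 1 + H 1 * H 1) :
    setTab H q F b a = H a := by
  induction b with
  | zero => rfl
  | succ b ih =>
    rw [setTab, Function.update_of_ne, ih]
    have := taddr_gt (H 1) q b
    omega

lemma setTab_one (H : Mem) (q : ℕ) (F : ℕ → ℕ) (b : ℕ) : setTab H q F b 1 = H 1 :=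
  setTab_of_le b (by omega)

lemma setTab_zero (H : Mem) (q : ℕ) (F : ℕ → ℕ) (b : ℕ) : setTab H q F b 0 = H 0 :=
  setTab_of_le b (by omega)

lemma adjH_setTab (H : Mem) (q : ℕ) (F : ℕ → ℕ) (b : ℕ) : adjH (setTab H q F b) = adjH H := by
  funext x y
  unfold adjH
  rw [setTab_one]
  refine propext (and_congr_right fun ⟨hx, hy, _⟩ => ?_)
  rw [setTab_of_le]
  have h2 : (x + 1) * H 1 ≤ H 1 * H 1 := Nat.mul_le_mul_right _ hx
  rw [Nat.succ_mul] at h2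
  omega

lemma tab_setTab_self {H : Mem} {q : ℕ} (hq : q < 4) {F : ℕ → ℕ} {b i : ℕ} (hi : i < b) :
    tab (setTab H q F b) q i = F i := by
  unfold tab
  rw [setTab_one]
  induction b with
  | zero => omega
  | succ b ih =>
    rw [setTab]
    by_cases h : i = b
    · subst h; simp
    · rw [Function.update_of_ne fun h' => h (taddr_inj hq hq h').2, ih (by omega)]

lemma tab_setTab_of_ne {H : Mem} {q q' : ℕ} (hq : q < 4) (hq' : q' < 4) (hne : q' ≠ q)
    (F : ℕ → ℕ) (b i : ℕ) : tab (setTab H q F b) q' i = tab H q' i := by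
  unfold tab
  rw [setTab_one]
  induction b with
  | zero => rfl
  | succ b ih => rw [setTab, Function.update_of_ne fun h' => hne (taddr_inj hq' hq h').1, ih]

lemma setTab_le {H : Mem} {q : ℕ} {F : ℕ → ℕ} {b Z : ℕ} (hH : ∀ a, H a ≤ Z)
    (hF : ∀ i < b, F i ≤ Z) (a : ℕ) : setTab H q F b a ≤ Z := by
  induction b with
  | zero => exact hH a
  | succ b ih =>
    rw [setTab, Function.update_apply]
    split_ifs
    · exact hF b (Nat.lt_succ_self b)
    · exact ih fun i hi => hF i (Nat.lt_succ_of_lt hi)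

lemma Rep.update {M H : Mem} (h : Rep M H) {a : ℕ} (ha : a ≠ 1) (x : ℕ) :
    Rep (Function.update M a x) (Function.update H a x) := by
  intro a' ha'
  rw [Function.update_of_ne ha.symm] at ha'
  simp only [Function.update_apply]
  split_ifs
  · rfl
  · exact h a' ha'

lemma Holds.unit (ρ : ℕ → ℕ) (n : ℕ) (M : Mem) (γ : Unit) : Holds ρ n M γ :=
  fun _ hi => absurd hi (Nat.not_lt_zero _)

/-- Filling a table by course-of-values recursion. -/
lemma exec_tabulate {b : Mem → Unit → ℕ} {f : Mem → Unit × ℕ → ℕ} (q : ℕ) (hb : Comp b)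
    (hf : Comp f) : ∃ (p : Prog) (c : ℕ), ∀ (H : Mem) (Z : ℕ) (F : ℕ → ℕ), 1 ≤ H 1 → 2 ≤ Z →
      (∀ a, H a ≤ Z) → (∀ i < b H (), F i ≤ Z) →
      (∀ i < b H (), f (setTab H q F i) ((), i) = F i) → ∀ M, Rep M H →
      ∃ t M', Exec p M t M' ∧ Rep M' (setTab H q F (b H ())) ∧ t ≤ Z ^ c := by
  -- Registers `0` to `3` hold the length of the table, the index, the address of the entry and its
  -- value.
  obtain ⟨p, c₀, hp⟩ := hb (fun _ => 0) 0 fun i hi => absurd hi (Nat.not_lt_zero _)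
  obtain ⟨p₁, c₁, hp₁⟩ := (Comp.taddr (Γ := Unit × ℕ) q .var) (fun _ => 1) 2 fun _ _ => by omega
  obtain ⟨p₂, c₂, hp₂⟩ := hf (fun _ => 1) 3 fun _ _ => by omega
  set w₀ : Prog := .write (regT 1) (.const 0)
  set w₁ : Prog := .write (getT 2) (getT 3)
  set T₄ : Term := .add (getT 1) (.const 1) with hT₄
  set w₂ : Prog := .write (regT 1) T₄
  set g : Term := .sub (getT 0) (getT 1) with hg
  set k₀ := (regT 1).cost + (Term.const 0).cost + 1
  set k₁ := (getT 2).cost + (getT 3).cost + 1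
  set k₂ := (regT 1).cost + T₄.cost + 1
  set k := g.cost + 1 + k₁ + k₂
  set d := c₀ + 1
  refine ⟨.seq (.seq p w₀) (.loop g (.seq (.seq (.seq p₁ p₂) w₁) w₂)),
    (c₀ + (k₀ + (g.cost + 1)) + 1) + (c₀ + (d * c₁ + d * c₂ + 1 + k + 1)) + 1, ?_⟩
  intro H Z F h1 hZ hH hF hval M hr
  obtain ⟨t₀, M₀, ex₀, hv₀, hfr₀, ht₀, hb₀⟩ := hp H M () Z h1 hr (.unit _ _ _ _) hZ hH
    fun i hi => absurd hi (Nat.not_lt_zero _)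
  have hr₀ := hfr₀.rep rfl hr
  set N := b H ()
  set n := H 1 with hn
  have ex₁ : Exec w₀ M₀ k₀ _ := exec_writeReg hr₀.one _
  set M₁ := Function.update M₀ (reg n 1) ((Term.const 0).eval M₀) with hM₁
  have hr₁ : Rep M₁ H := (hfr₀.update (Nat.zero_le _) _).rep rfl hr
  have hZd : Z ≤ Z ^ d := by
    simpa using Nat.pow_le_pow_right (by omega : 0 < Z) (by omega : 1 ≤ d)
  let I : ℕ → Mem → Prop := fun i M' => Rep M' (setTab H q F i) ∧ M' (reg n 0) = N ∧
    M' (reg n 1) = i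
  obtain ⟨t₂, M₂, ex₂, ⟨hr₂, -, -⟩, ht₂⟩ := exec_loop (e := g)
    (p := .seq (.seq (.seq p₁ p₂) w₁) w₂) I N (Z ^ (d * c₁ + d * c₂ + 1) + k₁ + k₂) (by
      rintro i hi M' ⟨hr', hvN, hvi⟩
      have hone : setTab H q F i 1 = n := setTab_one _ _ _ _
      have hM'1 : M' 1 = n := hr'.one.trans hone
      have hle : ∀ a, setTab H q F i a ≤ Z ^ d := fun a =>
        (setTab_le hH (fun j hj => hF j (hj.trans hi)) a).trans hZd
      have hctx : ∀ j < Ctx.len (Unit × ℕ), Ctx.val ((), i) j ≤ Z ^ d := by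
        intro j hj
        obtain rfl : j = 0 := by simpa [Ctx.len] using hj
        simp only [Ctx.val, Ctx.len, if_true]
        exact hi.le.trans (pow_mono hZ hb₀ (by omega))
      have hholds : ∀ M'' : Mem, M'' (reg n 1) = i →
          Holds (Γ := Unit × ℕ) (fun _ => 1) n M'' ((), i) := by
        intro M'' h j hj
        obtain rfl : j = 0 := by simpa [Ctx.len] using hj
        simpa [Ctx.val, Ctx.len] using h
      refine ⟨?_, ?_⟩
      · rw [hg, Term.eval, getT_eval, getT_eval, hM'1, hvN, hvi]; omega
      obtain ⟨s₁, M₃, ex₃, hv₃, hfr₃, hs₁, -⟩ := hp₁ _ M' ((), i) (Z ^ d) (by rwa [hone]) hr'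
        (by rw [hone]; exact hholds _ hvi) (hZ.trans hZd) hle hctx
      have hr₃ := hfr₃.rep rfl hr'
      rw [hone] at hfr₃ hv₃
      have hvi₃ : M₃ (reg n 1) = i := by rw [hfr₃.reg (by omega), hvi]
      obtain ⟨s₂, M₄, ex₄, hv₄, hfr₄, hs₂, -⟩ := hp₂ _ M₃ ((), i) (Z ^ d) (by rwa [hone]) hr₃
        (by rw [hone]; exact hholds _ hvi₃) (hZ.trans hZd) hle hctx
      have hr₄ := hfr₄.rep rfl hr₃
      rw [hone] at hfr₄ hv₄
      have hM₄1 : M₄ 1 = n := hr₄.one.trans hone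
      have ht1 : taddr n q i ≠ 1 := by have := taddr_gt n q i; omega
      have ex₅ : Exec w₁ M₄ k₁ (Function.update M₄ (taddr n q i) (F i)) := by
        have := Exec.write (getT 2) (getT 3) M₄
        rw [getT_eval, getT_eval, hM₄1, hv₄, hval i hi, hfr₄.reg (by omega), hv₃] at this
        simpa only [hone] using this
      set M₅ := Function.update M₄ (taddr n q i) (F i) with hM₅
      have hr₅ : Rep M₅ (setTab H q F (i + 1)) := hr₄.update ht1 _
      have hone' : setTab H q F (i + 1) 1 = n := setTab_one _ _ _ _
      have hM₅1 : M₅ 1 = n := hr₅.one.trans hone'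
      have hreg₅ : ∀ j, M₅ (reg n j) = M₄ (reg n j) := fun j =>
        Function.update_of_ne (taddr_offLane h1 q i j).symm _ _
      refine ⟨_, _, .seq (.seq (.seq ex₃ ex₄) ex₅) (exec_writeReg hM₅1 _), ?_, ?_, ?_, ?_⟩
      · rw [← pow_mul] at hs₁ hs₂
        have := add_le_pow hZ hs₁ hs₂
        omega
      · exact ((Frame.refl n 0 M₅).update (Nat.zero_le _) _).rep hone'.symm hr₅
      · rw [Function.update_of_ne (by rw [Ne, reg_inj]; omega), hreg₅, hfr₄.reg (by omega),
          hfr₃.reg (by omega), hvN]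
      · rw [Function.update_self, hT₄, Term.eval, getT_eval, hM₅1, hreg₅, hfr₄.reg (by omega), hvi₃]
        rfl) (by
      rintro M' ⟨hr', hvN, hvi⟩
      rw [hg, Term.eval, getT_eval, getT_eval, hr'.one, setTab_one, ← hn, hvN, hvi]; omega)
    (M := M₁) ⟨hr₁, by
      rw [hM₁, Function.update_of_ne (by rw [Ne, reg_inj]; omega), hv₀],
      by rw [hM₁, Function.update_self]; rfl⟩
  refine ⟨_, _, .seq (.seq ex₀ ex₁) ex₂, hr₂, ?_⟩
  have h2 : t₀ + (k₀ + (g.cost + 1)) ≤ Z ^ (c₀ + (k₀ + (g.cost + 1)) + 1) :=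
    add_le_pow hZ ht₀ (le_pow_self_of_two_le hZ _)
  have h3 : N * (Z ^ (d * c₁ + d * c₂ + 1) + k) ≤
      Z ^ (c₀ + (d * c₁ + d * c₂ + 1 + k + 1)) := by
    rw [pow_add Z c₀]
    exact Nat.mul_le_mul hb₀ (add_le_pow hZ le_rfl (le_pow_self_of_two_le hZ _))
  have h4 : N * (g.cost + 1 + (Z ^ (d * c₁ + d * c₂ + 1) + k₁ + k₂)) =
      N * (Z ^ (d * c₁ + d * c₂ + 1) + k) := by congr 1; omega
  have h5 := add_le_pow hZ h2 h3
  omega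

/-- Leaving the truth value of a computable proposition in cell `0`. -/
lemma exec_answer {P : Mem → Unit → Prop} (hP : CompP P) : ∃ (p : Prog) (c : ℕ),
    ∀ (H : Mem) (Z : ℕ), 1 ≤ H 1 → 2 ≤ Z → (∀ a, H a ≤ Z) → ∀ M, Rep M H →
      ∃ t M', Exec p M t M' ∧ M' 0 = ind (P H ()) ∧ t ≤ Z ^ c := by
  obtain ⟨p, c, hp⟩ := hP (fun _ => 0) 0 fun i hi => absurd hi (Nat.not_lt_zero _)
  set k := (Term.const 0).cost + (getT 0).cost + 1
  refine ⟨.seq p (.write (.const 0) (getT 0)), c + k + 1, ?_⟩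
  intro H Z h1 hZ hH M hr
  obtain ⟨t, M₁, ex, hv, hfr, ht, -⟩ := hp H M () Z h1 hr (.unit _ _ _ _) hZ hH
    fun i hi => absurd hi (Nat.not_lt_zero _)
  refine ⟨_, _, .seq ex (.write _ _ _), ?_, add_le_pow hZ ht (le_pow_self_of_two_le hZ k)⟩
  rw [getT_eval, (hfr.rep rfl hr).one, hv]
  exact Function.update_self _ _ _

end RAM

/-! ### Lexicographic transitive orientation -/

namespace LexOrient

open Relation

/-- The pairs reachable by Warshall's algorithm with intermediate points below `m`. -/
def warshall (r : ℕ → ℕ → Prop) : ℕ → ℕ → ℕ → Prop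
  | 0 => fun e f => e = f ∨ r e f
  | m + 1 => fun e f => warshall r m e f ∨ (warshall r m e m ∧ warshall r m m f)

/-- Composition must be possible at every point below `m`, not only at the last one admitted. At the
newest point, detours from it to itself are dropped. -/
lemma warshall_trans {r : ℕ → ℕ → Prop} {m g : ℕ} (hg : g < m) {e f : ℕ}
    (h₁ : warshall r m e g) (h₂ : warshall r m g f) : warshall r m e f := by
  induction m generalizing e f g with
  | zero => omega
  | succ m ih =>
    simp only [warshall] at *
    rcases Nat.lt_succ_iff_lt_or_eq.mp hg with hg | rfl
    · have := @ih g hg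
      rcases h₁ with h₁ | ⟨h₁, h₁'⟩ <;> rcases h₂ with h₂ | ⟨h₂, h₂'⟩
      · exact .inl (this h₁ h₂)
      · exact .inr ⟨this h₁ h₂, h₂'⟩
      · exact .inr ⟨h₁, this h₁' h₂⟩
      · exact .inr ⟨h₁, h₂'⟩
    · tauto

lemma warshall_sound {r : ℕ → ℕ → Prop} {m e f : ℕ} (h : warshall r m e f) :
    ReflTransGen r e f := by
  induction m generalizing e f with
  | zero =>
    rcases h with rfl | h
    · exact .refl
    · exact .single h
  | succ m ih =>
    rcases h with h | ⟨h, h'⟩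
    · exact ih h
    · exact (ih h).trans (ih h')

lemma warshall_of_zero {r : ℕ → ℕ → Prop} (m : ℕ) {e f : ℕ} (h : e = f ∨ r e f) :
    warshall r m e f := by
  induction m with
  | zero => exact h
  | succ m ih => exact .inl ih

lemma warshall_iff {r : ℕ → ℕ → Prop} {N : ℕ} (hr : ∀ e f, r e f → e < N) {e f : ℕ} :
    warshall r N e f ↔ ReflTransGen r e f := by
  refine ⟨warshall_sound, fun h => ?_⟩
  induction h with
  | refl => exact warshall_of_zero N (.inl rfl)
  | tail _ hgf ih => exact warshall_trans (hr _ _ hgf) ih (warshall_of_zero N (.inr hgf))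

variable (n : ℕ) (A : ℕ → ℕ → Prop)

/-- Distinct nonadjacent vertices below `n`. -/
def NonAdj (a b : ℕ) : Prop := (a < n ∧ b < n) ∧ a ≠ b ∧ ¬ A a b

/-- One orientation of a nonadjacent pair forces that of another one. -/
def Force (p q : ℕ × ℕ) : Prop :=
  (NonAdj n A p.1 p.2 ∧ NonAdj n A q.1 q.2) ∧
    ((p.1 = q.1 ∧ A p.2 q.2) ∨ (p.2 = q.2 ∧ A p.1 q.1))

/-- The implication classes. -/
def Cls : ℕ × ℕ → ℕ × ℕ → Prop := ReflTransGen (Force n A)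

/-- The lexicographic order on pairs. -/
def LexLe (p q : ℕ × ℕ) : Prop := p.1 < q.1 ∨ (p.1 = q.1 ∧ p.2 ≤ q.2)

/-- `x` is a lower bound of the increasing pairs in the class of `p` and its reverse. -/
def LexBound (p x : ℕ × ℕ) : Prop :=
  ∀ u w, u < w → (Cls n A p (u, w) ∨ Cls n A p.swap (u, w)) → LexLe x (u, w)

/-- The lexicographic orientation: the least increasing pair in a class or its reverse is oriented
upwards. -/
def Orient (a b : ℕ) : Prop :=
  NonAdj n A a b ∧ ∃ u w, u < w ∧ Cls n A (a, b) (u, w) ∧ LexBound n A (a, b) (u, w)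

/-- `L` is a transitive orientation of the nonadjacent pairs. -/
structure IsOrient (L : ℕ → ℕ → Prop) : Prop where
  trans : ∀ {a b c}, L a b → L b c → L a c
  irrefl : ∀ a, ¬ L a a
  nonAdj_iff : ∀ {a b}, NonAdj n A a b ↔ L a b ∨ L b a

variable {n A} {L : ℕ → ℕ → Prop}

lemma NonAdj.symm (hA : ∀ ⦃x y⦄, A x y → A y x) {a b : ℕ} (h : NonAdj n A a b) : NonAdj n A b a :=
  ⟨h.1.symm, h.2.1.symm, fun h' => h.2.2 (hA h')⟩

lemma Force.symm (hA : ∀ ⦃x y⦄, A x y → A y x) {p q : ℕ × ℕ} (h : Force n A p q) : Force n A q p :=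
  ⟨h.1.symm, h.2.imp (fun h => ⟨h.1.symm, hA h.2⟩) fun h => ⟨h.1.symm, hA h.2⟩⟩

lemma Force.swap (hA : ∀ ⦃x y⦄, A x y → A y x) {p q : ℕ × ℕ} (h : Force n A p q) :
    Force n A p.swap q.swap :=
  ⟨⟨h.1.1.symm hA, h.1.2.symm hA⟩, h.2.symm⟩

lemma Cls.symm (hA : ∀ ⦃x y⦄, A x y → A y x) {p q : ℕ × ℕ} (h : Cls n A p q) : Cls n A q p :=
  have : Std.Symm (Force n A) := ⟨fun _ _ => Force.symm hA⟩
  ReflTransGen.stdSymm.symm _ _ h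

lemma Cls.swap (hA : ∀ ⦃x y⦄, A x y → A y x) {p q : ℕ × ℕ} (h : Cls n A p q) : Cls n A p.swap q.swap :=
  ReflTransGen.lift Prod.swap (fun _ _ => Force.swap hA) _ _ h

lemma Cls.nonAdj {p q : ℕ × ℕ} (h : Cls n A p q) (hp : NonAdj n A p.1 p.2) :
    NonAdj n A q.1 q.2 := by
  induction h with
  | refl => exact hp
  | tail _ h _ => exact h.1.2

/-- If the forced pair were oriented the other way, transitivity with the forcing pair would orient
an adjacent pair. -/
lemma IsOrient.cls (hL : IsOrient n A L) {p q : ℕ × ℕ} (h : Cls n A p q) (hp : L p.1 p.2) :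
    L q.1 q.2 := by
  induction h with
  | refl => exact hp
  | @tail q r _ h ih =>
    obtain ⟨⟨h1, h2⟩, h3⟩ := h
    rcases hL.nonAdj_iff.mp h2 with h | h
    · exact h
    exfalso
    rcases h3 with ⟨he, h4⟩ | ⟨he, h4⟩
    · rw [he] at ih
      exact (hL.nonAdj_iff.mpr (.inr (hL.trans h ih))).2.2 h4
    · rw [he] at ih
      exact (hL.nonAdj_iff.mpr (.inl (hL.trans ih h))).2.2 h4

lemma LexBound.swap {p x : ℕ × ℕ} (h : LexBound n A p x) : LexBound n A p.swap x :=
  fun u w huw h' => h u w huw (by simpa using h'.symm)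

lemma LexBound.cls (hA : ∀ ⦃x y⦄, A x y → A y x) {p q x : ℕ × ℕ} (h : LexBound n A p x)
    (hpq : Cls n A p q) : LexBound n A q x := fun u w huw h' =>
  h u w huw (h'.imp (hpq.trans ·) ((hpq.swap hA).trans ·))

lemma Orient.cls (hA : ∀ ⦃x y⦄, A x y → A y x) {a b c d : ℕ} (h : Orient n A a b)
    (hc : Cls n A (a, b) (c, d)) : Orient n A c d := by
  obtain ⟨h1, u, w, huw, h2, h3⟩ := h
  exact ⟨hc.nonAdj h1, u, w, huw, (hc.symm hA).trans h2, h3.cls hA hc⟩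

lemma orient_total (hA : ∀ ⦃x y⦄, A x y → A y x) {a b : ℕ} (h : NonAdj n A a b) :
    Orient n A a b ∨ Orient n A b a := by
  let S : Set (ℕ ×ₗ ℕ) := {x | (ofLex x).1 < (ofLex x).2 ∧
    (Cls n A (a, b) (ofLex x) ∨ Cls n A (b, a) (ofLex x))}
  have hS : S.Nonempty := by
    rcases lt_or_gt_of_ne h.2.1 with hab | hab
    · exact ⟨toLex (a, b), hab, .inl .refl⟩
    · exact ⟨toLex (b, a), hab, .inr .refl⟩
  obtain ⟨x, ⟨hx1, hx2⟩, hmin⟩ := (wellFounded_lt (α := ℕ ×ₗ ℕ)).has_min S hS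
  have hb : LexBound n A (a, b) (ofLex x) := by
    intro u w huw hc
    have := hmin (toLex (u, w)) ⟨huw, hc⟩
    rw [Prod.Lex.lt_iff] at this
    simp only [ofLex_toLex] at this
    unfold LexLe
    omega
  rcases hx2 with hx2 | hx2
  · exact .inl ⟨h, _, _, hx1, hx2, hb⟩
  · exact .inr ⟨h.symm hA, _, _, hx1, hx2, hb.swap⟩

/-- Both orientations would have the same least pair, so the class would contain its own reverse. A
transitive orientation, being constant on classes, excludes this. -/
lemma orient_asymm (hA : ∀ ⦃x y⦄, A x y → A y x) (hL : IsOrient n A L) {a b : ℕ} (h : Orient n A a b)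
    (h' : Orient n A b a) : False := by
  obtain ⟨h1, u, w, huw, h2, h3⟩ := h
  obtain ⟨h1', u', w', huw', h2', h3'⟩ := h'
  have e1 := h3 u' w' huw' (.inr h2')
  have e2 := h3' u w huw (.inr h2)
  unfold LexLe at e1 e2
  simp only at e1 e2
  obtain ⟨rfl, rfl⟩ : u = u' ∧ w = w' := by omega
  have hc : Cls n A (a, b) (b, a) := h2.trans (h2'.symm hA)
  rcases hL.nonAdj_iff.mp h1 with h | h
  · exact hL.irrefl _ (hL.trans h (hL.cls hc h))
  · exact hL.irrefl _ (hL.trans h (hL.cls (hc.symm hA) h))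

/-- The triangle lemma for a cyclic triangle. -/
lemma orient_triangle (hA : ∀ ⦃x y⦄, A x y → A y x) (hL : IsOrient n A L) {a b c b' c' : ℕ}
    (h₁ : Orient n A a b) (h₂ : Orient n A b c) (h₃ : Orient n A c a)
    (h : Cls n A (b, c) (b', c')) : Cls n A (a, b) (a, b') ∧ Cls n A (c, a) (c', a) := by
  suffices H : ∀ q, Cls n A (b, c) q → Cls n A (a, b) (a, q.1) ∧ Cls n A (c, a) (q.2, a) from
    H _ h
  intro q hq
  induction hq with
  | refl => exact ⟨.refl, .refl⟩
  | @tail x y hx hxy ih =>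
    obtain ⟨p, q⟩ := x
    obtain ⟨p', q'⟩ := y
    obtain ⟨i1, i2⟩ := ih
    have o1 := h₁.cls hA i1
    have o3 := h₃.cls hA i2
    have o2 : Orient n A p' q' := h₂.cls hA (hx.tail hxy)
    obtain ⟨⟨n1, n2⟩, ⟨he, h4⟩ | ⟨he, h4⟩⟩ := hxy
    · simp only at he h4 n1 n2 i1 i2 o1 o3
      subst he
      -- If `q'` and `a` were adjacent, `(p, q')` would force `(p, a)`, against the orientation of
      -- `(a, p)`. Being nonadjacent, `(q', a)` is forced by `(q, a)`.
      have hN : NonAdj n A q' a := by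
        refine ⟨⟨n2.1.2, o1.1.1.1⟩, ?_, fun h => ?_⟩
        · rintro rfl; exact o3.1.2.2 h4
        · have hf : Force n A (p, q') (p, a) := ⟨⟨n2, o1.1.symm hA⟩, .inl ⟨rfl, h⟩⟩
          exact orient_asymm hA hL o1 (o2.cls hA (.single hf))
      exact ⟨i1, i2.tail ⟨⟨o3.1, hN⟩, .inr ⟨rfl, h4⟩⟩⟩
    · simp only at he h4 n1 n2 i1 i2 o1 o3
      subst he
      have hN : NonAdj n A a p' := by
        refine ⟨⟨o1.1.1.1, n2.1.1⟩, ?_, fun h => ?_⟩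
        · rintro rfl; exact o1.1.2.2 (hA h4)
        · have hf : Force n A (p', q) (a, q) := ⟨⟨n2, o3.1.symm hA⟩, .inr ⟨rfl, hA h⟩⟩
          exact orient_asymm hA hL o3 (o2.cls hA (.single hf))
      exact ⟨i1.tail ⟨⟨o1.1, hN⟩, .inl ⟨rfl, h4⟩⟩, i2⟩

/-- The triangle lemma moves the cycle to `a, u, w`. If `a < u`, the pair `(a, u)` beats the bound
`(u, w)`. If `u < a`, the least pair of the class of `(a, u)` is squeezed between `(u, w)` and `(u,
a)`, so it starts with `u`; a second use of the triangle lemma then reverses `(u, w)`. -/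
lemma orient_no_cycle_of_bound (hA : ∀ ⦃x y⦄, A x y → A y x) (hL : IsOrient n A L) {a b c u w : ℕ}
    (h₁ : Orient n A a b) (h₂ : Orient n A b c) (h₃ : Orient n A c a) (huw : u < w)
    (hc : Cls n A (b, c) (u, w)) (hb : LexBound n A (a, b) (u, w)) : False := by
  obtain ⟨c1, c2⟩ := orient_triangle hA hL h₁ h₂ h₃ hc
  have o1 := h₁.cls hA c1
  have o2 := h₂.cls hA hc
  have o3 := h₃.cls hA c2
  have hb' := hb.cls hA c1
  rcases lt_or_gt_of_ne o1.1.2.1 with hau | hau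
  · have := hb' a u hau (.inl .refl)
    unfold LexLe at this
    simp only at this
    omega
  · obtain ⟨-, x, y, hxy, hx, hxb⟩ := id o1
    have e1 := hxb u a hau (.inr .refl)
    have e2 := hb' x y hxy (.inl hx)
    unfold LexLe at e1 e2
    simp only at e1 e2
    obtain rfl : x = u := by omega
    have := (orient_triangle hA hL o3 o1 o2 hx).1
    exact orient_asymm hA hL o2 (o3.cls hA this)

lemma LexBound.mono {p x y : ℕ × ℕ} (h : LexBound n A p x) (hxy : LexLe y x) :
    LexBound n A p y := by
  intro u w huw hc
  have := h u w huw hc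
  unfold LexLe at *
  omega

lemma lexLe_total (x y : ℕ × ℕ) : LexLe x y ∨ LexLe y x := by
  unfold LexLe; omega

lemma LexLe.trans {x y z : ℕ × ℕ} (h : LexLe x y) (h' : LexLe y z) : LexLe x z := by
  unfold LexLe at *; omega

/-- Around the cycle, some class has a least pair not above that of its predecessor; rotate so that
this class is that of `(b, c)`. -/
lemma orient_no_cycle (hA : ∀ ⦃x y⦄, A x y → A y x) (hL : IsOrient n A L) {a b c : ℕ}
    (h₁ : Orient n A a b) (h₂ : Orient n A b c) (h₃ : Orient n A c a) : False := by
  obtain ⟨-, u, w, huw, e1, b1⟩ := id h₁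
  obtain ⟨-, u', w', huw', e2, b2⟩ := id h₂
  obtain ⟨-, u'', w'', huw'', e3, b3⟩ := id h₃
  rcases lexLe_total (u', w') (u, w) with h | h
  · exact orient_no_cycle_of_bound hA hL h₁ h₂ h₃ huw' e2 (b1.mono h)
  rcases lexLe_total (u, w) (u'', w'') with h' | h'
  · exact orient_no_cycle_of_bound hA hL h₃ h₁ h₂ huw e1 (b3.mono h')
  · exact orient_no_cycle_of_bound hA hL h₂ h₃ h₁ huw'' e3 (b2.mono (h'.trans h))

/-- The lexicographic orientation is transitive whenever there is a transitive orientation. -/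
theorem IsOrient.lex (hA : ∀ ⦃x y⦄, A x y → A y x) (hL : IsOrient n A L) : IsOrient n A (Orient n A) where
  trans {a b c} h₁ h₂ := by
    have hac : NonAdj n A a c := by
      refine ⟨⟨h₁.1.1.1, h₂.1.1.2⟩, ?_, fun h => ?_⟩
      · rintro rfl; exact orient_asymm hA hL h₁ h₂
      · have hf : Force n A (b, c) (b, a) := ⟨⟨h₂.1, h₁.1.symm hA⟩, .inl ⟨rfl, hA h⟩⟩
        exact orient_asymm hA hL h₁ (h₂.cls hA (.single hf))
    exact (orient_total hA hac).resolve_right fun h => orient_no_cycle hA hL h₁ h₂ h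
  irrefl a h := h.1.2.1 rfl
  nonAdj_iff := ⟨orient_total hA, fun h => h.elim (·.1) fun h => h.1.symm hA⟩

/-! #### The orientation in terms of codes of pairs -/

/-- `Force` in terms of the codes `a * n + b` of pairs `(a, b)`. -/
def ForceCode (n : ℕ) (A : ℕ → ℕ → Prop) (e f : ℕ) : Prop :=
  Force n A (e / n, e % n) (f / n, f % n)

/-- `Orient` for a given table of the implication classes. -/
def OrientCode (n : ℕ) (A R : ℕ → ℕ → Prop) (a b : ℕ) : Prop :=
  NonAdj n A a b ∧ ∃ u < n, ∃ w < n, u < w ∧ R (a * n + b) (u * n + w) ∧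
    ∀ u' < n, ∀ w' < n, u' < w' →
      (R (a * n + b) (u' * n + w') ∨ R (b * n + a) (u' * n + w')) →
      u < u' ∨ (u = u' ∧ w ≤ w')

lemma code_div {a b : ℕ} (hb : b < n) : (a * n + b) / n = a := by
  rw [mul_comm, Nat.mul_add_div (by omega), Nat.div_eq_of_lt hb, add_zero]

lemma code_mod {a b : ℕ} (hb : b < n) : (a * n + b) % n = b := by
  rw [mul_comm, Nat.mul_add_mod, Nat.mod_eq_of_lt hb]

lemma code_lt {a b : ℕ} (ha : a < n) (hb : b < n) : a * n + b < n * n := by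
  have : (a + 1) * n ≤ n * n := Nat.mul_le_mul_right n ha
  rw [Nat.succ_mul] at this
  omega

lemma cls_iff_code {a b c d : ℕ} (hb : b < n) (hd : d < n) :
    ReflTransGen (ForceCode n A) (a * n + b) (c * n + d) ↔ Cls n A (a, b) (c, d) := by
  constructor
  · intro h
    have := ReflTransGen.lift (fun e => (e / n, e % n)) (fun _ _ h => h) _ _ h (p := Force n A)
    rwa [Function.onFun, code_div hb, code_div hd, code_mod hb, code_mod hd] at this
  · intro h
    refine ReflTransGen.lift (fun p : ℕ × ℕ => p.1 * n + p.2) (fun p q h => ?_) _ _ h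
    unfold Function.onFun ForceCode
    rwa [code_div h.1.1.1.2, code_div h.1.2.1.2, code_mod h.1.1.1.2, code_mod h.1.2.1.2]

lemma forceCode_lt {e f : ℕ} (h : ForceCode n A e f) : e < n * n :=
  Nat.lt_mul_of_div_lt h.1.1.1.1 (Nat.pos_of_ne_zero fun h0 => absurd h.1.1.1.1 (by rw [h0]; exact Nat.not_lt_zero _))

lemma orientCode_iff (hA : ∀ ⦃x y⦄, A x y → A y x) {R : ℕ → ℕ → Prop}
    (hR : ∀ e < n * n, ∀ f < n * n, R e f ↔ warshall (ForceCode n A) (n * n) e f) {a b : ℕ} :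
    OrientCode n A R a b ↔ Orient n A a b := by
  unfold OrientCode Orient LexBound
  refine and_congr_right fun hN => ?_
  have hcls : ∀ {a b c d : ℕ}, a < n → b < n → c < n → d < n →
      (R (a * n + b) (c * n + d) ↔ Cls n A (a, b) (c, d)) := by
    intro a b c d ha hb hc hd
    rw [hR _ (code_lt ha hb) _ (code_lt hc hd), warshall_iff fun e f => forceCode_lt,
      cls_iff_code hb hd]
  obtain ⟨⟨ha, hb⟩, hne, hab⟩ := id hN
  constructor
  · rintro ⟨u, hu, w, hw, huw, h1, h2⟩
    refine ⟨u, w, huw, (hcls ha hb hu hw).mp h1, fun u' w' huw' h => ?_⟩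
    have hlt : u' < n ∧ w' < n := by
      rcases h with h | h
      · exact (h.nonAdj hN).1
      · exact (h.nonAdj (p := (b, a)) (hN.symm hA)).1
    exact h2 u' hlt.1 w' hlt.2 huw' (h.imp (hcls ha hb hlt.1 hlt.2).mpr (hcls hb ha hlt.1 hlt.2).mpr)
  · rintro ⟨u, w, huw, h1, h2⟩
    obtain ⟨hu, hw⟩ := (h1.nonAdj hN).1
    exact ⟨u, hu, w, hw, huw, (hcls ha hb hu hw).mpr h1, fun u' hu' w' hw' huw' h =>
      h2 u' w' huw' (h.imp (hcls ha hb hu' hw').mp (hcls hb ha hu' hw').mp)⟩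

end LexOrient

/-! ### The canonical interval model of a vertebrate interval graph -/

/-- The number of `x < n` with `P x`. -/
noncomputable def cnt (n : ℕ) (P : ℕ → Prop) : ℕ := ∑ x ∈ Finset.range n, RAM.ind (P x)

open Classical in
lemma cnt_eq_card (n : ℕ) (P : ℕ → Prop) : cnt n P = ((Finset.range n).filter P).card := by
  simp [cnt, RAM.ind]

lemma cnt_mono {n : ℕ} {P Q : ℕ → Prop} (h : ∀ x < n, P x → Q x) : cnt n P ≤ cnt n Q := by
  classical
  rw [cnt_eq_card, cnt_eq_card]
  refine Finset.card_le_card fun x hx => ?_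
  simp only [Finset.mem_filter, Finset.mem_range] at hx ⊢
  exact ⟨hx.1, h x hx.1 hx.2⟩

lemma cnt_lt {n : ℕ} {P Q : ℕ → Prop} (h : ∀ x < n, P x → Q x) {y : ℕ} (hy : y < n)
    (hQ : Q y) (hP : ¬ P y) : cnt n P < cnt n Q := by
  classical
  rw [cnt_eq_card, cnt_eq_card]
  refine Finset.card_lt_card ⟨fun x hx => ?_, fun h' => ?_⟩
  · simp only [Finset.mem_filter, Finset.mem_range] at hx ⊢
    exact ⟨hx.1, h x hx.1 hx.2⟩
  · have := h' (Finset.mem_filter.mpr ⟨Finset.mem_range.mpr hy, hQ⟩)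
    exact hP (Finset.mem_filter.mp this).2

lemma cnt_le (n : ℕ) (P : ℕ → Prop) : cnt n P ≤ n := by
  classical
  rw [cnt_eq_card]
  exact (Finset.card_filter_le _ _).trans_eq (Finset.card_range n)

lemma cnt_congr {n : ℕ} {P Q : ℕ → Prop} (h : ∀ x < n, P x ↔ Q x) : cnt n P = cnt n Q :=
  le_antisymm (cnt_mono fun x hx => (h x hx).mp) (cnt_mono fun x hx => (h x hx).mpr)

/-- Nonempty integer intervals `[lo u, hi u)`, `u < n`, within `[0, k)`, among them all intervals
of length one. -/
structure IntervalModel (n k : ℕ) (lo hi : ℕ → ℕ) : Prop where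
  lt : ∀ u < n, lo u < hi u
  le : ∀ u < n, hi u ≤ k
  unit : ∀ j < k, ∃ u < n, lo u = j ∧ hi u = j + 1

namespace Backbone

open LexOrient

variable (n : ℕ) (A D : ℕ → ℕ → Prop)

/-- The neighbourhood of `b` is a clique. -/
def Simplicial (b : ℕ) : Prop :=
  b < n ∧ ∀ x < n, ∀ y < n, A b x → A b y → x ≠ y → A x y

/-- Chosen simplicial vertices, one for every class of twins. -/
def IsRep (b : ℕ) : Prop := Simplicial n A b ∧ ∀ b' < b, ¬ (A b b' ∧ Simplicial n A b')

/-- The left end of `u` in the canonical model. -/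
noncomputable def lo (u : ℕ) : ℕ := cnt n fun b => IsRep n A b ∧ D b u

/-- The right end of `u` in the canonical model. -/
noncomputable def hi (u : ℕ) : ℕ := cnt n fun b => IsRep n A b ∧ ¬ D u b

/-- The length of the backbone. -/
noncomputable def len : ℕ := cnt n fun b => IsRep n A b

variable {n A D}

/-- Adjacent simplicial vertices have the same closed neighbourhood, so the least simplicial vertex
in the closed neighbourhood of `b` represents the twin class. -/
lemma exists_isRep (hA : ∀ ⦃x y⦄, A x y → A y x) {b : ℕ}
    (hb : Simplicial n A b) :
    ∃ b', IsRep n A b' ∧ ∀ u, u < n → (b = u ∨ A b u) → (b' = u ∨ A b' u) := by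
  classical
  have hex : ∃ b', Simplicial n A b' ∧ (b = b' ∨ A b b') := ⟨b, hb, .inl rfl⟩
  obtain ⟨h1, h2⟩ := Nat.find_spec hex
  set b' := Nat.find hex
  have hmin := fun m => Nat.find_min hex (m := m)
  refine ⟨b', ⟨h1, fun b'' hlt' ⟨h3, h4⟩ => hmin b'' hlt' ⟨h4, ?_⟩⟩, fun u hu hbu => ?_⟩
  · rcases h2 with h2 | h2
    · exact .inr (by rw [h2]; exact h3)
    · by_cases he : b = b''
      · exact .inl he
      · exact .inr (h1.2 b hb.1 b'' h4.1 (hA h2) h3 he)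
  · rcases hbu with rfl | hbu
    · exact h2.imp Eq.symm fun h => hA h
    · rcases h2 with h2 | h2
      · rw [← h2]; exact .inr hbu
      · by_cases he : b' = u
        · exact .inl he
        · exact .inr (hb.2 b' h1.1 u hu h2 hbu he)

section
variable (hA : ∀ ⦃x y⦄, A x y → A y x)
  (hD : IsOrient n A D)
  (hV : ∀ u < n, ∀ w < n, (u = w ∨ A u w) →
    ∃ b, Simplicial n A b ∧ (b = u ∨ A b u) ∧ (b = w ∨ A b w))

include hA hV in
lemma exists_isRep_near {u w : ℕ} (hu : u < n) (hw : w < n) (h : u = w ∨ A u w) :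
    ∃ b, IsRep n A b ∧ (b = u ∨ A b u) ∧ (b = w ∨ A b w) := by
  obtain ⟨b, hb, h1, h2⟩ := hV u hu w hw h
  obtain ⟨b', hb', h3⟩ := exists_isRep hA hb
  exact ⟨b', hb', h3 u hu h1, h3 w hw h2⟩

include hD in
lemma not_orient_of_near {u w : ℕ} (h : u = w ∨ A u w) : ¬ D u w := by
  intro h'
  rcases h with rfl | h
  · exact hD.irrefl _ h'
  · exact (hD.nonAdj_iff.mpr (.inl h')).2.2 h

include hD in
lemma orient_or_near {u w : ℕ} (hu : u < n) (hw : w < n) :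
    D u w ∨ D w u ∨ (u = w ∨ A u w) := by
  by_cases h : u = w ∨ A u w
  · exact .inr (.inr h)
  · push Not at h
    have := hD.nonAdj_iff.mp ⟨⟨hu, hw⟩, h⟩
    tauto

lemma near_symm (hA : ∀ ⦃x y⦄, A x y → A y x) {u w : ℕ} (h : u = w ∨ A u w) :
    w = u ∨ A w u := h.imp Eq.symm fun h => hA h

include hA hD hV in
-- Every representative before `w` is not after `u`, as otherwise `u` would precede `w`. A
-- representative near both vertices is counted on the right only.
lemma lo_lt_hi {u w : ℕ} (hu : u < n) (hw : w < n) (h : u = w ∨ A u w) :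
    lo n A D w < hi n A D u := by
  obtain ⟨b, hb, h1, h2⟩ := exists_isRep_near hA hV hu hw h
  refine cnt_lt (y := b) ?_ hb.1.1 ⟨hb, not_orient_of_near hD (near_symm hA h1)⟩
    fun h' => not_orient_of_near hD h2 h'.2
  rintro b' - ⟨hb', h3⟩
  exact ⟨hb', fun h4 => not_orient_of_near hD h (hD.trans h4 h3)⟩

include hD in
-- A representative that is neither after `u` nor before `w` would be near both, and simpliciality
-- would make `u` and `w` adjacent.
lemma hi_le_lo {u w : ℕ} (h : D u w) : hi n A D u ≤ lo n A D w := by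
  obtain ⟨⟨hu, hw⟩, hne, hnA⟩ := hD.nonAdj_iff.mpr (.inl h)
  refine cnt_mono ?_
  rintro b hbn ⟨hb, h1⟩
  refine ⟨hb, ?_⟩
  rcases orient_or_near hD hbn hw with h2 | h2 | h2
  · exact h2
  · exact absurd (hD.trans h h2) h1
  rcases orient_or_near hD hbn hu with h3 | h3 | h3
  · exact hD.trans h3 h
  · exact absurd h3 h1
  rcases h2 with rfl | h2
  · exact absurd h h1
  rcases h3 with rfl | h3
  · exact h
  exact absurd (hb.1.2 u hu w hw h3 h2 hne) hnA

include hA hD hV in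
/-- Adjacency in the canonical model. -/
theorem near_iff {u w : ℕ} (hu : u < n) (hw : w < n) :
    (u = w ∨ A u w) ↔ lo n A D u < hi n A D w ∧ lo n A D w < hi n A D u := by
  constructor
  · exact fun h => ⟨lo_lt_hi hA hD hV hw hu (near_symm hA h), lo_lt_hi hA hD hV hu hw h⟩
  · rintro ⟨h1, h2⟩
    rcases orient_or_near hD hu hw with h | h | h
    · have := hi_le_lo hD h; omega
    · have := hi_le_lo hD h; omega
    · exact h

include hA hD in
lemma isRep_orient {b b' : ℕ} (hb : IsRep n A b) (hb' : IsRep n A b') (hne : b ≠ b') :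
    D b b' ∨ D b' b := by
  refine hD.nonAdj_iff.mp ⟨⟨hb.1.1, hb'.1.1⟩, hne, fun h => ?_⟩
  rcases lt_or_gt_of_ne hne with h' | h'
  · exact hb'.2 b h' ⟨hA h, hb.1⟩
  · exact hb.2 b' h' ⟨h, hb'.1⟩

include hA hD in
lemma hi_isRep {b : ℕ} (hb : IsRep n A b) : hi n A D b = lo n A D b + 1 := by
  classical
  unfold hi lo
  rw [cnt_eq_card, cnt_eq_card, ← Finset.card_insert_of_notMem (a := b) (by simp [hD.irrefl])]
  congr 1
  ext x
  simp only [Finset.mem_filter, Finset.mem_range, Finset.mem_insert]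
  constructor
  · rintro ⟨hx, hxr, hbx⟩
    by_cases h : x = b
    · exact .inl h
    · exact .inr ⟨hx, hxr, (isRep_orient hA hD hxr hb h).resolve_right hbx⟩
  · rintro (rfl | ⟨hx, hxr, hxb⟩)
    · exact ⟨hb.1.1, hb, hD.irrefl _⟩
    · exact ⟨hx, hxr, fun h => hD.irrefl _ (hD.trans h hxb)⟩

include hD in
lemma lo_lt_lo {b b' : ℕ} (hb : IsRep n A b) (h : D b b') : lo n A D b < lo n A D b' :=
  cnt_lt (y := b) (fun _ _ hx => ⟨hx.1, hD.trans hx.2 h⟩) hb.1.1 ⟨hb, h⟩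
    fun h' => hD.irrefl _ h'.2

include hA hD hV in
theorem intervalModel : IntervalModel n (len n A) (lo n A D) (hi n A D) where
  lt u hu := lo_lt_hi hA hD hV hu hu (.inl rfl)
  le u _ := cnt_mono fun _ _ h => h.1
  unit j hj := by
    classical
    set S := (Finset.range n).filter fun b => IsRep n A b with hS
    have hmem : ∀ b, b ∈ S ↔ IsRep n A b := fun b => by
      simp only [hS, Finset.mem_filter, Finset.mem_range, and_iff_right_iff_imp]
      exact fun h => h.1.1
    have hcard : S.card = len n A := (cnt_eq_card _ _).symm
    -- The representatives are linearly ordered by `D`, so `lo` numbers them injectively by values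
    -- below their number; hence every value occurs.
    have hinj : Set.InjOn (lo n A D) S := by
      intro b hb b' hb' he
      by_contra hne
      have hb := (hmem b).mp hb
      have hb' := (hmem b').mp hb'
      rcases isRep_orient hA hD hb hb' hne with h | h
      · exact (lo_lt_lo hD hb h).ne he
      · exact (lo_lt_lo hD hb' h).ne he.symm
    have hsub : S.image (lo n A D) ⊆ Finset.range (len n A) := by
      intro j hj
      obtain ⟨b, hb, rfl⟩ := Finset.mem_image.mp hj
      have hb := (hmem b).mp hb
      exact Finset.mem_range.mpr
        (cnt_lt (y := b) (fun _ _ h => h.1) hb.1.1 hb fun h => hD.irrefl _ h.2)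
    have himg := Finset.eq_of_subset_of_card_le hsub (by
      rw [Finset.card_image_of_injOn hinj, hcard, Finset.card_range])
    have : j ∈ S.image (lo n A D) := by rw [himg]; exact Finset.mem_range.mpr hj
    obtain ⟨b, hb, rfl⟩ := Finset.mem_image.mp this
    have hb := (hmem b).mp hb
    exact ⟨b, hb.1.1, rfl, hi_isRep hA hD hb⟩

include hA hV in
lemma len_pos (hn : 0 < n) : 0 < len n A := by
  obtain ⟨b, hb, -⟩ := exists_isRep_near hA hV hn hn (.inl rfl)
  exact (Nat.zero_le _).trans_lt
    (cnt_lt (P := fun _ => False) (y := b) (fun _ _ h => h.elim) hb.1.1 hb id)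

end

end Backbone

/-! ### Simplicial vertices and complement orders of vertebrate interval graphs -/

namespace SimpleGraph

/-- In a vertebrate graph, every clique is contained in the closed neighbourhood of a simplicial
vertex. -/
lemma exists_simplicial_of_indepNum_eq {V : Type*} [Finite V] {G : SimpleGraph V}
    (hG : G.indepNum = G.numMaximalCliques) {s : Set V} (hs : G.IsClique s) :
    ∃ b, (∀ x y, G.Adj b x → G.Adj b y → x ≠ y → G.Adj x y) ∧ ∀ x ∈ s, b = x ∨ G.Adj b x := by
  classical
  have hmax : ∀ s : Set V, G.IsClique s → ∃ t, s ⊆ t ∧ Maximal G.IsClique t := fun s hs =>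
    (Set.toFinite {s : Set V | G.IsClique s}).exists_le_maximal hs
  obtain ⟨I, hI⟩ := G.exists_isNIndepSet_indepNum
  have hex : ∀ v, ∃ t, v ∈ t ∧ Maximal G.IsClique t := fun v => by
    obtain ⟨t, h1, h2⟩ := hmax {v} (by simp)
    exact ⟨t, h1 rfl, h2⟩
  choose f hf hfm using hex
  set 𝓜 := (Set.toFinite {s : Set V | Maximal G.IsClique s}).toFinset with h𝓜
  have hcard : 𝓜.card = I.card := by
    rw [hI.card_eq, hG, numMaximalCliques, Set.ncard_eq_toFinset_card]
  have hdisj : ∀ x ∈ I, ∀ y ∈ I, ∀ t : Set V, G.IsClique t → x ∈ t → y ∈ t → x = y := by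
    intro x hx y hy t ht hxt hyt
    by_contra hne
    exact hI.isIndepSet hx hy hne (ht hxt hyt hne)
  obtain ⟨t, hst, ht⟩ := hmax s hs
  -- A clique contains at most one element of `I`, so `f` is injective on `I`; equality of the
  -- cardinalities makes it surjective onto the maximal cliques.
  have hsurj := Finset.surj_on_of_inj_on_of_card_le (s := I) (t := 𝓜) (fun x _ => f x)
    (fun x _ => by simp [h𝓜, hfm x])
    (fun x y hx hy he => hdisj x hx y hy (f x) (hfm x).1 (hf x)
      (by rw [show f x = f y from he]; exact hf y)) hcard.le
  obtain ⟨b, hbI, hbt⟩ := hsurj t (by simp [h𝓜, ht])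
  -- A second maximal clique through `b` would also be `f b'` for some `b'` in `I`, and `b = b'` by
  -- independence. Hence all neighbours of `b` lie in `t`.
  have huniq : ∀ t', Maximal G.IsClique t' → b ∈ t' → t' = t := by
    intro t' ht' hb'
    obtain ⟨b', hbI', hbt'⟩ := hsurj t' (by simp [h𝓜, ht'])
    have := hdisj b hbI b' hbI' t' ht'.1 hb' (by rw [hbt']; exact hf b')
    rw [hbt', hbt, this]
  have hnb : ∀ x, G.Adj b x → x ∈ t := by
    intro x hx
    obtain ⟨t', h1, h2⟩ := hmax {b, x} (by
      rw [isClique_pair]; exact fun _ => hx)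
    rw [← huniq t' h2 (h1 (by simp))]
    exact h1 (by simp)
  refine ⟨b, fun x y hx hy hne => ht.1 (hnb x hx) (hnb y hy) hne, fun x hx => ?_⟩
  by_cases he : b = x
  · exact .inl he
  · exact .inr (ht.1 (by rw [hbt]; exact hf b) (hst hx) he)

/-- Adjacency of a graph on `Fin n` as a relation on natural numbers. -/
def adjNat {n : ℕ} (G : SimpleGraph (Fin n)) (a b : ℕ) : Prop :=
  ∃ (ha : a < n) (hb : b < n), G.Adj ⟨a, ha⟩ ⟨b, hb⟩

variable {n : ℕ} {G : SimpleGraph (Fin n)}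

lemma adjNat_iff {a b : Fin n} : G.adjNat a b ↔ G.Adj a b :=
  ⟨fun ⟨_, _, h⟩ => h, fun h => ⟨a.2, b.2, h⟩⟩

lemma adjNat_symm ⦃a b : ℕ⦄ (h : G.adjNat a b) : G.adjNat b a :=
  let ⟨ha, hb, h⟩ := h
  ⟨hb, ha, h.symm⟩

/-- Open intervals are disjoint exactly when one ends no later than the other begins, and
nonemptiness makes this relation transitive. -/
lemma IsIntervalGraph.exists_isOrient (hG : G.IsIntervalGraph) :
    ∃ L, LexOrient.IsOrient n G.adjNat L := by
  obtain ⟨l, r, hlr, hadj⟩ := hG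
  refine ⟨fun a b => ∃ (ha : a < n) (hb : b < n), r ⟨a, ha⟩ ≤ l ⟨b, hb⟩, ?_, ?_, ?_⟩
  · rintro a b c ⟨ha, hb, h⟩ ⟨_, hc, h'⟩
    exact ⟨ha, hc, h.trans ((hlr ⟨b, hb⟩).le.trans h')⟩
  · rintro a ⟨ha, _, h⟩
    exact absurd (hlr ⟨a, ha⟩) (not_lt.mpr h)
  · intro a b
    have key : ∀ (ha : a < n) (hb : b < n), (Set.Ioo (l ⟨a, ha⟩) (r ⟨a, ha⟩) ∩
        Set.Ioo (l ⟨b, hb⟩) (r ⟨b, hb⟩)).Nonempty ↔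
        ¬ (r ⟨a, ha⟩ ≤ l ⟨b, hb⟩ ∨ r ⟨b, hb⟩ ≤ l ⟨a, ha⟩) := by
      intro ha hb
      rw [Set.Ioo_inter_Ioo, Set.nonempty_Ioo, sup_lt_iff, lt_inf_iff, lt_inf_iff]
      have h1 := hlr ⟨a, ha⟩
      have h2 := hlr ⟨b, hb⟩
      push Not
      tauto
    constructor
    · rintro ⟨⟨ha, hb⟩, hne, h⟩
      have hne' : (⟨a, ha⟩ : Fin n) ≠ ⟨b, hb⟩ := by simpa using hne
      have : ¬ G.Adj ⟨a, ha⟩ ⟨b, hb⟩ := fun h' => h ⟨ha, hb, h'⟩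
      rw [hadj _ _ hne', key ha hb, not_not] at this
      exact this.imp (⟨ha, hb, ·⟩) (⟨hb, ha, ·⟩)
    · intro h
      obtain ⟨ha, hb, h⟩ : ∃ (ha : a < n) (hb : b < n),
          r ⟨a, ha⟩ ≤ l ⟨b, hb⟩ ∨ r ⟨b, hb⟩ ≤ l ⟨a, ha⟩ := by
        rcases h with ⟨ha, hb, h⟩ | ⟨hb, ha, h⟩
        · exact ⟨ha, hb, .inl h⟩
        · exact ⟨ha, hb, .inr h⟩
      have hne : (⟨a, ha⟩ : Fin n) ≠ ⟨b, hb⟩ := by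
        intro he
        rw [← he, or_self] at h
        exact absurd (hlr ⟨a, ha⟩) (not_lt.mpr h)
      refine ⟨⟨ha, hb⟩, by simpa using hne, fun ⟨_, _, h'⟩ => ?_⟩
      rw [hadj _ _ hne, key ha hb] at h'
      exact h' h

lemma exists_simplicial_near (hG : G.indepNum = G.numMaximalCliques) {u w : ℕ} (hu : u < n)
    (hw : w < n) (h : u = w ∨ G.adjNat u w) : ∃ b, Backbone.Simplicial n G.adjNat b ∧
      (b = u ∨ G.adjNat b u) ∧ (b = w ∨ G.adjNat b w) := by
  have hs : G.IsClique {(⟨u, hu⟩ : Fin n), ⟨w, hw⟩} := by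
    rw [isClique_pair]
    intro hne
    rcases h with rfl | ⟨_, _, h⟩
    · exact absurd rfl hne
    · exact h
  obtain ⟨b, hb, hb'⟩ := exists_simplicial_of_indepNum_eq hG hs
  refine ⟨b, ⟨b.2, ?_⟩, ?_, ?_⟩
  · rintro x hx y hy ⟨_, _, hbx⟩ ⟨_, _, hby⟩ hne
    exact ⟨hx, hy, hb _ _ hbx hby (by simpa using hne)⟩
  · exact (hb' ⟨u, hu⟩ (by simp)).imp (fun h => by rw [h]) fun h => ⟨b.2, hu, h⟩
  · exact (hb' ⟨w, hw⟩ (by simp)).imp (fun h => by rw [h]) fun h => ⟨b.2, hw, h⟩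

end SimpleGraph

/-! ### Two-colourings of interval models -/

namespace IntervalColoring

/-- The number of positions in `[l, r)` where `x` has the truth value `c`. -/
noncomputable def cntIn (x : ℕ → Prop) (c : Prop) (l r : ℕ) : ℕ :=
  cnt r fun j => l ≤ j ∧ (x j ↔ c)

lemma cntIn_add_not (x : ℕ → Prop) (c : Prop) (l r : ℕ) :
    cntIn x c l r + cntIn x (¬ c) l r = r - l := by
  classical
  unfold cntIn cnt
  rw [← Finset.sum_add_distrib]
  have : ∀ j, RAM.ind (l ≤ j ∧ (x j ↔ c)) + RAM.ind (l ≤ j ∧ (x j ↔ ¬ c)) = RAM.ind (l ≤ j) := by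
    intro j
    by_cases h1 : l ≤ j <;> by_cases h2 : x j <;> by_cases h3 : c <;> simp [RAM.ind, h1, h2, h3]
  rw [Finset.sum_congr rfl fun j _ => this j]
  have := cnt_eq_card r (fun j => l ≤ j)
  unfold cnt at this
  rw [this, ← Nat.card_Ico]
  congr 1
  ext j
  simp [and_comm]

lemma exists_enum {J : Finset ℕ} {v : ℕ} (hJ : v < J.card) :
    ∃ e : ℕ → ℕ, (∀ i ≤ v, e i ∈ J) ∧ ∀ i ≤ v, ∀ j ≤ v, i ≠ j → e i ≠ e j := by
  classical
  refine ⟨fun i => if h : i < J.card then J.equivFin.symm ⟨i, h⟩ else 0, fun i hi => ?_,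
    fun i hi j hj hij he => ?_⟩
  · beta_reduce; rw [dif_pos (by omega)]; exact Subtype.prop _
  · beta_reduce at he; rw [dif_pos (by omega), dif_pos (by omega)] at he
    have := J.equivFin.symm.injective (Subtype.ext he)
    simp only [Fin.mk.injEq] at this
    exact hij this

lemma lt_cnt_of_enum {r v : ℕ} {P : ℕ → Prop} (e : ℕ → ℕ) (he : ∀ i ≤ v, e i < r ∧ P (e i))
    (hinj : ∀ i ≤ v, ∀ j ≤ v, i ≠ j → e i ≠ e j) : v < cnt r P := by
  classical
  rw [cnt_eq_card]
  have h1 : ((Finset.range (v + 1)).image e).card = v + 1 := by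
    rw [Finset.card_image_of_injOn, Finset.card_range]
    intro i hi j hj hij
    simp only [Finset.coe_range, Set.mem_Iio] at hi hj
    by_contra hne
    exact hinj i (by omega) j (by omega) hne hij
  rw [← Nat.succ_le_iff, ← Nat.succ_eq_add_one] at *
  rw [← h1]
  refine Finset.card_le_card fun j hj => ?_
  obtain ⟨i, hi, rfl⟩ := Finset.mem_image.mp hj
  have := he i (by simpa [Nat.lt_succ_iff] using hi)
  simpa using this

variable (n : ℕ) (lo hi : ℕ → ℕ) (v : ℕ)

/-- The vertex `u` is the centre of a monochromatic claw with leaves `w 0, …, w v`. -/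
def Claw (col : ℕ → Prop) (u : ℕ) : Prop :=
  ∃ w : ℕ → ℕ, (∀ i ≤ v, (w i < n ∧ (col (w i) ↔ col u)) ∧ lo (w i) < hi u ∧ lo u < hi (w i)) ∧
    ∀ i ≤ v, ∀ j ≤ v, i ≠ j → hi (w i) ≤ lo (w j) ∨ hi (w j) ≤ lo (w i)

/-- The colouring has no monochromatic claw with more than `v` leaves. -/
def Good (col : ℕ → Prop) : Prop := ∀ u < n, ¬ Claw n lo hi v col u

/-- The interval `[l, r)` is short and its end positions have different colours. -/
def Mixed (x : ℕ → Prop) (l r : ℕ) : Prop := r ≤ l + 2 * v ∧ ¬ (x l ↔ x (r - 1))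

/-- The colour of `[l, r)` determined by the colours `x` of the positions and the colours `y`
of the short intervals with ends of different colours. -/
def canon (x : ℕ → Prop) (y : ℕ → ℕ → Prop) (l r : ℕ) : Prop :=
  (Mixed v x l r → y l r) ∧ (¬ Mixed v x l r → (x l ↔ cntIn x (x l) l r ≤ v))

variable {n lo hi v}

lemma canon_congr {x x' : ℕ → Prop} {y y' : ℕ → ℕ → Prop} {l r : ℕ} (hlr : l < r)
    (hx : ∀ j, l ≤ j → j < r → (x j ↔ x' j)) (hy : Mixed v x' l r → (y l r ↔ y' l r)) :
    canon v x y l r ↔ canon v x' y' l r := by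
  have hl : x l = x' l := propext (hx l le_rfl hlr)
  have hr : x (r - 1) = x' (r - 1) := propext (hx (r - 1) (by omega) (by omega))
  have hm : Mixed v x l r = Mixed v x' l r := by unfold Mixed; rw [hl, hr]
  have hc : cntIn x (x l) l r = cntIn x' (x' l) l r := by
    unfold cntIn
    refine cnt_congr fun j hj => and_congr_right fun hlj => ?_
    rw [hl, hx j hlj hj]
  unfold canon
  rw [hm, hc, hl]
  exact and_congr_left fun _ => imp_congr_right hy

/-- One may assume that the colour depends only on the interval. -/
lemma Good.exists_interval_color {col : ℕ → Prop} (h : Good n lo hi v col) :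
    ∃ χ : ℕ → ℕ → Prop, Good n lo hi v fun u => χ (lo u) (hi u) := by
  classical
  -- Every vertex takes the colour of the least vertex with the same interval. Replacing vertices by
  -- these turns claws of the new colouring into claws of the old one.
  have hτ : ∀ u : ℕ, ∃ τ, u < n → (τ < n ∧ lo τ = lo u ∧ hi τ = hi u) ∧
      ∀ u' < n, lo u' = lo u → hi u' = hi u → τ ≤ u' := by
    intro u
    by_cases hu : u < n
    · have hex : ∃ τ, τ < n ∧ lo τ = lo u ∧ hi τ = hi u := ⟨u, hu, rfl, rfl⟩
      exact ⟨Nat.find hex, fun _ => ⟨Nat.find_spec hex, fun u' h1 h2 h3 =>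
        Nat.find_min' hex ⟨h1, h2, h3⟩⟩⟩
    · exact ⟨0, fun h => absurd h hu⟩
  choose τ hτ using hτ
  let χ : ℕ → ℕ → Prop := fun l r => ∃ u < n, lo u = l ∧ hi u = r ∧ col (τ u)
  have hχ : ∀ u < n, (χ (lo u) (hi u) ↔ col (τ u)) := by
    intro u hu
    constructor
    · rintro ⟨u', hu', h1, h2, h3⟩
      have e : τ u' = τ u := by
        refine le_antisymm ?_ ?_
        · exact (hτ u' hu').2 _ (hτ u hu).1.1 ((hτ u hu).1.2.1.trans h1.symm)
            ((hτ u hu).1.2.2.trans h2.symm)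
        · exact (hτ u hu).2 _ (hτ u' hu').1.1 ((hτ u' hu').1.2.1.trans h1)
            ((hτ u' hu').1.2.2.trans h2)
      rwa [← e]
    · exact fun h => ⟨u, hu, rfl, rfl, h⟩
  refine ⟨χ, fun u hu ⟨w, hw, hd⟩ => h (τ u) (hτ u hu).1.1 ⟨fun i => τ (w i), fun i hi' => ?_,
    fun i hi' j hj hij => ?_⟩⟩
  · obtain ⟨⟨h1, h2⟩, h3⟩ := hw i hi'
    obtain ⟨h4, h5, h6⟩ := (hτ (w i) h1).1
    obtain ⟨h7, h8, h9⟩ := (hτ u hu).1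
    beta_reduce at h2
    rw [hχ _ h1, hχ _ hu] at h2
    exact ⟨⟨h4, h2⟩, by rw [h5, h9, h6, h8]; exact h3⟩
  · obtain ⟨_, h5, h6⟩ := (hτ (w i) (hw i hi').1.1).1
    obtain ⟨_, h8, h9⟩ := (hτ (w j) (hw j hj).1.1).1
    simp only [h5, h6, h8, h9]
    exact hd i hi' j hj hij

section
variable {k : ℕ} (M : IntervalModel n k lo hi) {χ : ℕ → ℕ → Prop}
  (hχ : Good n lo hi v fun u => χ (lo u) (hi u))

include M hχ in
-- More than `v` such positions would be unit intervals forming the leaves of a monochromatic claw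
-- centred at `u`.
lemma cntIn_le_of_good {u : ℕ} (hu : u < n) {c : Prop} (hc : χ (lo u) (hi u) ↔ c) :
    cntIn (fun j => χ j (j + 1)) c (lo u) (hi u) ≤ v := by
  classical
  by_contra hlt
  push Not at hlt
  unfold cntIn at hlt
  rw [cnt_eq_card] at hlt
  obtain ⟨e, he, hinj⟩ := exists_enum hlt
  have hunit : ∀ j, ∃ w, j < k → w < n ∧ lo w = j ∧ hi w = j + 1 := fun j => by
    by_cases hj : j < k
    · obtain ⟨w, h⟩ := M.unit j hj
      exact ⟨w, fun _ => h⟩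
    · exact ⟨0, fun h => absurd h hj⟩
  choose w hw using hunit
  have hek : ∀ i ≤ v, (e i < hi u ∧ lo u ≤ e i ∧ (χ (e i) (e i + 1) ↔ c)) := fun i hi' => by
    simpa using he i hi'
  have hwe : ∀ i ≤ v, w (e i) < n ∧ lo (w (e i)) = e i ∧ hi (w (e i)) = e i + 1 := fun i hi' =>
    hw _ ((hek i hi').1.trans_le (M.le u hu))
  refine hχ u hu ⟨fun i => w (e i), fun i hi' => ?_, fun i hi' j hj hij => ?_⟩
  · obtain ⟨h1, h2, h3⟩ := hwe i hi'
    obtain ⟨h4, h5, h6⟩ := hek i hi'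
    simp only [h2, h3]
    exact ⟨⟨h1, h6.trans hc.symm⟩, h4, by omega⟩
  · obtain ⟨_, h2, h3⟩ := hwe i hi'
    obtain ⟨_, h5, h6⟩ := hwe j hj
    have := hinj i hi' j hj hij
    simp only [h2, h3, h5, h6]
    omega

include M hχ in
lemma minority {u : ℕ} (hu : u < n) :
    ∃ c : Prop, cntIn (fun j => χ j (j + 1)) c (lo u) (hi u) ≤ v :=
  ⟨_, cntIn_le_of_good M hχ hu Iff.rfl⟩

include M hχ in
-- If the colour of the left end occurs more than `v` times, `χ` and `canon` are both the opposite
-- colour. If the ends differ and the interval is short, `canon` copies `χ`. If they differ and it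
-- is longer than `2 * v`, some colour occurs more than `v` times and forces both. Only equal ends
-- of a colour that is not frequent leave room for disagreement.
lemma of_canon_ne {u : ℕ} (hu : u < n)
    (hne : ¬ (canon v (fun j => χ j (j + 1)) χ (lo u) (hi u) ↔ χ (lo u) (hi u))) :
    (χ (lo u) (lo u + 1) ↔ canon v (fun j => χ j (j + 1)) χ (lo u) (hi u)) ∧
    (χ (hi u - 1) (hi u) ↔ canon v (fun j => χ j (j + 1)) χ (lo u) (hi u)) ∧
    cntIn (fun j => χ j (j + 1)) (χ (lo u) (lo u + 1)) (lo u) (hi u) ≤ v := by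
  set x : ℕ → Prop := fun j => χ j (j + 1) with hx
  set l := lo u
  set r := hi u
  have hlr : l < r := M.lt u hu
  have hxl : χ l (l + 1) = x l := rfl
  have hxr : χ (r - 1) r = x (r - 1) := by simp only [hx]; congr 1; omega
  rw [hxl, hxr]
  have hnm : ¬ Mixed v x l r := by
    intro hm
    apply hne
    unfold canon
    tauto
  have hcan : canon v x χ l r ↔ (x l ↔ cntIn x (x l) l r ≤ v) := by
    unfold canon
    tauto
  have hcount : cntIn x (x l) l r ≤ v := by
    by_contra hgt
    have : ¬ (χ l r ↔ x l) := fun h => hgt (cntIn_le_of_good M hχ hu h)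
    tauto
  refine ⟨by tauto, ?_, hcount⟩
  have hsame : x l ↔ x (r - 1) := by
    by_contra hdiff
    have hlong : ¬ r ≤ l + 2 * v := fun h => hnm ⟨h, hdiff⟩
    have hsum := cntIn_add_not x (x l) l r
    have : ¬ (χ l r ↔ ¬ x l) := fun h => by
      have : cntIn x (¬ x l) l r ≤ v := cntIn_le_of_good M hχ hu h
      omega
    tauto
  tauto

end

lemma iff_of_not_iff {p q c : Prop} (h₁ : ¬ (p ↔ c)) (h₂ : ¬ (q ↔ c)) : p ↔ q := by tauto

lemma iff_not_of_not_iff {p c : Prop} (h : ¬ (p ↔ c)) : p ↔ ¬ c := by tauto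

lemma not_of_iff_of_not_iff {p q c : Prop} (h : c ↔ (p ↔ q)) (h₁ : ¬ (p ↔ c)) : ¬ q := by tauto

section
variable {k : ℕ} (M : IntervalModel n k lo hi) {χ : ℕ → ℕ → Prop}
  (hχ : Good n lo hi v fun u => χ (lo u) (hi u))

include M hχ in
/-- The canonical colouring is good. -/
theorem good_canon (hv : 1 ≤ v) :
    Good n lo hi v fun u => canon v (fun j => χ j (j + 1)) χ (lo u) (hi u) := by
  set x : ℕ → Prop := fun j => χ j (j + 1) with hx
  rintro u hu ⟨w, hw, hd⟩
  set c : Prop := canon v x χ (lo u) (hi u) with hc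
  have hother : ∀ i ≤ v, ∃ i' ≤ v, i ≠ i' := fun i _ => by
    by_cases h : i = 0
    · exact ⟨1, hv, by omega⟩
    · exact ⟨0, Nat.zero_le _, h⟩
  -- A leaf covering the centre would meet every other leaf; `1 ≤ v` provides another one.
  have hncover : ∀ i ≤ v, ¬ (lo (w i) ≤ lo u ∧ hi u ≤ hi (w i)) := by
    rintro i hi' ⟨h1, h2⟩
    obtain ⟨i', hi'', hne⟩ := hother i hi'
    have := hd i hi' i' hi'' hne
    have := (hw i' hi'').2
    omega
  have hpos : ∀ i ≤ v, (x (lo (w i)) ↔ c) → (x (hi (w i) - 1) ↔ c) →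
      ∃ j, (lo (w i) ≤ j ∧ j < hi (w i)) ∧ (lo u ≤ j ∧ j < hi u) ∧ (x j ↔ c) := by
    intro i hi' h1 h2
    obtain ⟨⟨h3, -⟩, h4, h5⟩ := hw i hi'
    have h6 := M.lt _ h3
    by_cases h : lo u ≤ lo (w i)
    · exact ⟨lo (w i), ⟨le_rfl, h6⟩, ⟨h, h4⟩, h1⟩
    · have := hncover i hi'
      exact ⟨hi (w i) - 1, ⟨by omega, by omega⟩, ⟨by omega, by omega⟩, h2⟩
  by_cases hcu : χ (lo u) (hi u) ↔ c
  -- The centre has kept its colour. A recoloured leaf has both end positions coloured `c` and does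
  -- not cover the centre, so an end position lies in the centre; its unit interval replaces the
  -- leaf, giving a claw for `χ`.
  · have hrep : ∀ i, ∃ w', i ≤ v → (w' < n ∧ (χ (lo w') (hi w') ↔ c)) ∧
        (lo (w i) ≤ lo w' ∧ hi w' ≤ hi (w i)) ∧ lo w' < hi u ∧ lo u < hi w' := by
      intro i
      by_cases hi' : i ≤ v
      swap
      · exact ⟨0, fun h => absurd h hi'⟩
      obtain ⟨⟨h3, h3'⟩, h4, h5⟩ := hw i hi'
      by_cases hci : χ (lo (w i)) (hi (w i)) ↔ c
      · exact ⟨w i, fun _ => ⟨⟨h3, hci⟩, ⟨le_rfl, le_rfl⟩, h4, h5⟩⟩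
      · obtain ⟨h6, h7, -⟩ := of_canon_ne M hχ h3 fun h => hci (h.symm.trans h3')
        have e : hi (w i) - 1 + 1 = hi (w i) := by have := M.lt _ h3; omega
        obtain ⟨j, hj1, hj2, hj3⟩ := hpos i hi' (h6.trans h3')
          (by simp only [hx, e]; exact h7.trans h3')
        obtain ⟨w', hw1, hw2, hw3⟩ := M.unit j (hj2.2.trans_le (M.le u hu))
        refine ⟨w', fun _ => ⟨⟨hw1, by rw [hw2, hw3]; exact hj3⟩, ?_, ?_⟩⟩ <;> omega
    choose w' hw' using hrep
    refine hχ u hu ⟨w', fun i hi' => ?_, fun i hi' j hj hij => ?_⟩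
    · obtain ⟨⟨h1, h2⟩, -, h3⟩ := hw' i hi'
      exact ⟨⟨h1, h2.trans hcu.symm⟩, h3⟩
    · obtain ⟨-, h1, -⟩ := hw' i hi'
      obtain ⟨-, h2, -⟩ := hw' j hj
      have := hd i hi' j hj hij
      omega
  -- The centre was recoloured, so neither colour occurs more than `v` times in it. The disjoint
  -- leaves nevertheless yield `v + 1` positions of colour `c` there.
  · obtain ⟨h1, h2, h3⟩ := of_canon_ne M hχ hu fun h => hcu h.symm
    have hcl : x (lo u) ↔ c := h1
    have hcr : x (hi u - 1) ↔ c := by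
      have e : hi u - 1 + 1 = hi u := by have := M.lt _ hu; omega
      simp only [hx, e]; exact h2
    have h3 : cntIn x c (lo u) (hi u) ≤ v := by rw [← propext hcl]; exact h3
    have h4 : cntIn x (¬ c) (lo u) (hi u) ≤ v := cntIn_le_of_good M hχ hu (iff_not_of_not_iff hcu)
    have hrep : ∀ i, ∃ j, i ≤ v → (lo (w i) ≤ j ∧ j < hi (w i)) ∧ (lo u ≤ j ∧ j < hi u) ∧
        (x j ↔ c) := by
      intro i
      by_cases hi' : i ≤ v
      swap
      · exact ⟨0, fun h => absurd h hi'⟩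
      obtain ⟨⟨h5, h5'⟩, h6, h7⟩ := hw i hi'
      have hlt := M.lt u hu
      have hlt' := M.lt _ h5
      by_cases hl : lo (w i) ≤ lo u
      · exact ⟨lo u, fun _ => ⟨⟨hl, h7⟩, ⟨le_rfl, hlt⟩, hcl⟩⟩
      by_cases hr : hi u ≤ hi (w i)
      · exact ⟨hi u - 1, fun _ => ⟨⟨by omega, by omega⟩, ⟨by omega, by omega⟩, hcr⟩⟩
      -- The leaf now lies strictly inside the centre. Without a position coloured `c`, it could be
      -- coloured `c` only because the other colour occurs in it more than `v` times, which exceeds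
      -- the count in the centre.
      by_contra hnone
      have hall : ∀ j, lo (w i) ≤ j → j < hi (w i) → ¬ (x j ↔ c) := fun j hj1 hj2 =>
        fun h => hnone ⟨j, fun _ => ⟨⟨hj1, hj2⟩, ⟨by omega, by omega⟩, h⟩⟩
      have e1 := hall (lo (w i)) le_rfl hlt'
      have e2 := hall (hi (w i) - 1) (by omega) (by omega)
      have hnm : ¬ Mixed v x (lo (w i)) (hi (w i)) := fun h => h.2 (iff_of_not_iff e1 e2)
      have hgt : ¬ cntIn x (x (lo (w i))) (lo (w i)) (hi (w i)) ≤ v := by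
        have h8 : canon v x χ (lo (w i)) (hi (w i)) ↔ c := h5'
        exact not_of_iff_of_not_iff (h8.symm.trans ⟨fun h => h.2 hnm, fun h =>
          ⟨fun h' => absurd h' hnm, fun _ => h⟩⟩) e1
      have hle : cntIn x (x (lo (w i))) (lo (w i)) (hi (w i)) ≤ cntIn x (¬ c) (lo u) (hi u) := by
        unfold cntIn
        have hsub : cnt (hi (w i)) (fun j => lo (w i) ≤ j ∧ (x j ↔ x (lo (w i)))) ≤
            cnt (hi u) (fun j => j < hi (w i) ∧ lo (w i) ≤ j ∧ (x j ↔ x (lo (w i)))) := by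
          classical
          rw [cnt_eq_card, cnt_eq_card]
          refine Finset.card_le_card fun j hj => ?_
          simp only [Finset.mem_filter, Finset.mem_range] at hj ⊢
          exact ⟨by omega, hj⟩
        refine hsub.trans (cnt_mono fun j _ hj => ⟨by omega, ?_⟩)
        exact hj.2.2.trans (iff_not_of_not_iff e1)
      omega
    choose e he using hrep
    have : v < cntIn x c (lo u) (hi u) := lt_cnt_of_enum e
      (fun i hi' => ⟨(he i hi').2.1.2, (he i hi').2.1.1, (he i hi').2.2⟩)
      (fun i hi' j hj hij hee => by
        have h5 := (he i hi').1
        have h6 := (he j hj).1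
        have := hd i hi' j hj hij
        omega)
    omega

end

/-! #### Dynamic programming over the positions -/

variable (n lo hi v) in
/-- The vertex `w` meets a vertex whose interval contains `t`. -/
def Win (t w : ℕ) : Prop := ∃ u < n, (lo u ≤ t ∧ t < hi u) ∧ lo w < hi u ∧ lo u < hi w

variable (n lo hi v) in
/-- The local colouring has no monochromatic claw with a centre starting at `t`. -/
def Check (col : ℕ → Prop) (t : ℕ) : Prop := ∀ u < n, lo u = t → ¬ Claw n lo hi v col u

variable (n lo hi v) in
/-- The codes `s < S` of local colourings `dec s` that are reachable at position `t`. -/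
def Reach (S : ℕ) (dec : ℕ → ℕ → Prop) : ℕ → ℕ → Prop
  | 0 => fun s => Check n lo hi v (dec s) 0
  | t + 1 => fun s => Check n lo hi v (dec s) (t + 1) ∧
      ∃ s' < S, Reach S dec t s' ∧
        ∀ w < n, Win n lo hi t w ∧ Win n lo hi (t + 1) w → (dec s' w ↔ dec s w)

lemma Reach.exists_path {S : ℕ} {dec : ℕ → ℕ → Prop} {t s : ℕ} (h : Reach n lo hi v S dec t s) :
    ∃ σ : ℕ → ℕ, σ t = s ∧ (∀ i ≤ t, Check n lo hi v (dec (σ i)) i) ∧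
      ∀ i < t, ∀ w < n, Win n lo hi i w → Win n lo hi (i + 1) w →
        (dec (σ i) w ↔ dec (σ (i + 1)) w) := by
  induction t generalizing s with
  | zero =>
    exact ⟨fun _ => s, rfl, fun i hi' => by obtain rfl := Nat.le_zero.mp hi'; exact h,
      fun i hi' => absurd hi' (Nat.not_lt_zero _)⟩
  | succ t ih =>
    obtain ⟨h1, s', -, h2, h3⟩ := h
    obtain ⟨σ, e, h4, h5⟩ := ih h2
    refine ⟨fun i => if i ≤ t then σ i else s, by simp, fun i hi' => ?_, fun i hi' w hw w1 w2 => ?_⟩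
    · by_cases h : i ≤ t
      · simpa [h] using h4 i h
      · obtain rfl : i = t + 1 := by omega
        simpa using h1
    · rcases Nat.lt_succ_iff_lt_or_eq.mp hi' with h | rfl
      · have h' : i ≤ t := by omega
        have h'' : i + 1 ≤ t := h
        simpa [h', h''] using h5 i h w hw w1 w2
      · simpa [e] using h3 w hw ⟨w1, w2⟩

section
variable {k : ℕ} (M : IntervalModel n k lo hi)

include M in
lemma win_self {w t : ℕ} (hw : w < n) (ht : lo w ≤ t ∧ t < hi w) : Win n lo hi t w :=
  ⟨w, hw, ht, M.lt w hw, M.lt w hw⟩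

include M in
-- If neither witnessing interval contains `t`, one ends by `t` and the other begins after `t`;
-- meeting both, `w` contains `t`.
lemma Win.convex {i j t w : ℕ} (hw : w < n) (h : Win n lo hi i w) (h' : Win n lo hi j w)
    (hit : i ≤ t) (htj : t ≤ j) : Win n lo hi t w := by
  obtain ⟨u, hu, h1, h2⟩ := h
  obtain ⟨u', hu', h1', h2'⟩ := h'
  by_cases c1 : lo u ≤ t ∧ t < hi u
  · exact ⟨u, hu, c1, h2⟩
  by_cases c2 : lo u' ≤ t ∧ t < hi u'
  · exact ⟨u', hu', c2, h2'⟩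
  exact win_self M hw (by omega)

include M in
-- Each vertex takes its colour from the code at its left end. By convexity of windows, this agrees
-- with every code whose window contains the vertex, in particular with the one that checked a given
-- centre.
theorem good_of_reach {S : ℕ} {dec : ℕ → ℕ → Prop} {s : ℕ}
    (h : Reach n lo hi v S dec (k - 1) s) : ∃ col, Good n lo hi v col := by
  obtain ⟨σ, -, hc, hagree⟩ := h.exists_path
  have key : ∀ w < n, ∀ d i, i + d ≤ k - 1 → Win n lo hi i w → Win n lo hi (i + d) w →
      (dec (σ i) w ↔ dec (σ (i + d)) w) := by
    intro w hw d
    induction d with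
    | zero => exact fun _ _ _ _ => Iff.rfl
    | succ d ih =>
      intro i hid h1 h2
      have h3 : Win n lo hi (i + d) w := h1.convex M hw h2 (by omega) (by omega)
      exact (ih i (by omega) h1 h3).trans (hagree (i + d) (by omega) w hw h3 h2)
  have key' : ∀ w < n, ∀ i j, i ≤ k - 1 → j ≤ k - 1 → Win n lo hi i w → Win n lo hi j w →
      (dec (σ i) w ↔ dec (σ j) w) := by
    intro w hw i j hik hjk h1 h2
    rcases le_total i j with h | h
    · obtain ⟨d, rfl⟩ := Nat.exists_eq_add_of_le h
      exact key w hw d i hjk h1 h2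
    · obtain ⟨d, rfl⟩ := Nat.exists_eq_add_of_le h
      exact (key w hw d j hik h2 h1).symm
  have hlo : ∀ w < n, lo w ≤ k - 1 := fun w hw => by
    have := M.lt w hw; have := M.le w hw; omega
  refine ⟨fun w => dec (σ (lo w)) w, fun u hu ⟨w, hw, hd⟩ => hc (lo u) (hlo u hu) u hu rfl
    ⟨w, fun i hi' => ?_, hd⟩⟩
  obtain ⟨⟨h1, h2⟩, h3⟩ := hw i hi'
  refine ⟨⟨h1, ?_⟩, h3⟩
  beta_reduce at h2
  rw [← h2]
  exact key' _ h1 _ _ (hlo u hu) (hlo _ h1) ⟨u, hu, ⟨le_rfl, M.lt u hu⟩, h3⟩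
    (win_self M h1 ⟨le_rfl, M.lt _ h1⟩)

include M in
-- The leaves of a centre starting at `t` lie in the window of `t`, so agreement with `col` on that
-- window suffices for the check.
theorem exists_reach_of_good {S : ℕ} {dec : ℕ → ℕ → Prop} {col : ℕ → Prop}
    (hcol : Good n lo hi v col) (hk : 0 < k)
    (hdec : ∀ t < k, ∃ s < S, ∀ w < n, Win n lo hi t w → (dec s w ↔ col w)) :
    ∃ s < S, Reach n lo hi v S dec (k - 1) s := by
  have hcheck : ∀ s t, (∀ w < n, Win n lo hi t w → (dec s w ↔ col w)) →
      Check n lo hi v (dec s) t := by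
    rintro s t h u hu rfl ⟨w, hw, hd⟩
    refine hcol u hu ⟨w, fun i hi' => ?_, hd⟩
    obtain ⟨⟨h1, h2⟩, h3⟩ := hw i hi'
    refine ⟨⟨h1, ?_⟩, h3⟩
    rw [← h _ h1 ⟨u, hu, ⟨le_rfl, M.lt u hu⟩, h3⟩, h2,
      h u hu (win_self M hu ⟨le_rfl, M.lt u hu⟩)]
  suffices H : ∀ t < k, ∀ s, (∀ w < n, Win n lo hi t w → (dec s w ↔ col w)) →
      Reach n lo hi v S dec t s by
    obtain ⟨s, hs, h⟩ := hdec (k - 1) (by omega)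
    exact ⟨s, hs, H _ (by omega) s h⟩
  intro t
  induction t with
  | zero => exact fun _ s h => hcheck s 0 h
  | succ t ih =>
    intro ht s h
    obtain ⟨s', hs', h'⟩ := hdec t (by omega)
    exact ⟨hcheck s _ h, s', hs', ih (by omega) s' h', fun w hw hww =>
      (h' w hw hww.1).trans (h w hw hww.2).symm⟩

end

end IntervalColoring

/-! ### Codes of local colourings -/

namespace IntervalColoring

lemma exists_digits {B : ℕ} (m : ℕ) (f : ℕ → ℕ) (hf : ∀ i < m, f i < B) :
    ∃ s < B ^ m, ∀ i < m, s / B ^ i % B = f i := by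
  induction m generalizing f with
  | zero => exact ⟨0, by simp, fun i hi => absurd hi (Nat.not_lt_zero _)⟩
  | succ m ih =>
    obtain ⟨s, hs, h⟩ := ih (fun i => f (i + 1)) fun i hi => hf _ (by omega)
    have h0 := hf 0 (Nat.succ_pos m)
    refine ⟨f 0 + B * s, ?_, fun i hi => ?_⟩
    · have : B * (s + 1) ≤ B * B ^ m := Nat.mul_le_mul_left _ hs
      rw [pow_succ']
      rw [Nat.mul_succ] at this
      omega
    · cases i with
      | zero => simp [Nat.mod_eq_of_lt h0]
      | succ i =>
        rw [pow_succ', ← Nat.div_div_eq_div_mul, Nat.add_mul_div_left _ _ (by omega),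
          Nat.div_eq_of_lt h0, zero_add, h i (by omega)]

lemma exists_surj_enum {K : Finset ℕ} {m : ℕ} (hK : K.card ≤ m) (hne : K.Nonempty) :
    ∃ e : ℕ → ℕ, (∀ i, e i ∈ K) ∧ ∀ q ∈ K, ∃ i < m, e i = q := by
  obtain ⟨q₀, hq₀⟩ := hne
  refine ⟨fun i => if h : i < K.card then K.equivFin.symm ⟨i, h⟩ else q₀, fun i => ?_,
    fun q hq => ⟨K.equivFin ⟨q, hq⟩, by omega, ?_⟩⟩
  · beta_reduce
    split_ifs
    · exact Subtype.prop _
    · exact hq₀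
  · beta_reduce
    rw [dif_pos (Fin.is_lt _)]
    simp

section
variable (n v : ℕ) (p₂ pB : ℕ → ℕ)

/-- The base of the codes, for a table `p₂` of the powers of two. -/
def base : ℕ := n * p₂ (4 * v + 2)

/-- The position in the `i`-th entry of a code. -/
def key (s i : ℕ) : ℕ := s / pB i % base n v p₂ % n

/-- The bit mask in the `i`-th entry of a code. -/
def mask (s i : ℕ) : ℕ := s / pB i % base n v p₂ / n

/-- The `j`-th bit of `β` is set. -/
def Bit (β j : ℕ) : Prop := β / p₂ j % 2 = 1

/-- The colour of the position `j` for the code `s`. -/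
def posColor (s j : ℕ) : Prop :=
  ∃ i < 21 * v, (key n v p₂ pB s i ≤ j ∧ Bit p₂ (mask n v p₂ pB s i) 0) ∧
    ∀ i' < 21 * v, key n v p₂ pB s i' ≤ j → key n v p₂ pB s i' ≤ key n v p₂ pB s i

/-- The colour of the short interval `[l, r)` for the code `s`. -/
def shortColor (s l r : ℕ) : Prop :=
  ∃ i < 21 * v,
    (key n v p₂ pB s i = l ∧ Bit p₂ (mask n v p₂ pB s i) (1 + (r - l))) ∨
    (key n v p₂ pB s i + 1 = r ∧ Bit p₂ (mask n v p₂ pB s i) (2 * v + 1 + (r - l)))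

/-- The colour of the vertex `u` for the code `s`. -/
def decode (lo hi : ℕ → ℕ) (s u : ℕ) : Prop :=
  canon v (posColor n v p₂ pB s) (shortColor n v p₂ pB s) (lo u) (hi u)

end

variable {n v : ℕ} {p₂ pB : ℕ → ℕ}

/-- The digits are `q + n * β q`, with `q` running through `K`, possibly with repetitions. Decoding
uses the digits only through existential statements, so order and multiplicity are irrelevant. -/
lemma exists_code (hn : 0 < n) (hB : ∀ i < 21 * v, pB i = base n v p₂ ^ i)
    {K : Finset ℕ} (hK : K.card ≤ 21 * v) (hne : K.Nonempty) (hKn : ∀ q ∈ K, q < n) (β : ℕ → ℕ)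
    (hβ : ∀ q ∈ K, β q < p₂ (4 * v + 2)) : ∃ s < base n v p₂ ^ (21 * v), ∀ Φ : ℕ → ℕ → Prop,
      (∃ i < 21 * v, Φ (key n v p₂ pB s i) (mask n v p₂ pB s i)) ↔ ∃ q ∈ K, Φ q (β q) := by
  obtain ⟨e, he, hsurj⟩ := exists_surj_enum hK hne
  have hd : ∀ i, e i + n * β (e i) < base n v p₂ := fun i => by
    have h1 := hKn _ (he i)
    have h2 : n * (β (e i) + 1) ≤ n * p₂ (4 * v + 2) := Nat.mul_le_mul_left n (hβ _ (he i))
    rw [Nat.mul_succ] at h2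
    unfold base
    omega
  obtain ⟨s, hs, hdig⟩ := exists_digits (21 * v) (fun i => e i + n * β (e i)) fun i _ => hd i
  have hkey : ∀ i < 21 * v, key n v p₂ pB s i = e i := fun i hi => by
    rw [key, hB i hi, hdig i hi, Nat.add_mul_mod_self_left, Nat.mod_eq_of_lt (hKn _ (he i))]
  have hmask : ∀ i < 21 * v, mask n v p₂ pB s i = β (e i) := fun i hi => by
    rw [mask, hB i hi, hdig i hi, Nat.add_mul_div_left _ _ hn, Nat.div_eq_of_lt (hKn _ (he i)),
      zero_add]
  refine ⟨s, hs, fun Φ => ⟨?_, ?_⟩⟩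
  · rintro ⟨i, hi, h⟩
    rw [hkey i hi, hmask i hi] at h
    exact ⟨e i, he i, h⟩
  · rintro ⟨q, hq, h⟩
    obtain ⟨i, hi, rfl⟩ := hsurj q hq
    exact ⟨i, hi, by rwa [hkey i hi, hmask i hi]⟩

lemma exists_bits (h₂ : ∀ j ≤ 4 * v + 2, p₂ j = 2 ^ j) (P : ℕ → Prop) :
    ∃ β < p₂ (4 * v + 2), ∀ j < 4 * v + 2, Bit p₂ β j ↔ P j := by
  obtain ⟨β, hβ, h⟩ := exists_digits (4 * v + 2) (fun j => RAM.ind (P j)) (B := 2) fun j _ =>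
    (RAM.ind_le_one _).trans_lt one_lt_two
  refine ⟨β, by rwa [h₂ _ le_rfl], fun j hj => ?_⟩
  rw [Bit, h₂ j hj.le, h j hj, RAM.ind_eq_one]

/-! ### Key sets and the number of codes of a window -/

/-- A set of positions in a window `[p, q)` that suffices for encoding a colouring in it. -/
structure IsKeySet (v : ℕ) (x : ℕ → Prop) (p q : ℕ) (K : Finset ℕ) : Prop where
  mem_window : ∀ j ∈ K, p ≤ j ∧ j < q
  first : p ∈ K
  toggle : ∀ j, p < j → j < q → ¬ (x (j - 1) ↔ x j) → j ∈ K
  mixed : ∀ l r, p ≤ l → l < r → r ≤ q → Mixed v x l r → l ∈ K ∨ r - 1 ∈ K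

/-- Every change of colour is a key, so the colour is constant from one key up to the next. -/
lemma IsKeySet.color_eq {x : ℕ → Prop} {p q : ℕ} {K : Finset ℕ} (hK : IsKeySet v x p q K) {a : ℕ}
    (ha : p ≤ a) (d : ℕ) (hd : a + d < q) (hmax : ∀ b ∈ K, b ≤ a + d → b ≤ a) :
    x a ↔ x (a + d) := by
  induction d with
  | zero => exact Iff.rfl
  | succ d ih =>
    refine (ih (by omega) fun b hb h => hmax b hb (by omega)).trans ?_
    by_contra h
    have := hmax _ (hK.toggle (a + (d + 1)) (by omega) hd h) le_rfl
    omega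

/-- The canonical colouring restricted to a window with a small key set has a code. -/
lemma exists_code_of_isKeySet (hn : 0 < n) (h₂ : ∀ j ≤ 4 * v + 2, p₂ j = 2 ^ j)
    (hB : ∀ i < 21 * v, pB i = base n v p₂ ^ i) {χ : ℕ → ℕ → Prop} {p q : ℕ} (hq : q ≤ n)
    {K : Finset ℕ} (hK : IsKeySet v (fun j => χ j (j + 1)) p q K) (hcard : K.card ≤ 21 * v) :
    ∃ s < base n v p₂ ^ (21 * v), ∀ l r, p ≤ l → l < r → r ≤ q →
      (canon v (posColor n v p₂ pB s) (shortColor n v p₂ pB s) l r ↔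
        canon v (fun j => χ j (j + 1)) χ l r) := by
  -- Bit `0` is the colour of position `a`; bits up to `2 * v + 1` serve the intervals starting at
  -- `a`, the others those ending at `a + 1`. Bit `1` belongs to the empty interval and is never
  -- needed.
  have hβ : ∀ a : ℕ, ∃ β < p₂ (4 * v + 2), ∀ j < 4 * v + 2, Bit p₂ β j ↔
      (if j = 0 then χ a (a + 1) else if j ≤ 2 * v + 1 then χ a (a + (j - 1))
        else χ (a + 1 - (j - (2 * v + 1))) (a + 1)) := fun a => exists_bits h₂ _
  choose β hβ hbit using hβ
  obtain ⟨s, hs, hcode⟩ := exists_code hn hB hcard ⟨p, hK.first⟩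
    (fun a ha => (hK.mem_window a ha).2.trans_le hq) β fun a _ => hβ a
  refine ⟨s, hs, fun l r hpl hlr hrq => canon_congr hlr (fun j hlj hjr => ?_) fun hm => ?_⟩
  · have h1 : posColor n v p₂ pB s j ↔ ∃ a ∈ K, (a ≤ j ∧ Bit p₂ (β a) 0) ∧
        ∀ b ∈ K, b ≤ j → b ≤ a := by
      unfold posColor
      rw [← hcode fun a b => (a ≤ j ∧ Bit p₂ b 0) ∧ ∀ b ∈ K, b ≤ j → b ≤ a]
      refine exists_congr fun i => and_congr_right fun _ => and_congr_right fun _ => ?_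
      -- `hcode` transfers existential statements only, so maximality of a key is transferred
      -- through its negation.
      have := hcode fun a _ => a ≤ j ∧ ¬ a ≤ key n v p₂ pB s i
      constructor
      · intro h b hb hbj
        by_contra hc
        obtain ⟨i', hi', h3⟩ := this.mpr ⟨b, hb, hbj, hc⟩
        exact h3.2 (h i' hi' h3.1)
      · intro h i' hi' h3
        by_contra hc
        obtain ⟨b, hb, h4⟩ := this.mp ⟨i', hi', h3, hc⟩
        exact h4.2 (h b hb h4.1)
    have hb0 : ∀ a, Bit p₂ (β a) 0 ↔ χ a (a + 1) := fun a => by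
      simpa using hbit a 0 (by omega)
    have hne : (K.filter (· ≤ j)).Nonempty :=
      ⟨p, Finset.mem_filter.mpr ⟨hK.first, by omega⟩⟩
    have hmem := Finset.max'_mem _ hne
    set a := (K.filter (· ≤ j)).max' hne
    rw [Finset.mem_filter] at hmem
    have hmax : ∀ b ∈ K, b ≤ j → b ≤ a := fun b hb hbj =>
      Finset.le_max' _ _ (Finset.mem_filter.mpr ⟨hb, hbj⟩)
    have hcol : ∀ a ∈ K, a ≤ j → (∀ b ∈ K, b ≤ j → b ≤ a) → (χ a (a + 1) ↔ χ j (j + 1)) := by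
      intro b hb hbj hbmax
      have e : b + (j - b) = j := by omega
      have := hK.color_eq (hK.mem_window b hb).1 (j - b) (by omega) (by rwa [e])
      rwa [e] at this
    rw [h1]
    constructor
    · rintro ⟨b, hb, ⟨h3, h4⟩, h5⟩
      exact (hcol b hb h3 h5).mp ((hb0 b).mp h4)
    · exact fun h => ⟨a, hmem.1, ⟨hmem.2, (hb0 a).mpr ((hcol a hmem.1 hmem.2 hmax).mpr h)⟩, hmax⟩
  · have hshort : r - l ≤ 2 * v := by have := hm.1; omega
    have hbl : Bit p₂ (β l) (1 + (r - l)) ↔ χ l r := by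
      rw [hbit l _ (by omega), if_neg (by omega), if_pos (by omega)]
      rw [show l + (1 + (r - l) - 1) = r by omega]
    have hbr : Bit p₂ (β (r - 1)) (2 * v + 1 + (r - l)) ↔ χ l r := by
      rw [hbit (r - 1) _ (by omega), if_neg (by omega), if_neg (by omega)]
      rw [show r - 1 + 1 - (2 * v + 1 + (r - l) - (2 * v + 1)) = l by omega,
        show r - 1 + 1 = r by omega]
    unfold shortColor
    rw [hcode fun a b => (a = l ∧ Bit p₂ b (1 + (r - l))) ∨
      (a + 1 = r ∧ Bit p₂ b (2 * v + 1 + (r - l)))]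
    constructor
    · rintro ⟨a, -, ⟨rfl, h⟩ | ⟨h', h⟩⟩
      · exact hbl.mp h
      · obtain rfl : a = r - 1 := by omega
        exact hbr.mp h
    · intro h
      rcases hK.mixed l r hpl hlr hrq hm with h' | h'
      · exact ⟨l, h', .inl ⟨rfl, hbl.mpr h⟩⟩
      · exact ⟨r - 1, h', .inr ⟨by omega, hbr.mpr h⟩⟩

open Classical in
/-- The keys contributed by a piece `[a, b)` in which the truth value `c` is rare. -/
noncomputable def pieceKeys (v : ℕ) (x : ℕ → Prop) (c : Prop) (a b : ℕ) : Finset ℕ :=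
  let R := (Finset.range b).filter fun j => a ≤ j ∧ (x j ↔ c)
  R ∪ R.image (· + 1) ∪ Finset.Icc (b - 2 * v) b

/-- The rare positions and their successors contribute at most `2 * v`, the final stretch at most `2
* v + 1`. -/
lemma card_pieceKeys {x : ℕ → Prop} {c : Prop} {a b : ℕ} (h : cntIn x c a b ≤ v) :
    (pieceKeys v x c a b).card ≤ 4 * v + 1 := by
  classical
  unfold cntIn at h
  rw [cnt_eq_card] at h
  unfold pieceKeys
  refine (Finset.card_union_le _ _).trans ?_
  have h1 := (Finset.card_union_le ((Finset.range b).filter fun j => a ≤ j ∧ (x j ↔ c))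
    (((Finset.range b).filter fun j => a ≤ j ∧ (x j ↔ c)).image (· + 1)))
  have h2 := Finset.card_image_le (s := (Finset.range b).filter fun j => a ≤ j ∧ (x j ↔ c))
    (f := (· + 1))
  rw [Nat.card_Icc]
  have h3 : ((Finset.range b).filter fun j => a ≤ j ∧ (x j ↔ c)).card ≤ v := by convert h
  omega

lemma mem_pieceKeys {x : ℕ → Prop} {c : Prop} {a b j : ℕ} :
    j ∈ pieceKeys v x c a b ↔ ((j < b ∧ a ≤ j ∧ (x j ↔ c)) ∨
      ∃ i, (i < b ∧ a ≤ i ∧ (x i ↔ c)) ∧ i + 1 = j) ∨ (b - 2 * v ≤ j ∧ j ≤ b) := by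
  classical
  simp [pieceKeys, or_assoc]

/-- Of two neighbouring positions with different colours one is rare; beyond the piece only `j = b`
is possible, which belongs to the final stretch. -/
lemma pieceKeys_toggle {x : ℕ → Prop} {c : Prop} {a b j : ℕ} (hj : 0 < j) (ha : a ≤ j - 1)
    (hb : j - 1 < b) (h : ¬ (x (j - 1) ↔ x j)) : j ∈ pieceKeys v x c a b := by
  rw [mem_pieceKeys]
  by_cases hjb : j < b
  · by_cases hc : x j ↔ c
    · exact .inl (.inl ⟨hjb, by omega, hc⟩)
    · exact .inl (.inr ⟨j - 1, ⟨hb, ha, by tauto⟩, by omega⟩)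
  · exact .inr (by omega)

/-- If both ends lie in the piece, one of them is rare. Otherwise the interval sticks out and, being
short, begins within `2 * v` of `b`. -/
lemma pieceKeys_mixed {x : ℕ → Prop} {c : Prop} {a b l r : ℕ} (hlr : l < r) (ha : a ≤ l)
    (hb : l < b) (h : Mixed v x l r) :
    l ∈ pieceKeys v x c a b ∨ r - 1 ∈ pieceKeys v x c a b := by
  obtain ⟨h1, h2⟩ := h
  rw [mem_pieceKeys, mem_pieceKeys]
  by_cases hrb : r - 1 < b
  · by_cases hc : x l ↔ c
    · exact .inl (.inl (.inl ⟨hb, ha, hc⟩))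
    · exact .inr (.inl (.inl ⟨hrb, by omega, by tauto⟩))
  · exact .inl (.inr (by omega))

variable {lo hi : ℕ → ℕ} {k : ℕ}

/-- Every window around a position is covered by four intervals. -/
lemma exists_window (M : IntervalModel n k lo hi) {t : ℕ} (ht : t < k) :
    ∃ w : Fin 4 → ℕ, (∀ i, w i < n) ∧ ∃ p q, p < q ∧ q ≤ k ∧
      (∀ u < n, Win n lo hi t u → p ≤ lo u ∧ hi u ≤ q) ∧
      ∀ j, p ≤ j → j < q → ∃ i, lo (w i) ≤ j ∧ j < hi (w i) := by
  classical
  set W := (Finset.range n).filter fun u => Win n lo hi t u with hW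
  have hmem : ∀ u, u ∈ W ↔ u < n ∧ Win n lo hi t u := by simp [hW]
  have hne : W.Nonempty := by
    obtain ⟨u, hu, h1, h2⟩ := M.unit t ht
    exact ⟨u, (hmem u).mpr ⟨hu, win_self M hu (by omega)⟩⟩
  obtain ⟨a, ha, hamin⟩ := W.exists_min_image lo hne
  obtain ⟨b, hb, hbmax⟩ := W.exists_max_image hi hne
  obtain ⟨han, u, hu, h1, h2⟩ := (hmem a).mp ha
  obtain ⟨hbn, u', hu', h1', h2'⟩ := (hmem b).mp hb
  -- `a` and `b` reach furthest left and right among the vertices of the window; `u` and `u'`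
  -- contain `t` and meet `a` and `b`, so no gap remains.
  refine ⟨![a, u, u', b], ?_, lo a, hi b, ?_, M.le b hbn, ?_, ?_⟩
  · intro i; fin_cases i <;> simp <;> assumption
  · have := hamin b hb; have := M.lt b hbn; omega
  · exact fun w hw hww => ⟨hamin w ((hmem w).mpr ⟨hw, hww⟩), hbmax w ((hmem w).mpr ⟨hw, hww⟩)⟩
  · intro j hj hj'
    by_cases c0 : j < hi a
    · exact ⟨0, hj, c0⟩
    by_cases c1 : j < hi u
    · exact ⟨1, by simp; omega, c1⟩
    by_cases c3 : lo b ≤ j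
    · exact ⟨3, c3, hj'⟩
    · exact ⟨2, by simp; omega, by simp; omega⟩

/-- The canonical colouring has a code in every window. -/
theorem exists_decode (hv : 1 ≤ v) (M : IntervalModel n k lo hi) (hkn : k ≤ n)
    (h₂ : ∀ j ≤ 4 * v + 2, p₂ j = 2 ^ j) (hB : ∀ i < 21 * v, pB i = base n v p₂ ^ i)
    {χ : ℕ → ℕ → Prop} (hχ : Good n lo hi v fun u => χ (lo u) (hi u)) {t : ℕ} (ht : t < k) :
    ∃ s < base n v p₂ ^ (21 * v), ∀ u < n, Win n lo hi t u →
      (decode n v p₂ pB lo hi s u ↔ canon v (fun j => χ j (j + 1)) χ (lo u) (hi u)) := by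
  classical
  obtain ⟨w, hw, p, q, hpq, hqk, hwin, hcover⟩ := exists_window M ht
  have hc := fun i => minority M hχ (hw i)
  choose c hc using hc
  set x : ℕ → Prop := fun j => χ j (j + 1) with hx
  set U : Finset ℕ := {p} ∪ Finset.univ.biUnion fun i : Fin 4 =>
    pieceKeys v x (c i) (lo (w i)) (hi (w i)) with hU
  set K := U.filter fun j => p ≤ j ∧ j < q with hKdef
  -- Four pieces and the first position give `4 * (4 * v + 1) + 1`, at most `21 * v` because `1 ≤
  -- v`.
  have hcard : K.card ≤ 21 * v := by
    refine (Finset.card_filter_le _ _).trans ((Finset.card_union_le _ _).trans ?_)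
    have := Finset.card_biUnion_le_card_mul (Finset.univ : Finset (Fin 4))
      (fun i => pieceKeys v x (c i) (lo (w i)) (hi (w i))) (4 * v + 1)
      fun i _ => card_pieceKeys (hc i)
    rw [Finset.card_univ, Fintype.card_fin] at this
    rw [Finset.card_singleton]
    omega
  have hmemK : ∀ i j, p ≤ j → j < q → j ∈ pieceKeys v x (c i) (lo (w i)) (hi (w i)) → j ∈ K :=
    fun i j h1 h2 h3 => Finset.mem_filter.mpr ⟨Finset.mem_union_right _
      (Finset.mem_biUnion.mpr ⟨i, Finset.mem_univ _, h3⟩), h1, h2⟩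
  have hK : IsKeySet v x p q K := by
    refine ⟨fun j hj => (Finset.mem_filter.mp hj).2, ?_, ?_, ?_⟩
    · exact Finset.mem_filter.mpr ⟨Finset.mem_union_left _ (Finset.mem_singleton_self p), le_rfl,
        hpq⟩
    · intro j h1 h2 h3
      obtain ⟨i, h4, h5⟩ := hcover (j - 1) (by omega) (by omega)
      exact hmemK i j h1.le h2 (pieceKeys_toggle (by omega) h4 h5 h3)
    · intro l r h1 h2 h3 h4
      obtain ⟨i, h5, h6⟩ := hcover l h1 (by omega)
      exact (pieceKeys_mixed h2 h5 h6 h4).imp (hmemK i l h1 (by omega))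
        (hmemK i (r - 1) (by omega) (by omega))
  obtain ⟨s, hs, h⟩ := exists_code_of_isKeySet (pB := pB) (by omega) h₂ hB (hqk.trans hkn) hK hcard
  exact ⟨s, hs, fun u hu hwu =>
    h _ _ (hwin u hu hwu).1 (M.lt u hu) (hwin u hu hwu).2⟩

/-- The dynamic program finds out whether there is a good colouring. -/
theorem exists_good_iff (hv : 1 ≤ v) (M : IntervalModel n k lo hi) (hk : 0 < k) (hkn : k ≤ n)
    (h₂ : ∀ j ≤ 4 * v + 2, p₂ j = 2 ^ j) (hB : ∀ i < 21 * v, pB i = base n v p₂ ^ i) :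
    (∃ col, Good n lo hi v col) ↔ ∃ s < base n v p₂ ^ (21 * v),
      Reach n lo hi v (base n v p₂ ^ (21 * v)) (decode n v p₂ pB lo hi) (k - 1) s := by
  constructor
  · rintro ⟨col, hcol⟩
    obtain ⟨χ, hχ⟩ := hcol.exists_interval_color
    exact exists_reach_of_good M (good_canon M hχ hv) hk
      fun t ht => exists_decode hv M hkn h₂ hB hχ ht
  · rintro ⟨s, -, h⟩
    exact good_of_reach M h

/-! #### Claws in terms of codes -/

/-- `Claw` with the leaves given by the digits of a number. -/
def ClawCode (n : ℕ) (lo hi : ℕ → ℕ) (v : ℕ) (p₂ pB : ℕ → ℕ) (col : ℕ → Prop) (u : ℕ) : Prop :=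
  ∃ z < pB (v + 1), (∀ i < v + 1, (z / pB i % base n v p₂ < n ∧
      (col (z / pB i % base n v p₂) ↔ col u)) ∧
      lo (z / pB i % base n v p₂) < hi u ∧ lo u < hi (z / pB i % base n v p₂)) ∧
    ∀ i < v + 1, ∀ j < v + 1, i ≠ j →
      hi (z / pB i % base n v p₂) ≤ lo (z / pB j % base n v p₂) ∨
      hi (z / pB j % base n v p₂) ≤ lo (z / pB i % base n v p₂)

/-- The base is at least `n`, so any `v + 1` vertices are the digits of a number below its power. -/
lemma clawCode_iff (h₂ : 0 < p₂ (4 * v + 2))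
    (hB : ∀ i ≤ v + 1, pB i = base n v p₂ ^ i) {col : ℕ → Prop} {u : ℕ} :
    ClawCode n lo hi v p₂ pB col u ↔ Claw n lo hi v col u := by
  constructor
  · rintro ⟨z, -, h1, h2⟩
    exact ⟨fun i => z / pB i % base n v p₂, fun i hi' => h1 i (by omega),
      fun i hi' j hj hij => h2 i (by omega) j (by omega) hij⟩
  · rintro ⟨w, h1, h2⟩
    have hle : n ≤ base n v p₂ := Nat.le_mul_of_pos_right n h₂
    obtain ⟨z, hz, hdig⟩ := exists_digits (v + 1) w fun i hi' =>
      (h1 i (by omega)).1.1.trans_le hle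
    have e : ∀ i < v + 1, z / pB i % base n v p₂ = w i := fun i hi' => by
      rw [hB i (by omega), hdig i hi']
    refine ⟨z, by rwa [hB _ le_rfl], fun i hi' => ?_, fun i hi' j hj hij => ?_⟩
    · rw [e i hi']; exact h1 i (by omega)
    · rw [e i hi', e j hj]; exact h2 i (by omega) j (by omega) hij

end IntervalColoring

/-! ### Claw numbers and proper interval graphs -/

namespace SimpleGraph

section
variable {V : Type*} {G : SimpleGraph V}

lemma clawNumber_le_iff {v : ℕ} : G.clawNumber ≤ v ↔
    ∀ (c : V) (leaf : Fin (v + 1) → V), Function.Injective leaf → (∀ i, G.Adj c (leaf i)) →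
      ∃ i j, G.Adj (leaf i) (leaf j) := by
  unfold clawNumber
  simp only [iSup_le_iff, Nat.cast_le]
  constructor
  · intro h c leaf hinj hadj
    by_contra hno
    push Not at hno
    have := h (v + 1) ⟨⟨⟨Sum.elim (fun _ => c) leaf, ?_⟩, ?_⟩⟩
    · omega
    · rintro (a | a) (b | b) hab
      · rw [Subsingleton.elim a b]
      · exact absurd hab (hadj b).ne
      · exact absurd hab (hadj a).ne'
      · rw [hinj hab]
    · rintro (a | a) (b | b)
      · change G.Adj c c ↔ _; simp
      · change G.Adj c (leaf b) ↔ _; simpa using hadj b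
      · change G.Adj (leaf a) c ↔ _; simpa using (hadj a).symm
      · change G.Adj (leaf a) (leaf b) ↔ _; simpa using hno a b
  · rintro h w ⟨e⟩
    by_contra hw
    push Not at hw
    obtain ⟨i, j, hij⟩ := h (e (.inl 0)) (fun i => e (.inr (Fin.castLE hw i)))
      (fun i j hij => by simpa using e.injective hij)
      (fun i => e.map_rel_iff.mpr (by simp))
    have := e.map_rel_iff.mp hij
    simp at this

lemma IsIntervalRep.adj_iff {l r : V → ℝ} (h : G.IsIntervalRep l r) {u w : V} :
    G.Adj u w ↔ u ≠ w ∧ l u < r w ∧ l w < r u := by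
  have key : u ≠ w → (G.Adj u w ↔ l u < r w ∧ l w < r u) := by
    intro hne
    rw [h.2 u w hne, Set.Ioo_inter_Ioo, Set.nonempty_Ioo, sup_lt_iff, lt_inf_iff, lt_inf_iff]
    have h1 := h.1 u
    have h2 := h.1 w
    tauto
  constructor
  · exact fun hadj => ⟨hadj.ne, (key hadj.ne).mp hadj⟩
  · exact fun h' => (key h'.1).mpr h'.2

lemma IsIntervalGraph.induce (h : G.IsIntervalGraph) (P : Set V) :
    (G.induce P).IsIntervalGraph := by
  obtain ⟨l, r, h1, h2⟩ := h
  exact ⟨fun u => l u, fun u => r u, fun u => h1 u, fun u w hne =>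
    h2 u w fun h => hne (Subtype.ext h)⟩

/-- Of three disjoint intervals meeting a common one, the middle one lies properly inside it. -/
lemma IsProperIntervalGraph.clawNumber_le (h : G.IsProperIntervalGraph) :
    G.clawNumber ≤ 2 := by
  obtain ⟨l, r, hrep, hprop⟩ := h
  have hlr := hrep.1
  refine clawNumber_le_iff.mpr fun c leaf hinj hadj => ?_
  by_contra hno
  push Not at hno
  have hdisj : ∀ i j, i ≠ j → r (leaf i) ≤ l (leaf j) ∨ r (leaf j) ≤ l (leaf i) := by
    intro i j hij
    by_contra h
    push Not at h
    exact hno i j (hrep.adj_iff.mpr ⟨fun he => hij (hinj he), h.2, h.1⟩)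
  have hmid : ∀ i j k, r (leaf i) ≤ l (leaf j) → r (leaf j) ≤ l (leaf k) → False := by
    intro i j k hij hjk
    have h1 := (hrep.adj_iff.mp (hadj i)).2
    have h2 := (hrep.adj_iff.mp (hadj k)).2
    have h3 := hlr (leaf j)
    refine hprop (leaf j) c ⟨Set.Ioo_subset_Ioo (by linarith) (by linarith), fun hsub => ?_⟩
    rw [Set.Ioo_subset_Ioo_iff (hlr c)] at hsub
    linarith
  have h01 := hdisj 0 1 (by decide)
  have h02 := hdisj 0 2 (by decide)
  have h12 := hdisj 1 2 (by decide)
  rcases h01 with h01 | h01 <;> rcases h02 with h02 | h02 <;> rcases h12 with h12 | h12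
  · exact hmid _ _ _ h01 h12
  · exact hmid _ _ _ h02 h12
  · exact hmid _ _ _ h02 h01
  · exact hmid _ _ _ h02 h01
  · exact hmid _ _ _ h01 h02
  · exact hmid _ _ _ h01 h02
  · exact hmid _ _ _ h12 h02
  · exact hmid _ _ _ h12 h01

/-- An injective numbering of the vertices such that the closed neighbourhoods of all vertices are
consecutive yields a proper interval representation. -/
lemma isProperIntervalGraph_of_umbrella [Finite V] (π : V → ℤ) (hπ : Function.Injective π)
    (humb : ∀ u x w, π u < π x → π x < π w → G.Adj u w → G.Adj u x ∧ G.Adj x w) :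
    G.IsProperIntervalGraph := by
  classical
  have := Fintype.ofFinite V
  obtain ⟨K, hK⟩ : ∃ K : ℤ, ∀ u, |π u| ≤ K := by
    obtain ⟨K, hK⟩ := (Set.finite_range fun u => |π u|).bddAbove
    exact ⟨K, fun u => hK ⟨u, rfl⟩⟩
  have hmem : ∀ u, u ∈ Finset.univ.filter fun w => w = u ∨ G.Adj u w := fun u => by simp
  -- `m u` is the place of the last closed neighbour of `u`. By the umbrella property, the later
  -- neighbours of `u` are exactly the later vertices up to `m u`, and `m` is monotone.
  let m : V → ℤ := fun u => (Finset.univ.filter fun w => w = u ∨ G.Adj u w).sup' ⟨u, hmem u⟩ π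
  have hle : ∀ u w, w = u ∨ G.Adj u w → π w ≤ m u := fun u w h =>
    Finset.le_sup' π (by simpa using h)
  have hex : ∀ u, ∃ w, (w = u ∨ G.Adj u w) ∧ m u = π w := fun u => by
    obtain ⟨w, hw, h⟩ := Finset.exists_mem_eq_sup' ⟨u, hmem u⟩ π
    exact ⟨w, by simpa using hw, h⟩
  have hadj : ∀ u w, π u < π w → (G.Adj u w ↔ π w ≤ m u) := by
    intro u w huw
    refine ⟨fun h => hle u w (.inr h), fun h => ?_⟩
    obtain ⟨w', hw', he⟩ := hex u
    rw [he] at h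
    have hadj' : G.Adj u w' := hw'.resolve_left fun h' => by rw [h'] at h; omega
    rcases h.lt_or_eq with h | h
    · exact (humb u w w' huw h hadj').1
    · rwa [hπ h]
  have hmono : ∀ u w, π u < π w → m u ≤ m w := by
    intro u w huw
    obtain ⟨w', hw', he⟩ := hex u
    rw [he]
    by_cases h : π w' ≤ π w
    · exact h.trans (hle w w (.inl rfl))
    · push Not at h
      have hadj' : G.Adj u w' := hw'.resolve_left fun h' => by rw [h'] at h; omega
      exact hle w w' (.inr (humb u w w' huw h hadj').2)
  -- The summand `π u + K + 1` lies strictly between `0` and `T`: it makes the right ends strictly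
  -- increasing, while `l w < r u` still means `π w ≤ m u`.
  set T : ℤ := 2 * K + 2
  have hb : ∀ u, -K ≤ π u ∧ π u ≤ K := fun u => abs_le.mp (hK u)
  let l : V → ℝ := fun u => ((T * π u : ℤ) : ℝ)
  let r : V → ℝ := fun u => ((T * m u + (π u + K + 1) : ℤ) : ℝ)
  have hT : ∀ u, 0 < T := fun u => by have := hb u; omega
  have hlr : ∀ u, l u < r u := fun u => by
    have h1 := hle u u (.inl rfl)
    have h2 := hb u
    have : T * π u ≤ T * m u := mul_le_mul_of_nonneg_left h1 (hT u).le
    simp only [l, r, Int.cast_lt]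
    omega
  have hr : ∀ u w, π u < π w → r u < r w := fun u w h => by
    have : T * m u ≤ T * m w := mul_le_mul_of_nonneg_left (hmono u w h) (hT u).le
    simp only [r, Int.cast_lt]
    omega
  have hl : ∀ u w, π u < π w → l u < l w := fun u w h => by
    simp only [l, Int.cast_lt]
    exact mul_lt_mul_of_pos_left h (hT u)
  have hmeet : ∀ u w, π u < π w → (G.Adj u w ↔
      (Set.Ioo (l u) (r u) ∩ Set.Ioo (l w) (r w)).Nonempty) := by
    intro u w h
    have h2 := hb u
    have h3 : l w < r u ↔ π w ≤ m u := by
      simp only [l, r, Int.cast_lt]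
      constructor
      · intro h4
        by_contra h5
        push Not at h5
        have : T * (m u + 1) ≤ T * π w := mul_le_mul_of_nonneg_left h5 (hT u).le
        rw [mul_add, mul_one] at this
        omega
      · intro h4
        have : T * π w ≤ T * m u := mul_le_mul_of_nonneg_left h4 (hT u).le
        omega
    rw [hadj u w h, ← h3, Set.Ioo_inter_Ioo, Set.nonempty_Ioo, sup_lt_iff, lt_inf_iff, lt_inf_iff]
    have h4 := hlr u
    have h5 := hlr w
    have h6 := (hl u w h).trans h5
    tauto
  refine ⟨l, r, ⟨hlr, fun u w hne => ?_⟩, fun u w hss => ?_⟩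
  · rcases lt_or_gt_of_ne fun h => hne (hπ h) with h | h
    · exact hmeet u w h
    · rw [G.adj_comm, Set.inter_comm]; exact hmeet w u h
  · have hsub := (Set.Ioo_subset_Ioo_iff (hlr u)).mp hss.1
    rcases lt_trichotomy (π u) (π w) with h | h | h
    · exact absurd (hl u w h) (not_lt.mpr hsub.1)
    · rw [hπ h] at hss; exact hss.2 subset_rfl
    · exact absurd (hr w u h) (not_lt.mpr hsub.2)

/-- Interval graphs of claw number at most two are proper interval graphs. -/
theorem IsIntervalGraph.isProperIntervalGraph [Finite V] (h : G.IsIntervalGraph)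
    (hclaw : G.clawNumber ≤ 2) : G.IsProperIntervalGraph := by
  classical
  have := Fintype.ofFinite V
  obtain ⟨l, r, hrep⟩ := h
  have hlr := hrep.1
  -- An interval meeting the outer two of three successive intervals also meets the middle one and
  -- so is the centre of a claw.
  have hno : ∀ c x y z, r x ≤ l y → r y ≤ l z → l c < r x → l z < r c → False := by
    intro c x y z hxy hyz hcx hcz
    have hx := hlr x
    have hy := hlr y
    have hz := hlr z
    have hxney : x ≠ y := by rintro rfl; linarith
    have hynez : y ≠ z := by rintro rfl; linarith
    have hxnez : x ≠ z := by rintro rfl; linarith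
    obtain ⟨i, j, hij⟩ := clawNumber_le_iff.mp hclaw c ![x, y, z] (by
        intro i j hij
        fin_cases i <;> fin_cases j <;> simp_all) (by
        intro i
        rw [hrep.adj_iff]
        fin_cases i
        · exact ⟨by rintro rfl; simp at *; linarith, hcx, by simp; linarith⟩
        · exact ⟨by rintro rfl; simp at *; linarith, by simp; linarith, by simp; linarith⟩
        · exact ⟨by rintro rfl; simp at *; linarith, by simp; linarith, hcz⟩)
    rw [hrep.adj_iff] at hij
    fin_cases i <;> fin_cases j <;> simp at hij <;> linarith [hij.2.1, hij.2.2]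
  let P : V → Finset V := fun u => Finset.univ.filter fun x => r x ≤ l u
  let S : V → Finset V := fun u => Finset.univ.filter fun x => r u ≤ l x
  have hP : ∀ u x, x ∈ P u ↔ r x ≤ l u := fun u x => by simp [P]
  have hS : ∀ u x, x ∈ S u ↔ r u ≤ l x := fun u x => by simp [S]
  -- The number of intervals before `u` minus the number after it replaces the left-to-right order
  -- of a proper representation.
  let κ : V → ℤ := fun u => (P u).card - (S u).card
  have hPlt : ∀ u w, l u ≤ l w → ∀ x, r x ≤ l w → l u < r x → (P u).card < (P w).card := by
    intro u w huw x h1 h2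
    refine Finset.card_lt_card ⟨fun y hy => ?_, fun hsub => ?_⟩
    · rw [hP] at hy ⊢; linarith
    · have := hsub ((hP w x).mpr h1)
      rw [hP] at this; linarith
  have hSlt : ∀ u w, r w ≤ r u → ∀ x, r w ≤ l x → l x < r u → (S u).card < (S w).card := by
    intro u w huw x h1 h2
    refine Finset.card_lt_card ⟨fun y hy => ?_, fun hsub => ?_⟩
    · rw [hS] at hy ⊢; linarith
    · have := hsub ((hS w x).mpr h1)
      rw [hS] at this; linarith
  have hbefore : ∀ u w, r u ≤ l w → κ u < κ w := by
    intro u w h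
    have hu := hlr u
    have hw := hlr w
    have h1 := hPlt u w (by linarith) u h hu
    have h2 := hSlt w u (by linarith) w h hw
    simp only [κ]
    omega
  -- More intervals precede `x` than `w`, so `κ x ≤ κ w` makes more follow `x` as well. Some `c`
  -- follows `x` but not `w`, and `u, x, c` are leaves at `w`.
  have hright : ∀ u x w, G.Adj u w → r u ≤ l x → κ x ≤ κ w → False := by
    intro u x w hadj hux hκ
    obtain ⟨-, h1, h2⟩ := hrep.adj_iff.mp hadj
    have h3 := hPlt w x (by linarith) u hux h2
    have h4 : (S w).card < (S x).card := by simp only [κ] at hκ; omega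
    obtain ⟨c, hc, hcw⟩ : ∃ c ∈ S x, c ∉ S w := by
      by_contra hall
      push Not at hall
      exact absurd (Finset.card_le_card hall) (by omega)
    rw [hS] at hc hcw
    exact hno w u x c hux hc h2 (not_le.mp hcw)
  have hleft : ∀ u x w, G.Adj u w → r x ≤ l w → κ u ≤ κ x → False := by
    intro u x w hadj hxw hκ
    obtain ⟨-, h1, h2⟩ := hrep.adj_iff.mp hadj
    have h3 := hSlt u x (by linarith) w hxw h2
    have h4 : (P u).card < (P x).card := by simp only [κ] at hκ; omega
    obtain ⟨c, hc, hcu⟩ : ∃ c ∈ P x, c ∉ P u := by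
      by_contra hall
      push Not at hall
      exact absurd (Finset.card_le_card hall) (by omega)
    rw [hP] at hc hcu
    exact hno u c x w hc hxw (not_le.mp hcu) h2
  let ι : V → Fin (Fintype.card V) := Fintype.equivFin V
  -- Ties of `κ` are broken by a numbering whose values are below the factor of `κ`.
  let π : V → ℤ := fun u => κ u * Fintype.card V + (ι u : ℕ)
  have hκle : ∀ u w, π u ≤ π w → κ u ≤ κ w := by
    intro u w h
    by_contra hlt
    push Not at hlt
    have h1 := (ι u).2
    have h2 := (ι w).2
    have h3 : (κ w + 1) * (Fintype.card V : ℤ) ≤ κ u * Fintype.card V :=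
      mul_le_mul_of_nonneg_right hlt (by positivity)
    rw [add_mul, one_mul] at h3
    simp only [π] at h
    omega
  refine isProperIntervalGraph_of_umbrella π (fun u w h => ?_) fun u x w hux hxw hadj => ?_
  · have h1 : κ u = κ w := le_antisymm (hκle _ _ h.le) (hκle _ _ h.ge)
    simp only [π, h1] at h
    have : ι u = ι w := Fin.ext (by omega)
    exact (Fintype.equivFin V).injective this
  · have h1 := hκle _ _ hux.le
    have h2 := hκle _ _ hxw.le
    constructor
    · refine hrep.adj_iff.mpr ⟨by rintro rfl; exact lt_irrefl _ hux, ?_, ?_⟩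
      · by_contra h
        exact absurd (hbefore x u (not_lt.mp h)) (not_lt.mpr h1)
      · by_contra h
        exact hright u x w hadj (not_lt.mp h) h2
    · refine hrep.adj_iff.mpr ⟨by rintro rfl; exact lt_irrefl _ hxw, ?_, ?_⟩
      · by_contra h
        exact absurd (hbefore w x (not_lt.mp h)) (not_lt.mpr h2)
      · by_contra h
        exact hleft u x w hadj (not_lt.mp h) h1

theorem IsIntervalGraph.hasTwoProperIntervalPartition_iff [Finite V] (h : G.IsIntervalGraph) :
    G.HasTwoProperIntervalPartition ↔ G.HasTwoPartition 2 :=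
  exists_congr fun P => and_congr
    ⟨fun h' => h'.clawNumber_le, fun h' => (h.induce P).isProperIntervalGraph h'⟩
    ⟨fun h' => h'.clawNumber_le, fun h' => (h.induce Pᶜ).isProperIntervalGraph h'⟩

end

/-! ### Two-partitions as good colourings of the interval model -/

section
variable {n k v : ℕ} {lo hi : ℕ → ℕ} {G : SimpleGraph (Fin n)}

open IntervalColoring

/-- Since `1 ≤ v` there are two disjoint leaves, so a vertex meeting all leaves is not one of them;
this bridges closed neighbourhoods and adjacency. -/
lemma clawNumber_induce_le_iff (hv : 1 ≤ v) (M : IntervalModel n k lo hi)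
    (hG : ∀ u < n, ∀ w < n, (u = w ∨ G.adjNat u w) ↔ lo u < hi w ∧ lo w < hi u)
    (Q : Set (Fin n)) : (G.induce Q).clawNumber ≤ v ↔
    ∀ (u : ℕ) (hu : u < n), ⟨u, hu⟩ ∈ Q → ¬ ∃ w : ℕ → ℕ,
      (∀ i ≤ v, (∃ h : w i < n, ⟨w i, h⟩ ∈ Q) ∧ lo (w i) < hi u ∧ lo u < hi (w i)) ∧
      ∀ i ≤ v, ∀ j ≤ v, i ≠ j → hi (w i) ≤ lo (w j) ∨ hi (w j) ≤ lo (w i) := by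
  rw [clawNumber_le_iff]
  constructor
  · rintro h u hu huQ ⟨w, hw, hd⟩
    have hwn : ∀ i : Fin (v + 1), w i < n := fun i => (hw i (by omega)).1.1
    have hwQ : ∀ i : Fin (v + 1), ⟨w i, hwn i⟩ ∈ Q := fun i => (hw i (by omega)).1.2
    have hinj : ∀ i j : Fin (v + 1), i ≠ j → w i ≠ w j := by
      intro i j hij he
      have := hd i (by omega) j (by omega) fun h => hij (Fin.ext h)
      have := M.lt _ (hwn i)
      rw [← he] at *
      omega
    obtain ⟨i, j, hij⟩ := h ⟨⟨u, hu⟩, huQ⟩ (fun i => ⟨⟨w i, hwn i⟩, hwQ i⟩)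
      (fun i j hij => by
        by_contra hne
        exact hinj i j hne (by simpa using hij))
      (fun i => by
        have h1 := (hw i (by omega)).2
        rcases (hG u hu (w i) (hwn i)).mpr ⟨h1.2, h1.1⟩ with h2 | ⟨_, _, h2⟩
        · exfalso
          obtain ⟨j, hj, hne⟩ : ∃ j ≤ v, (i : ℕ) ≠ j := by
            by_cases h : (i : ℕ) = 0
            · exact ⟨1, hv, by omega⟩
            · exact ⟨0, by omega, h⟩
          have := hd i (by omega) j hj hne
          have := (hw j hj).2
          subst h2
          omega
        · exact h2)
    have hadj : G.Adj ⟨w i, hwn i⟩ ⟨w j, hwn j⟩ := hij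
    have h1 := (hG _ (hwn i) _ (hwn j)).mp (.inr ⟨_, _, hadj⟩)
    have h2 := hd i (by omega) j (by omega) fun h => hadj.ne (by simp [h])
    omega
  · intro h c leaf hinj hadj
    by_contra hno
    push Not at hno
    let w : ℕ → ℕ := fun i => if h : i < v + 1 then (leaf ⟨i, h⟩ : Fin n) else 0
    have hw : ∀ i (hi' : i < v + 1), w i = (leaf ⟨i, hi'⟩ : Fin n) := fun i hi' => dif_pos hi'
    refine h c.1 c.1.2 c.2 ⟨w, fun i hi' => ?_, fun i hi' j hj hij => ?_⟩
    · rw [hw i (by omega)]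
      refine ⟨⟨Fin.is_lt _, (leaf _).2⟩, ?_⟩
      have h1 : G.Adj c.1 (leaf ⟨i, by omega⟩).1 := hadj ⟨i, by omega⟩
      exact ((hG _ (Fin.is_lt _) _ (Fin.is_lt _)).mp (.inr (adjNat_iff.mpr h1))).symm
    · rw [hw i (by omega), hw j (by omega)]
      have h1 : ¬ G.Adj (leaf ⟨i, by omega⟩).1 (leaf ⟨j, by omega⟩).1 :=
        hno ⟨i, by omega⟩ ⟨j, by omega⟩
      have h2 : (leaf ⟨i, by omega⟩).1 ≠ (leaf ⟨j, by omega⟩).1 := fun h => hij (by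
        simpa using hinj (Subtype.ext h))
      have h3 := (hG _ (leaf ⟨i, by omega⟩).1.2 _ (leaf ⟨j, by omega⟩).1.2).not.mp (by
        rw [adjNat_iff]
        push Not
        exact ⟨fun h => h2 (Fin.ext h), h1⟩)
      omega

theorem hasTwoPartition_iff (hv : 1 ≤ v) (M : IntervalModel n k lo hi)
    (hG : ∀ u < n, ∀ w < n, (u = w ∨ G.adjNat u w) ↔ lo u < hi w ∧ lo w < hi u) :
    G.HasTwoPartition v ↔ ∃ col, Good n lo hi v col := by
  unfold HasTwoPartition
  simp_rw [clawNumber_induce_le_iff hv M hG]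
  constructor
  · rintro ⟨P, h1, h2⟩
    refine ⟨fun u => ∃ h : u < n, ⟨u, h⟩ ∈ P, fun u hu ⟨w, hw, hd⟩ => ?_⟩
    by_cases huP : ⟨u, hu⟩ ∈ P
    · exact h1 u hu huP ⟨w, fun i hi' => ⟨(hw i hi').1.2.mpr ⟨hu, huP⟩, (hw i hi').2⟩, hd⟩
    · refine h2 u hu huP ⟨w, fun i hi' => ⟨⟨(hw i hi').1.1, fun h => ?_⟩, (hw i hi').2⟩, hd⟩
      exact huP ((hw i hi').1.2.mp ⟨_, h⟩).2
  · rintro ⟨col, h⟩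
    refine ⟨{u | col u}, ?_, ?_⟩
    · rintro u hu (huP : col u) ⟨w, hw, hd⟩
      exact h u hu ⟨w, fun i hi' => ⟨⟨(hw i hi').1.1, iff_of_true (hw i hi').1.2 huP⟩,
        (hw i hi').2⟩, hd⟩
    · rintro u hu (huP : ¬ col u) ⟨w, hw, hd⟩
      exact h u hu ⟨w, fun i hi' => ⟨⟨(hw i hi').1.1, iff_of_false (hw i hi').1.2 huP⟩,
        (hw i hi').2⟩, hd⟩

end

end SimpleGraph

/-! ### The algorithm -/

namespace RAM

open LexOrient IntervalColoring

/-- The implication classes stored in table `0`. -/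
def clsTab (H : Mem) (e f : ℕ) : Prop :=
  tab H 0 ((H 1 * H 1 * (H 1 * H 1) + e) * (H 1 * H 1) + f) = 1

/-- The orientation obtained from table `0`. -/
def orientTab (H : Mem) : ℕ → ℕ → Prop := OrientCode (H 1) (adjH H) (clsTab H)

/-- The left ends of the canonical intervals. -/
noncomputable def loTab (H : Mem) : ℕ → ℕ := Backbone.lo (H 1) (adjH H) (orientTab H)

/-- The right ends of the canonical intervals. -/
noncomputable def hiTab (H : Mem) : ℕ → ℕ := Backbone.hi (H 1) (adjH H) (orientTab H)

/-- The local colourings. -/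
def decTab (H : Mem) : ℕ → ℕ → Prop :=
  decode (H 1) (H 0) (tab H 1) (tab H 2) (loTab H) (hiTab H)

/-- The number of codes. -/
def numCodes (H : Mem) : ℕ := tab H 2 (21 * H 0)

/-- The `i`-th entry of table `0`: the algorithm of Warshall. -/
noncomputable def warshallEntry (H : Mem) (i : ℕ) : ℕ :=
  let N := H 1 * H 1
  let m := i / N / N
  let e := i / N % N
  let f := i % N
  ind ((m = 0 ∧ (e = f ∨ ForceCode (H 1) (adjH H) e f)) ∨
    (m ≠ 0 ∧ (tab H 0 (((m - 1) * N + e) * N + f) = 1 ∨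
      (tab H 0 (((m - 1) * N + e) * N + (m - 1)) = 1 ∧
        tab H 0 (((m - 1) * N + (m - 1)) * N + f) = 1))))

/-- The `i`-th entry of a table of powers of `b`. -/
noncomputable def powEntry (H : Mem) (q b i : ℕ) : ℕ :=
  ind (i = 0) + ind (i ≠ 0) * (b * tab H q (i - 1))

/-- `Check` with claws given by numbers. -/
def checkTab (H : Mem) (s t : ℕ) : Prop :=
  ∀ u < H 1, loTab H u = t →
    ¬ ClawCode (H 1) (loTab H) (hiTab H) (H 0) (tab H 1) (tab H 2) (decTab H s) u

/-- The `i`-th entry of table `3`: the dynamic program. -/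
noncomputable def reachEntry (H : Mem) (i : ℕ) : ℕ :=
  let S := numCodes H
  let t := i / S
  let s := i % S
  ind (checkTab H s t ∧ (t = 0 ∨ ∃ s' < S, tab H 3 ((t - 1) * S + s') = 1 ∧
    ∀ w < H 1, Win (H 1) (loTab H) (hiTab H) (t - 1) w ∧ Win (H 1) (loTab H) (hiTab H) t w →
      (decTab H s' w ↔ decTab H s w)))

/-- The answer obtained from table `3`. -/
def answer (H : Mem) : Prop :=
  ∃ s < numCodes H, tab H 3 ((Backbone.len (H 1) (adjH H) - 1) * numCodes H + s) = 1

/-! ### Computability of the ingredients of the algorithm -/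

section
variable {Γ : Type} [Ctx Γ] {f g h : Mem → Γ → ℕ}

/-- As below, the proof mirrors the unfolded definition. Each bounded quantifier adds a variable to
the context, and the number of `weaken`s is the number of quantifiers passed. -/
lemma CompP.nonAdj (hf : Comp f) (hg : Comp g) :
    CompP (fun H γ => NonAdj (H 1) (RAM.adjH H) (f H γ) (g H γ)) := by
  unfold NonAdj
  exact .and (.and (.lt hf .heapOne) (.lt hg .heapOne)) (.and (.ne hf hg) (.not (.adjH hf hg)))

lemma CompP.forceCode (hf : Comp f) (hg : Comp g) :
    CompP (fun H γ => ForceCode (H 1) (RAM.adjH H) (f H γ) (g H γ)) := by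
  unfold ForceCode Force
  have h1 := hf.div .heapOne
  have h2 := hf.mod .heapOne
  have h3 := hg.div .heapOne
  have h4 := hg.mod .heapOne
  exact .and (.and (.nonAdj h1 h2) (.nonAdj h3 h4))
    (.or (.and (.eq h1 h3) (.adjH h2 h4)) (.and (.eq h2 h4) (.adjH h1 h3)))

lemma CompP.clsTab (hf : Comp f) (hg : Comp g) :
    CompP (fun H γ => clsTab H (f H γ) (g H γ)) := by
  unfold RAM.clsTab
  have hN : Comp (fun H (_ : Γ) => H 1 * H 1) := Comp.heapOne.mul .heapOne
  exact .eq (.tab 0 ((((hN.mul hN).add hf).mul hN).add hg)) (.const 1)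

lemma CompP.orientTab (hf : Comp f) (hg : Comp g) :
    CompP (fun H γ => orientTab H (f H γ) (g H γ)) := by
  unfold RAM.orientTab OrientCode
  refine .and (.nonAdj hf hg) (.ex .heapOne (.ex .heapOne (.and (.lt Comp.var.weaken .var) (.and
    (.clsTab ((hf.weaken.weaken.mul .heapOne).add hg.weaken.weaken)
      ((Comp.var.weaken.mul .heapOne).add .var)) (.all .heapOne (.all .heapOne (.imp
        (.lt Comp.var.weaken .var) (.imp (.or
          (.clsTab ((hf.weaken.weaken.weaken.weaken.mul .heapOne).add
            hg.weaken.weaken.weaken.weaken) ((Comp.var.weaken.mul .heapOne).add .var))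
          (.clsTab ((hg.weaken.weaken.weaken.weaken.mul .heapOne).add
            hf.weaken.weaken.weaken.weaken) ((Comp.var.weaken.mul .heapOne).add .var)))
          (.or (.lt Comp.var.weaken.weaken.weaken Comp.var.weaken)
            (.and (.eq Comp.var.weaken.weaken.weaken Comp.var.weaken)
              (.le Comp.var.weaken.weaken .var)))))))))))

lemma CompP.simplicial (hf : Comp f) :
    CompP (fun H γ => Backbone.Simplicial (H 1) (RAM.adjH H) (f H γ)) := by
  unfold Backbone.Simplicial
  exact .and (.lt hf .heapOne) (.all .heapOne (.all .heapOne (.imp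
    (.adjH hf.weaken.weaken Comp.var.weaken) (.imp (.adjH hf.weaken.weaken .var)
      (.imp (.ne Comp.var.weaken .var) (.adjH Comp.var.weaken .var))))))

lemma CompP.isRep (hf : Comp f) :
    CompP (fun H γ => Backbone.IsRep (H 1) (RAM.adjH H) (f H γ)) := by
  unfold Backbone.IsRep
  exact .and (.simplicial hf) (.all hf (.not (.and (.adjH hf.weaken .var) (.simplicial .var))))

lemma Comp.cnt {P : Mem → Γ → ℕ → Prop} (hf : Comp f)
    (hP : CompP (fun H (γ : Γ × ℕ) => P H γ.1 γ.2)) :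
    Comp (fun H γ => cnt (f H γ) (P H γ)) := by
  unfold _root_.cnt
  exact Comp.sum hf (f := fun H γ x => ind (P H γ x)) hP

lemma Comp.loTab (hf : Comp f) : Comp (fun H γ => loTab H (f H γ)) := by
  unfold RAM.loTab Backbone.lo
  exact .cnt .heapOne (.and (.isRep .var) (.orientTab .var hf.weaken))

lemma Comp.hiTab (hf : Comp f) : Comp (fun H γ => hiTab H (f H γ)) := by
  unfold RAM.hiTab Backbone.hi
  exact .cnt .heapOne (.and (.isRep .var) (.not (.orientTab hf.weaken .var)))

lemma Comp.len : Comp (fun H (_ : Γ) => Backbone.len (H 1) (RAM.adjH H)) := by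
  unfold Backbone.len
  exact .cnt .heapOne (.isRep .var)

lemma Comp.base : Comp (fun H (_ : Γ) => base (H 1) (H 0) (RAM.tab H 1)) := by
  unfold IntervalColoring.base
  exact Comp.heapOne.mul (.tab 1 (((Comp.const 4).mul .heapZero).add (.const 2)))

lemma Comp.key (hf : Comp f) (hg : Comp g) :
    Comp (fun H γ => key (H 1) (H 0) (RAM.tab H 1) (RAM.tab H 2) (f H γ) (g H γ)) := by
  unfold IntervalColoring.key
  exact ((hf.div (.tab 2 hg)).mod .base).mod .heapOne

lemma Comp.mask (hf : Comp f) (hg : Comp g) :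
    Comp (fun H γ => mask (H 1) (H 0) (RAM.tab H 1) (RAM.tab H 2) (f H γ) (g H γ)) := by
  unfold IntervalColoring.mask
  exact ((hf.div (.tab 2 hg)).mod .base).div .heapOne

lemma CompP.bit (hf : Comp f) (hg : Comp g) :
    CompP (fun H γ => Bit (RAM.tab H 1) (f H γ) (g H γ)) := by
  unfold Bit
  exact .eq ((hf.div (.tab 1 hg)).mod (.const 2)) (.const 1)

lemma Comp.entries : Comp (fun H (_ : Γ) => 21 * H 0) := (Comp.const 21).mul .heapZero

lemma CompP.posColor (hf : Comp f) (hg : Comp g) :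
    CompP (fun H γ => posColor (H 1) (H 0) (RAM.tab H 1) (RAM.tab H 2) (f H γ) (g H γ)) := by
  unfold IntervalColoring.posColor
  exact .ex .entries (.and (.and (.le (.key hf.weaken .var) hg.weaken)
    (.bit (.mask hf.weaken .var) (.const 0))) (.all .entries (.imp
      (.le (.key hf.weaken.weaken .var) hg.weaken.weaken)
      (.le (.key hf.weaken.weaken .var) (.key hf.weaken.weaken Comp.var.weaken)))))

lemma CompP.shortColor (hf : Comp f) (hg : Comp g) (hh : Comp h) :
    CompP (fun H γ =>
      shortColor (H 1) (H 0) (RAM.tab H 1) (RAM.tab H 2) (f H γ) (g H γ) (h H γ)) := by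
  unfold IntervalColoring.shortColor
  have hd := hh.weaken.sub hg.weaken
  exact .ex .entries (.or
    (.and (.eq (.key hf.weaken .var) hg.weaken)
      (.bit (.mask hf.weaken .var) ((Comp.const 1).add hd)))
    (.and (.eq ((Comp.key hf.weaken .var).add (.const 1)) hh.weaken)
      (.bit (.mask hf.weaken .var)
        ((((Comp.const 2).mul .heapZero).add (.const 1)).add hd))))

lemma CompP.decTab (hf : Comp f) (hg : Comp g) :
    CompP (fun H γ => decTab H (f H γ) (g H γ)) := by
  unfold RAM.decTab decode canon
  have hl := hg.loTab
  have hr := hg.hiTab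
  have hm : CompP (fun H γ => Mixed (H 0)
      (IntervalColoring.posColor (H 1) (H 0) (RAM.tab H 1) (RAM.tab H 2) (f H γ))
      (RAM.loTab H (g H γ)) (RAM.hiTab H (g H γ))) := by
    unfold Mixed
    exact .and (.le hr (hl.add ((Comp.const 2).mul .heapZero)))
      (.not (.iff (.posColor hf hl) (.posColor hf (hr.sub (.const 1)))))
  have hc : Comp (fun H γ => cntIn
      (IntervalColoring.posColor (H 1) (H 0) (RAM.tab H 1) (RAM.tab H 2) (f H γ))
      (IntervalColoring.posColor (H 1) (H 0) (RAM.tab H 1) (RAM.tab H 2) (f H γ)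
        (RAM.loTab H (g H γ))) (RAM.loTab H (g H γ)) (RAM.hiTab H (g H γ))) := by
    unfold cntIn
    exact .cnt hr (.and (.le hl.weaken .var)
      (.iff (.posColor hf.weaken .var) (.posColor hf.weaken hl.weaken)))
  exact .and (.imp hm (.shortColor hf hl hr))
    (.imp hm.not (.iff (.posColor hf hl) (.le hc .heapZero)))

lemma CompP.win (hf : Comp f) (hg : Comp g) :
    CompP (fun H γ => Win (H 1) (RAM.loTab H) (RAM.hiTab H) (f H γ) (g H γ)) := by
  unfold Win
  exact .ex .heapOne (.and (.and (.le (.loTab .var) hf.weaken) (.lt hf.weaken (.hiTab .var)))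
    (.and (.lt hg.weaken.loTab (.hiTab .var)) (.lt (.loTab .var) hg.weaken.hiTab)))

lemma CompP.clawCode (hf : Comp f) (hg : Comp g) :
    CompP (fun H γ => ClawCode (H 1) (RAM.loTab H) (RAM.hiTab H) (H 0) (RAM.tab H 1)
      (RAM.tab H 2) (RAM.decTab H (f H γ)) (g H γ)) := by
  unfold ClawCode
  have hv : ∀ {Δ : Type} [Ctx Δ], Comp (fun H (_ : Δ) => H 0 + 1) := Comp.heapZero.add (.const 1)
  have hw : ∀ {Δ : Type} [Ctx Δ] {z i : Mem → Δ → ℕ}, Comp z → Comp i → Comp (fun H γ =>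
      z H γ / RAM.tab H 2 (i H γ) % IntervalColoring.base (H 1) (H 0) (RAM.tab H 1)) :=
    fun hz hi => (hz.div (.tab 2 hi)).mod .base
  have h1 := hw (Comp.var (Γ := Γ)).weaken Comp.var
  have h2 := hw (Comp.var (Γ := Γ)).weaken.weaken Comp.var.weaken
  have h3 := hw (Comp.var (Γ := Γ)).weaken.weaken Comp.var
  exact .ex (.tab 2 hv) (.and (.all hv (.and (.and (.lt h1 .heapOne)
    (.iff (.decTab hf.weaken.weaken h1) (.decTab hf.weaken.weaken hg.weaken.weaken)))
    (.and (.lt h1.loTab hg.weaken.weaken.hiTab) (.lt hg.weaken.weaken.loTab h1.hiTab))))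
    (.all hv (.all hv (.imp (.ne Comp.var.weaken .var)
      (.or (.le h2.hiTab h3.loTab) (.le h3.hiTab h2.loTab))))))

lemma CompP.checkTab (hf : Comp f) (hg : Comp g) :
    CompP (fun H γ => checkTab H (f H γ) (g H γ)) := by
  unfold RAM.checkTab
  exact .all .heapOne (.imp (.eq (.loTab .var) hg.weaken) (.not (.clawCode hf.weaken .var)))

lemma Comp.numCodes : Comp (fun H (_ : Γ) => numCodes H) := .tab 2 .entries

lemma Comp.warshallEntry (hf : Comp f) : Comp (fun H γ => warshallEntry H (f H γ)) := by
  unfold RAM.warshallEntry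
  have hN : Comp (fun H (_ : Γ) => H 1 * H 1) := Comp.heapOne.mul .heapOne
  have hm := (hf.div hN).div hN
  have hm' := hm.sub (.const 1)
  have he := (hf.div hN).mod hN
  have hr := hf.mod hN
  have h1 := (((hm'.mul hN).add he).mul hN).add hr
  have h2 := (((hm'.mul hN).add he).mul hN).add hm'
  have h3 := (((hm'.mul hN).add hm').mul hN).add hr
  exact CompP.or (.and (.eq hm (.const 0)) (.or (.eq he hr) (.forceCode he hr)))
    (.and (.ne hm (.const 0)) (.or (.eq (.tab 0 h1) (.const 1))
      (.and (.eq (.tab 0 h2) (.const 1)) (.eq (.tab 0 h3) (.const 1)))))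

lemma Comp.powEntry (q : ℕ) (hf : Comp f) (hg : Comp g) :
    Comp (fun H γ => powEntry H q (f H γ) (g H γ)) := by
  unfold RAM.powEntry
  exact (CompP.eq hg (.const 0)).add
    (Comp.mul (CompP.ne hg (.const 0)) (hf.mul (.tab q (hg.sub (.const 1)))))

lemma Comp.reachEntry (hf : Comp f) : Comp (fun H γ => reachEntry H (f H γ)) := by
  unfold RAM.reachEntry
  have hS : ∀ {Δ : Type} [Ctx Δ], Comp (fun H (_ : Δ) => RAM.numCodes H) := .numCodes
  have ht := hf.div hS
  have hs := hf.mod hS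
  have ht' := ht.sub (.const 1)
  exact CompP.and (.checkTab hs ht) (.or (.eq ht (.const 0)) (.ex hS (.and
    (.eq (.tab 3 ((ht'.weaken.mul hS).add .var)) (.const 1)) (.all .heapOne (.imp
      (.and (.win ht'.weaken.weaken .var) (.win ht.weaken.weaken .var))
      (.iff (.decTab Comp.var.weaken .var) (.decTab hs.weaken.weaken .var)))))))

lemma CompP.answer : CompP (fun H (_ : Γ) => answer H) := by
  unfold RAM.answer
  exact .ex .numCodes (.eq (.tab 3 (((Comp.len.sub (.const 1)).mul .numCodes).add .var)) (.const 1))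

end

end RAM

/-! ### Correctness of the tables and the decision procedure -/

namespace RAM

open LexOrient IntervalColoring

/-- Level `m` refers only to the block of level `m - 1`, whose indices are smaller, as
course-of-values recursion demands. -/
lemma warshallEntry_eq {H : Mem} {n N i : ℕ} {A : ℕ → ℕ → Prop} (h1 : H 1 = n)
    (hA : adjH H = A) (hN : N = n * n) (hpos : 0 < N) (hi : i < (N + 1) * N * N)
    (hprev : ∀ j < i, tab H 0 j = ind (warshall (ForceCode n A) (j / N / N) (j / N % N) (j % N))) :
    warshallEntry H i = ind (warshall (ForceCode n A) (i / N / N) (i / N % N) (i % N)) := by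
  have hf : i % N < N := Nat.mod_lt _ hpos
  have he : i / N % N < N := Nat.mod_lt _ hpos
  have hi' : i = (i / N / N * N + i / N % N) * N + i % N := by
    rw [Nat.div_add_mod', Nat.div_add_mod']
  have hmN : i / N / N < N + 1 := by
    apply Nat.div_lt_of_lt_mul
    apply Nat.div_lt_of_lt_mul
    calc i < (N + 1) * N * N := hi
      _ = N * (N * (N + 1)) := by ring
  unfold warshallEntry
  simp only [h1, hA, ← hN]
  generalize i / N / N = m at *
  generalize i / N % N = e at *
  generalize i % N = f at *
  cases m with
  | zero => exact ind_congr (by simp [warshall])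
  | succ m =>
    have hrec : ∀ e f, e < N → f < N →
        (tab H 0 ((m * N + e) * N + f) = 1 ↔ warshall (ForceCode n A) m e f) := by
      intro e' f' he' hf'
      have hlt : (m * N + e') * N + f' < i := by
        have h2 : (m * N + e' + 1) * N ≤ ((m + 1) * N + e) * N :=
          Nat.mul_le_mul_right N (by rw [Nat.succ_mul]; omega)
        rw [Nat.succ_mul] at h2
        omega
      rw [hprev _ hlt, code_div hf', code_mod hf', code_div he', code_mod he', ind_eq_one]
    refine ind_congr ?_
    simp only [Nat.add_sub_cancel]
    rw [hrec e f he hf, hrec e m he (by omega), hrec m f (by omega) hf]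
    simp [warshall]

lemma powEntry_eq {H : Mem} {q b i : ℕ} (hprev : ∀ j < i, tab H q j = b ^ j) :
    powEntry H q b i = b ^ i := by
  unfold powEntry
  cases i with
  | zero => simp [ind]
  | succ i => simp [ind, hprev i (Nat.lt_succ_self i), pow_succ']

/-- The heap holds the implication classes in table `0`. -/
lemma orientTab_eq {H : Mem} {n : ℕ} {A : ℕ → ℕ → Prop} (h1 : H 1 = n) (hA : adjH H = A)
    (hsymm : ∀ ⦃x y⦄, A x y → A y x)
    (htab : ∀ j < (n * n + 1) * (n * n) * (n * n), tab H 0 j =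
      ind (warshall (ForceCode n A) (j / (n * n) / (n * n)) (j / (n * n) % (n * n))
        (j % (n * n)))) : orientTab H = Orient n A := by
  funext a b
  unfold orientTab
  rw [h1, hA]
  refine propext (orientCode_iff hsymm fun e he f hf => ?_)
  unfold clsTab
  rw [h1, htab, code_div hf, code_mod hf, code_div he, code_mod he, ind_eq_one]
  have h2 : (n * n * (n * n) + e + 1) * (n * n) ≤ (n * n + 1) * (n * n) * (n * n) :=
    Nat.mul_le_mul_right _ (by rw [Nat.succ_mul (n * n)]; omega)
  rw [Nat.succ_mul] at h2
  omega

lemma checkTab_iff {H : Mem} {n v : ℕ} {lo hi p₂ pB : ℕ → ℕ} (h1 : H 1 = n) (h0 : H 0 = v)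
    (hlo : loTab H = lo) (hhi : hiTab H = hi) (hp₂ : tab H 1 = p₂) (hpB : tab H 2 = pB)
    (hpos : 0 < p₂ (4 * v + 2)) (hB : ∀ i ≤ v + 1, pB i = base n v p₂ ^ i) {s t : ℕ} :
    checkTab H s t ↔ Check n lo hi v (decode n v p₂ pB lo hi s) t := by
  unfold checkTab Check decTab
  simp only [h1, h0, hlo, hhi, hp₂, hpB]
  refine forall_congr' fun u => forall_congr' fun _ => forall_congr' fun _ => not_congr ?_
  exact clawCode_iff hpos hB

lemma reachEntry_eq {H : Mem} {n v S i : ℕ} {lo hi p₂ pB : ℕ → ℕ} (h1 : H 1 = n) (h0 : H 0 = v)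
    (hlo : loTab H = lo) (hhi : hiTab H = hi) (hp₂ : tab H 1 = p₂) (hpB : tab H 2 = pB)
    (hpos : 0 < p₂ (4 * v + 2)) (hB : ∀ i ≤ v + 1, pB i = base n v p₂ ^ i)
    (hS : pB (21 * v) = S) (hSpos : 0 < S)
    (hprev : ∀ j < i, tab H 3 j =
      ind (Reach n lo hi v S (decode n v p₂ pB lo hi) (j / S) (j % S))) :
    reachEntry H i = ind (Reach n lo hi v S (decode n v p₂ pB lo hi) (i / S) (i % S)) := by
  have hs : i % S < S := Nat.mod_lt _ hSpos
  have hi' : i = i / S * S + i % S := (Nat.div_add_mod' i S).symm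
  have hSc : numCodes H = S := by unfold numCodes; rw [h0, hpB, hS]
  unfold reachEntry
  simp only [hSc, checkTab_iff h1 h0 hlo hhi hp₂ hpB hpos hB, h1, hlo, hhi]
  have hdec : decTab H = decode n v p₂ pB lo hi := by
    unfold decTab; rw [h1, h0, hlo, hhi, hp₂, hpB]
  rw [hdec]
  generalize i / S = t at *
  generalize i % S = s at *
  refine ind_congr ?_
  cases t with
  | zero => simp [Reach]
  | succ t =>
    simp only [Reach, Nat.add_sub_cancel, Nat.succ_ne_zero, false_or]
    refine and_congr_right fun _ => exists_congr fun s' => and_congr_right fun hs' =>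
      and_congr_left fun _ => ?_
    rw [hprev _ (by rw [hi', Nat.succ_mul]; omega), code_div hs', code_mod hs', ind_eq_one]

/-! #### The input -/

section
variable {n : ℕ} (v : ℕ) (G : SimpleGraph (Fin n))

lemma paramGraphInput_zero : paramGraphInput v G 0 = v := by simp [paramGraphInput]

lemma paramGraphInput_one : paramGraphInput v G 1 = n := by simp [paramGraphInput, graphInput]

lemma paramGraphInput_le (a : ℕ) : paramGraphInput v G a ≤ max v (max n 1) := by
  unfold paramGraphInput graphInput
  rw [Function.update_apply]
  split_ifs <;> simp

lemma adjH_paramGraphInput : adjH (paramGraphInput v G) = G.adjNat := by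
  funext a b
  unfold adjH SimpleGraph.adjNat
  rw [paramGraphInput_one]
  refine propext ⟨?_, ?_⟩
  · rintro ⟨⟨ha, hb, hab⟩, h⟩
    unfold paramGraphInput graphInput at h
    rw [Function.update_of_ne (by omega), if_neg (by omega)] at h
    split_ifs at h with h'
    · obtain ⟨i, j, hij, hadj⟩ := h'
      have hij := Nat.add_left_cancel hij
      have h1 : a = i := by rw [← code_div (a := a) hb, hij, code_div j.2]
      have h2 : b = j := by rw [← code_mod (a := a) hb, hij, code_mod j.2]
      subst h1 h2
      exact ⟨ha, hb, hadj⟩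
    · exact absurd rfl h
  · rintro ⟨ha, hb, h⟩
    refine ⟨⟨ha, hb, fun he => h.ne (by simp [he])⟩, ?_⟩
    unfold paramGraphInput graphInput
    rw [Function.update_of_ne (by omega), if_neg (by omega), if_pos ⟨_, _, rfl, h⟩]
    exact one_ne_zero

end

/-- The decision algorithm. -/
theorem exists_decider : ∃ (p : Prog) (c : ℕ), ∀ v : ℕ, 1 ≤ v → ∀ n : ℕ, 1 ≤ n →
    ∀ G : SimpleGraph (Fin n), G.IsVertebrateIntervalGraph →
      p.DecidesWithin (paramGraphInput v G) (G.HasTwoPartition v)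
        ((n * 2 ^ (4 * v + 2)) ^ (21 * v * c)) := by
  have hN : ∀ {Δ : Type} [Ctx Δ], Comp (fun H (_ : Δ) => H 1 * H 1) := Comp.heapOne.mul .heapOne
  obtain ⟨p₀, c₀, hp₀⟩ := exec_tabulate 0 (((hN.add (.const 1)).mul hN).mul hN)
    (Comp.warshallEntry .var)
  obtain ⟨p₁, c₁, hp₁⟩ := exec_tabulate 1
    (((Comp.const 4).mul .heapZero).add (.const 3)) (Comp.powEntry 1 (.const 2) .var)
  obtain ⟨p₂, c₂, hp₂⟩ := exec_tabulate 2
    (((Comp.const 21).mul .heapZero).add (.const 1)) (Comp.powEntry 2 .base .var)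
  obtain ⟨p₃, c₃, hp₃⟩ := exec_tabulate 3 (Comp.len.mul .numCodes) (Comp.reachEntry .var)
  obtain ⟨p₄, c₄, hp₄⟩ := exec_answer CompP.answer
  refine ⟨.seq (.seq (.seq (.seq p₀ p₁) p₂) p₃) p₄, c₀ + c₁ + 1 + c₂ + 1 + c₃ + 1 + c₄ + 1, ?_⟩
  intro v hv n hn G hG
  set A := G.adjNat with hAdef
  have hA : ∀ ⦃x y⦄, A x y → A y x := G.adjNat_symm
  obtain ⟨L, hL⟩ := hG.1.exists_isOrient
  have hD : IsOrient n A (Orient n A) := hL.lex hA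
  have hV := fun u hu w hw h => SimpleGraph.exists_simplicial_near (u := u) (w := w) hG.2 hu hw h
  set lo := Backbone.lo n A (Orient n A) with hlo
  set hi := Backbone.hi n A (Orient n A) with hhi
  set k := Backbone.len n A with hk
  have M : IntervalModel n k lo hi := Backbone.intervalModel hA hD hV
  have hkpos : 0 < k := Backbone.len_pos hA hV hn
  have hkn : k ≤ n := cnt_le _ _
  set B := n * 2 ^ (4 * v + 2) with hBdef
  -- The number of codes bounds `n`, `v` and all table entries, so each stage takes time at most a
  -- fixed power of `Z`.
  set Z := B ^ (21 * v) with hZdef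
  have hB1 : 2 ^ (4 * v + 2) ≤ B := Nat.le_mul_of_pos_left _ hn
  have hBn : n ≤ B := Nat.le_mul_of_pos_right _ (by positivity)
  have hBZ : B ≤ Z := Nat.le_self_pow (by omega) B
  have hv2 : v < 2 ^ (4 * v + 2) := by
    have h1 : 4 * v + 2 < 2 ^ (4 * v + 2) := Nat.lt_two_pow_self
    omega
  have hZ2 : 2 ≤ Z := by
    have h1 : 4 * v + 2 < 2 ^ (4 * v + 2) := Nat.lt_two_pow_self
    omega
  have hBpos : 0 < B := by omega
  set H₀ := paramGraphInput v G with hH₀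
  have h00 : H₀ 0 = v := paramGraphInput_zero v G
  have h01 : H₀ 1 = n := paramGraphInput_one v G
  have h0A : adjH H₀ = A := adjH_paramGraphInput v G
  have h0Z : ∀ a, H₀ a ≤ Z := fun a => (paramGraphInput_le v G a).trans (by omega)
  -- the implication classes
  let F₀ : ℕ → ℕ := fun j => ind (warshall (ForceCode n A) (j / (n * n) / (n * n))
    (j / (n * n) % (n * n)) (j % (n * n)))
  have hF₀ : ∀ j, F₀ j ≤ Z := fun j => (ind_le_one _).trans (by omega)
  obtain ⟨t₀, M₁, ex₀, hr₁, ht₀⟩ := hp₀ H₀ Z F₀ (by omega) hZ2 h0Z (fun j _ => hF₀ j)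
    (fun i hi' => warshallEntry_eq (by rw [setTab_one, h01]) (by rw [adjH_setTab, h0A]) rfl
      (Nat.mul_pos hn hn) (by rwa [h01] at hi')
      fun j hj => tab_setTab_self (by omega) hj) H₀ fun _ _ => rfl
  simp only [h01] at hr₁
  set b₀ := (n * n + 1) * (n * n) * (n * n)
  set H₁ := setTab H₀ 0 F₀ b₀ with hH₁
  have h10 : H₁ 0 = v := by rw [hH₁, setTab_zero, h00]
  have h11 : H₁ 1 = n := by rw [hH₁, setTab_one, h01]
  have h1A : adjH H₁ = A := by rw [hH₁, adjH_setTab, h0A]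
  have h1Z : ∀ a, H₁ a ≤ Z := setTab_le h0Z fun j _ => hF₀ j
  have h1t0 : ∀ j < b₀, tab H₁ 0 j = F₀ j := fun j hj => tab_setTab_self (by omega) hj
  -- the powers of two
  obtain ⟨t₁, M₂, ex₁, hr₂, ht₁⟩ := hp₁ H₁ Z (fun j => 2 ^ j) (by omega) hZ2 h1Z
    (fun j hj => by
      rw [h10] at hj
      exact ((Nat.pow_le_pow_right two_pos (by omega)).trans hB1).trans hBZ)
    (fun i _ => powEntry_eq fun j hj => tab_setTab_self (by omega) hj) M₁ hr₁
  simp only [h10] at hr₂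
  set H₂ := setTab H₁ 1 (fun j => 2 ^ j) (4 * v + 3) with hH₂
  have h20 : H₂ 0 = v := by rw [hH₂, setTab_zero, h10]
  have h21 : H₂ 1 = n := by rw [hH₂, setTab_one, h11]
  have h2A : adjH H₂ = A := by rw [hH₂, adjH_setTab, h1A]
  have h2Z : ∀ a, H₂ a ≤ Z := setTab_le h1Z fun j hj =>
    ((Nat.pow_le_pow_right two_pos (by omega)).trans hB1).trans hBZ
  have h2t0 : ∀ j < b₀, tab H₂ 0 j = F₀ j := fun j hj => by
    rw [hH₂, tab_setTab_of_ne (by omega) (by omega) (by omega), h1t0 j hj]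
  have h2t1 : ∀ j ≤ 4 * v + 2, tab H₂ 1 j = 2 ^ j := fun j hj =>
    tab_setTab_self (by omega) (by omega)
  -- the powers of the base
  have h2b : ∀ i, base (setTab H₂ 2 (fun j => B ^ j) i 1) (setTab H₂ 2 (fun j => B ^ j) i 0)
      (tab (setTab H₂ 2 (fun j => B ^ j) i) 1) = B := fun i => by
    rw [setTab_zero, setTab_one, h20, h21, base, tab_setTab_of_ne (by omega) (by omega) (by omega),
      h2t1 _ le_rfl]
  have hpowB : ∀ j < 21 * v + 1, B ^ j ≤ Z := fun j hj => Nat.pow_le_pow_right hBpos (by omega)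
  obtain ⟨t₂, M₃, ex₂, hr₃, ht₂⟩ := hp₂ H₂ Z (fun j => B ^ j) (by omega) hZ2 h2Z
    (fun j hj => by
      rw [h20] at hj
      exact hpowB j hj)
    (fun i _ => by
      rw [h2b i]
      exact powEntry_eq fun j hj => tab_setTab_self (by omega) hj) M₂ hr₂
  simp only [h20] at hr₃
  set H₃ := setTab H₂ 2 (fun j => B ^ j) (21 * v + 1) with hH₃
  have h30 : H₃ 0 = v := by rw [hH₃, setTab_zero, h20]
  have h31 : H₃ 1 = n := by rw [hH₃, setTab_one, h21]
  have h3A : adjH H₃ = A := by rw [hH₃, adjH_setTab, h2A]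
  have h3Z : ∀ a, H₃ a ≤ Z := setTab_le h2Z hpowB
  have h3t0 : ∀ j < b₀, tab H₃ 0 j = F₀ j := fun j hj => by
    rw [hH₃, tab_setTab_of_ne (by omega) (by omega) (by omega), h2t0 j hj]
  have h3t1 : ∀ j ≤ 4 * v + 2, tab H₃ 1 j = 2 ^ j := fun j hj => by
    rw [hH₃, tab_setTab_of_ne (by omega) (by omega) (by omega), h2t1 j hj]
  have h3base : base n v (tab H₃ 1) = B := by rw [base, h3t1 _ le_rfl]
  have h3t2 : ∀ i ≤ 21 * v, tab H₃ 2 i = base n v (tab H₃ 1) ^ i := fun i hi' => by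
    rw [h3base]; exact tab_setTab_self (by omega) (by omega)
  -- the dynamic program
  have h3S : tab H₃ 2 (21 * v) = Z := by rw [h3t2 _ le_rfl, h3base]
  let F₃ : ℕ → ℕ := fun j => ind (Reach n lo hi v Z
    (decode n v (tab H₃ 1) (tab H₃ 2) lo hi) (j / Z) (j % Z))
  have hF₃ : ∀ j, F₃ j ≤ Z := fun j => (ind_le_one _).trans (by omega)
  have hsz : Backbone.len (H₃ 1) (adjH H₃) * numCodes H₃ = k * Z := by
    rw [h31, h3A, numCodes, h30, h3S]
  have hKtab : ∀ i, ∀ q < 3, tab (setTab H₃ 3 F₃ i) q = tab H₃ q := fun i q hq => by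
    funext j
    exact tab_setTab_of_ne (by omega) (by omega) (by omega) _ _ _
  have hK1 : ∀ i, setTab H₃ 3 F₃ i 1 = n := fun i => by rw [setTab_one, h31]
  have hK0 : ∀ i, setTab H₃ 3 F₃ i 0 = v := fun i => by rw [setTab_zero, h30]
  have hKA : ∀ i, adjH (setTab H₃ 3 F₃ i) = A := fun i => by rw [adjH_setTab, h3A]
  -- Filling table `3` leaves the other tables intact, so the interval model and the codes stay
  -- fixed during the recursion.
  have hKor : ∀ i, orientTab (setTab H₃ 3 F₃ i) = Orient n A := fun i =>
    orientTab_eq (hK1 i) (hKA i) hA fun j hj => by rw [hKtab i 0 (by omega)]; exact h3t0 j hj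
  obtain ⟨t₃, M₄, ex₃, hr₄, ht₃⟩ := hp₃ H₃ Z F₃ (by omega) hZ2 h3Z (fun j _ => hF₃ j)
    (fun i _ => reachEntry_eq (hK1 i) (hK0 i) (by rw [loTab, hK1, hKA, hKor])
      (by rw [hiTab, hK1, hKA, hKor]) (hKtab i 1 (by omega)) (hKtab i 2 (by omega))
      (by rw [h3t1 _ le_rfl]; positivity) (fun i hi' => h3t2 i (by omega)) h3S (by omega)
      fun j hj => tab_setTab_self (by omega) hj) M₃ hr₃
  rw [hsz] at hr₄
  set H₄ := setTab H₃ 3 F₃ (k * Z) with hH₄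
  -- the answer
  obtain ⟨t₄, M₅, ex₄, hans, ht₄⟩ := hp₄ H₄ Z (by rw [hH₄, hK1]; exact hn) hZ2
    (setTab_le h3Z fun j _ => hF₃ j) M₄ hr₄
  have hiff : answer H₄ ↔ G.HasTwoPartition v := by
    rw [SimpleGraph.hasTwoPartition_iff hv M fun u hu w hw => Backbone.near_iff hA hD hV hu hw,
      exists_good_iff hv M hkpos hkn h3t1 fun i hi' => h3t2 i (by omega), h3base]
    unfold answer
    rw [hH₄, hK1, hKA, numCodes, hK0, hKtab _ 2 (by omega), h3S]
    refine exists_congr fun s => and_congr_right fun hs => ?_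
    rw [tab_setTab_self (by omega), ind_eq_one, code_div hs, code_mod hs]
    have h1 : (k - 1 + 1) * Z ≤ k * Z := Nat.mul_le_mul_right Z (by omega)
    rw [Nat.succ_mul] at h1
    exact (Nat.add_lt_add_left hs _).trans_le h1
  refine ⟨_, _, .seq (.seq (.seq (.seq ex₀ ex₁) ex₂) ex₃) ex₄, ?_, fun hQ => ?_, fun hQ => ?_⟩
  · rw [pow_mul]
    exact add_le_pow hZ2 (add_le_pow hZ2 (add_le_pow hZ2 (add_le_pow hZ2 ht₀ ht₁) ht₂) ht₃) ht₄
  · rw [hans, ind_true (hiff.mpr hQ)]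
  · rw [hans, ind_false (hiff.not.mpr hQ)]

end RAM

theorem theorem1 :
    -- one algorithm for all `v ≥ 1`, running in `2 ^ O(v ^ 2) * n ^ O(v)` time
    (∃ (p : RAM.Prog) (C : ℕ), ∀ v : ℕ, 1 ≤ v → ∀ n : ℕ, 1 ≤ n →
      ∀ G : SimpleGraph (Fin n), G.IsVertebrateIntervalGraph →
        p.DecidesWithin (RAM.paramGraphInput v G) (G.HasTwoPartition v)
          (2 ^ (C * v ^ 2) * n ^ (C * v))) ∧
    -- a polynomial-time algorithm for partitioning into two proper interval graphs
    (∃ (p : RAM.Prog) (C : ℕ), ∀ n : ℕ, 1 ≤ n →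
      ∀ G : SimpleGraph (Fin n), G.IsVertebrateIntervalGraph →
        p.DecidesWithin (RAM.graphInput G) G.HasTwoProperIntervalPartition
          (C * n ^ C)) := by
  obtain ⟨p, c, hp⟩ := RAM.exists_decider
  have hbound : ∀ v n : ℕ, 1 ≤ v → 1 ≤ n → (n * 2 ^ (4 * v + 2)) ^ (21 * v * c) ≤
      2 ^ (126 * c * v ^ 2) * n ^ (126 * c * v) := by
    intro v n hv hn
    rw [mul_pow, mul_comm, ← pow_mul]
    refine Nat.mul_le_mul (Nat.pow_le_pow_right two_pos ?_) (Nat.pow_le_pow_right hn ?_)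
    -- `126 = 6 * 21`, with `4 * v + 2 ≤ 6 * v` from `1 ≤ v`.
    · calc (4 * v + 2) * (21 * v * c) ≤ (6 * v) * (21 * v * c) :=
            Nat.mul_le_mul_right _ (by omega)
        _ = 126 * c * v ^ 2 := by ring
    · calc 21 * v * c ≤ 126 * v * c := Nat.mul_le_mul_right _ (by omega)
        _ = 126 * c * v := by ring
  refine ⟨⟨p, 126 * c, fun v hv n hn G hG => ?_⟩,
    -- Writing `2` into cell `0` produces `paramGraphInput 2 G` by definition, at cost `3`.
    ⟨.seq (.write (.const 0) (.const 2)) p, 3 + 2 ^ (126 * c * 4) + 126 * c * 2,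
      fun n hn G hG => ?_⟩⟩
  · obtain ⟨t, M, ex, ht, h⟩ := hp v hv n hn G hG
    exact ⟨t, M, ex, ht.trans (hbound v n hv hn), h⟩
  · obtain ⟨t, M, ex, ht, h⟩ := hp 2 one_le_two n hn G hG
    rw [← hG.1.hasTwoProperIntervalPartition_iff] at h
    refine ⟨_, M, .seq (.write _ _ _) ex, ?_, h⟩
    have h1 := ht.trans (hbound 2 n one_le_two hn)
    have h2 : 1 ≤ n ^ (126 * c * 2) := Nat.one_le_pow _ _ hn
    calc RAM.Term.cost (.const 0) + RAM.Term.cost (.const 2) + 1 + t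
        ≤ 3 * n ^ (126 * c * 2) + 2 ^ (126 * c * 4) * n ^ (126 * c * 2) := by
          refine Nat.add_le_add ?_ h1
          simp only [RAM.Term.cost]
          omega
      _ = (3 + 2 ^ (126 * c * 4)) * n ^ (126 * c * 2) := by ring
      _ ≤ _ := Nat.mul_le_mul (Nat.le_add_right _ _) (Nat.pow_le_pow_right hn (Nat.le_add_left _ _))
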